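/- Let $d\ge 1$ and $\mathbb{T}^d=(\mathbb{R}/2\pi\mathbb{Z})^d$. Let $s_0,b_0,b_1$ be real numbers with $$s_0>\max\left(0,\tfrac d2-1\right),\qquad \tfrac12<b_0<\min\left(\tfrac12+\tfrac14\left(s_0-\tfrac d2+1\right),\tfrac34\right),\qquad b_1=1-b_0.$$ Write $\langle x\rangle=(1+|x|^2)^{1/2}$ and, for $f$ on $\mathbb{T}^d$ and $k\in\mathbb{Z}^d$, $\widehat f(k)=(2\pi)^{-d}\int_{\mathbb{T}^d}f(x)e^{-i\langle k,x\rangle}\,dx$. For $\tau\in(0,1]$ let $\Pi_\tau f=\sum_{k\in\mathbb{Z}^d,\ \max_j|k_j|\le\tau^{-1/2}}\widehat f(k)e^{i\langle k,x\rangle}$. For a sequence $(u_n)_{n\in\mathbb{Z}}$ of functions on $\mathbb{T}^d$ let $$\|u_n\|_{l^4_\tau L^4}=\Big(\tau\sum_{n\in\mathbb{Z}}\|u_n\|_{L^4(\mathbb{T}^d)}^4\Big)^{1/4},\qquad \widetilde{u_n}(\sigma,k)=\tau\sum_{m\in\mathbb{Z}}\widehat{u_m}(k)e^{im\tau\sigma},$$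 where for each $k$ the series is taken in $L^2$ of the period $\sigma\in(-\pi/\tau,\pi/\tau]$, and $$\|u_n\|_{X^{s,b}_\tau}=\Big(\sum_{k\in\mathbb{Z}^d}\int_{-\pi/\tau}^{\pi/\tau}\langle k\rangle^{2s}\,\langle d_\tau(\sigma-|k|^2)\rangle^{2b}\,|\widetilde{u_n}(\sigma,k)|^2\,d\sigma\Big)^{1/2},\qquad d_\tau(\sigma)=\frac{e^{i\tau\sigma}-1}{\tau};$$ for $s,b\ge0$, the space $X^{s,b}_\tau$ consists of the sequences of integrable functions for which this norm is finite. Then there is a constant $C$, depending only on $d,s_0,b_0$ (and in particular not on $\tau$), such that for every $\tau\in(0,1]$: 1. for all $(u_n)_n\in X^{s_0/2,b_1}_\tau$, $$\|\Pi_\tau u_n\|_{l^4_\tau L^4}\le C\,\|u_n\|_{X^{s_0/2,b_1}_\tau};$$ 2. for all $(u_{n,1})_n,(u_{n,2})_n,(u_{n,3})_n\in X^{s_0,b_1}_\tau$, $$\|\Pi_\tau(\Pi_\tau u_{n,1}\,\Pi_\tau\overline{u}_{n,2}\,\Pi_\tau u_{n,3})\|_{X^{s_0,-b_1}_\tau}\le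 C\,\|u_{n,1}\|_{X^{s_0,b_1}_\tau}\|u_{n,2}\|_{X^{s_0,b_1}_\tau}\|u_{n,3}\|_{X^{s_0,b_1}_\tau};$$ 3. for every permutation $\pi$ of $\{1,2,3\}$ and all $(u_{n,i})_n$, $i=1,2,3$, with $(u_{n,\pi(1)})_n,(u_{n,\pi(2)})_n\in X^{s_0,b_1}_\tau$ and $(u_{n,\pi(3)})_n\in X^{0,b_1}_\tau$, $$\|\Pi_\tau(\Pi_\tau u_{n,1}\,\Pi_\tau\overline{u}_{n,2}\,\Pi_\tau u_{n,3})\|_{X^{0,-b_1}_\tau}\le C\,\|u_{n,\pi(1)}\|_{X^{s_0,b_1}_\tau}\|u_{n,\pi(2)}\|_{X^{s_0,b_1}_\tau}\|u_{n,\pi(3)}\|_{X^{0,b_1}_\tau}.$$ -/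

import Mathlib

open MeasureTheory
open scoped ENNReal NNReal

noncomputable section

namespace DiscBourgain

instance fact_two_pi_pos : Fact ((0 : ℝ) < 2 * Real.pi) := ⟨Real.two_pi_pos⟩

/-- The torus `𝕋^d = (ℝ / 2πℤ)^d`; its `volume` is Lebesgue measure, of total mass `(2π)^d`. -/
abbrev Torus (d : ℕ) : Type := Fin d → AddCircle (2 * Real.pi)

/-- The Japanese bracket `⟨x⟩ = (1 + |x|²)^{1/2}`. -/
def bracket {E : Type*} [Norm E] (x : E) : ℝ := (1 + ‖x‖ ^ 2) ^ (1 / 2 : ℝ)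

/-- A frequency `k ∈ ℤ^d` as a vector of Euclidean space, so that `‖freqVec k‖ = |k|`. -/
def freqVec {d : ℕ} (k : Fin d → ℤ) : EuclideanSpace ℝ (Fin d) :=
  WithLp.toLp 2 fun j => (k j : ℝ)

/-- The character `e^{i⟨k,x⟩}` of the torus. -/
def character {d : ℕ} (k : Fin d → ℤ) (x : Torus d) : ℂ := ∏ j, fourier (k j) (x j)

/-- On representatives, `character k` is `x ↦ e^{i⟨k,x⟩}`. -/
theorem character_coe {d : ℕ} (k : Fin d → ℤ) (x : Fin d → ℝ) :
    character k (fun j => (x j : AddCircle (2 * Real.pi))) =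
      Complex.exp (Complex.I * ∑ j, (k j : ℂ) * (x j : ℂ)) := by
  simp only [character, fourier_coe_apply, Finset.mul_sum, Complex.exp_sum]
  refine Finset.prod_congr rfl fun j _ => ?_
  congr 1
  have : (Real.pi : ℂ) ≠ 0 := by exact_mod_cast Real.pi_ne_zero
  push_cast
  field_simp

/-- The Fourier coefficient `f̂(k) = (2π)^{-d} ∫_{𝕋^d} f(x) e^{-i⟨k,x⟩} dx`. -/
def spaceCoeff {d : ℕ} (f : Torus d → ℂ) (k : Fin d → ℤ) : ℂ :=
  (1 / (2 * Real.pi) ^ d : ℂ) * ∫ x, f x * character (-k) x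

/-- The frequencies kept by the filter: `k ∈ ℤ^d` with `τ^{1/2} k ∈ [-1,1]^d`. -/
def filterSet (d : ℕ) (τ : ℝ) : Finset (Fin d → ℤ) :=
  Fintype.piFinset fun _ => Finset.Icc (-⌊τ ^ (-(1 / 2) : ℝ)⌋) ⌊τ ^ (-(1 / 2) : ℝ)⌋

theorem mem_filterSet {d : ℕ} {τ : ℝ} {k : Fin d → ℤ} :
    k ∈ filterSet d τ ↔ ∀ j, |(k j : ℝ)| ≤ τ ^ (-(1 / 2) : ℝ) := by
  simp only [filterSet, Fintype.mem_piFinset, Finset.mem_Icc, abs_le]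
  refine forall_congr' fun j => ?_
  rw [neg_le, Int.le_floor, Int.le_floor]
  push_cast
  rw [neg_le]

/-- The frequency filter `Π_τ = χ(-i∇ / τ^{-1/2})`, with `χ` the characteristic function of the
cube `[-1,1]^d`. -/
def filterOp {d : ℕ} (τ : ℝ) (f : Torus d → ℂ) (x : Torus d) : ℂ :=
  ∑ k ∈ filterSet d τ, spaceCoeff f k * character k x

/-- Lebesgue measure `dσ` on the period `(-π/τ, π/τ]` of the time frequency. -/
def timeFreqMeasure (τ : ℝ) : Measure ℝ :=
  volume.restrict (Set.Ioc (-(Real.pi / τ)) (Real.pi / τ))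

instance (τ : ℝ) : IsFiniteMeasure (timeFreqMeasure τ) := by
  unfold timeFreqMeasure
  infer_instance

/-- The function `σ ↦ e^{imτσ}`. -/
def timeMode (τ : ℝ) (m : ℤ) (σ : ℝ) : ℂ := Complex.exp (Complex.I * m * τ * σ)

theorem memLp_timeMode (τ : ℝ) (m : ℤ) : MemLp (timeMode τ m) 2 (timeFreqMeasure τ) := by
  refine MemLp.of_bound (C := 1) ?_ (Filter.Eventually.of_forall fun σ => ?_)
  · refine Continuous.aestronglyMeasurable ?_
    unfold timeMode
    fun_prop
  · have h : Complex.I * m * τ * σ = ((m * τ * σ : ℝ) : ℂ) * Complex.I := by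
      push_cast
      ring
    rw [timeMode, h, Complex.norm_exp_ofReal_mul_I]

/-- The `m`-th term `τ û_m(k) e^{imτσ}` of the time-space Fourier series, as an element of
`L²(dσ)` over one period. -/
def transformTerm {d : ℕ} (τ : ℝ) (u : ℤ → Torus d → ℂ) (k : Fin d → ℤ) (m : ℤ) :
    Lp ℂ 2 (timeFreqMeasure τ) :=
  (τ * spaceCoeff (u m) k : ℂ) • (memLp_timeMode τ m).toLp (timeMode τ m)

/-- The time-space Fourier transform `ũ(σ,k) = τ ∑_m û_m(k) e^{imτσ}`, the series being summed
in `L²(dσ)` over one period, for each `k`. -/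
def transform {d : ℕ} (τ : ℝ) (u : ℤ → Torus d → ℂ) (k : Fin d → ℤ) :
    Lp ℂ 2 (timeFreqMeasure τ) :=
  ∑' m, transformTerm τ u k m

/-- `d_τ(σ) = (e^{iτσ} - 1) / τ`. -/
def dTau (τ σ : ℝ) : ℂ := (Complex.exp (Complex.I * τ * σ) - 1) / τ

open Classical in
/-- The norm `‖⟨k⟩^s ⟨d_τ(σ - |k|²)⟩^b ũ(σ,k)‖_{L²l²}` of `X^{s,b}_τ`, with values in `[0,∞]`.
It is `∞` if one of the series defining `ũ(·,k)` does not converge in `L²`. -/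
def bourgainNorm {d : ℕ} (τ s b : ℝ) (u : ℤ → Torus d → ℂ) : ℝ≥0∞ :=
  if ∀ k, Summable (transformTerm τ u k) then
    (∑' k : Fin d → ℤ, ∫⁻ σ,
      ENNReal.ofReal (bracket (freqVec k) ^ s * bracket (dTau τ (σ - ‖freqVec k‖ ^ 2)) ^ b *
        ‖transform τ u k σ‖) ^ 2 ∂(timeFreqMeasure τ)) ^ (1 / 2 : ℝ)
  else ∞

/-- Membership in `X^{s,b}_τ` (used for `s, b ≥ 0`): a sequence of functions on the torus, each
integrable so that it has Fourier coefficients, of finite norm. -/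
def MemBourgain {d : ℕ} (τ s b : ℝ) (u : ℤ → Torus d → ℂ) : Prop :=
  (∀ n, Integrable (u n)) ∧ bourgainNorm τ s b u < ∞

/-- The norm `‖u_n‖_{l^p_τ L^p} = (τ ∑_n ‖u_n‖_{L^p}^p)^{1/p}` for `0 < p < ∞`. -/
def seqLpNorm {d : ℕ} (p : ℝ≥0) (τ : ℝ) (u : ℤ → Torus d → ℂ) : ℝ≥0∞ :=
  (ENNReal.ofReal τ * ∑' n, eLpNorm (u n) p volume ^ (p : ℝ)) ^ (1 / (p : ℝ))

/-- The filtered cubic term `Π_τ(Π_τ u_{n,1} Π_τ ū_{n,2} Π_τ u_{n,3})`. -/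
def cubic {d : ℕ} (τ : ℝ) (u : Fin 3 → ℤ → Torus d → ℂ) (n : ℤ) : Torus d → ℂ :=
  filterOp τ fun x =>
    filterOp τ (u 0 n) x * filterOp τ (fun y => starRingEnd ℂ (u 1 n y)) x * filterOp τ (u 2 n) x

end DiscBourgain

end

open DiscBourgain

noncomputable section

namespace DiscBourgain

/-! ### Representations as a sum of two squares -/

/-! All three estimates reduce to one bilinear bound on the group of frequencies `(ℝ/(2π/τ)ℤ) ×
ℤ^d`, uniform in `τ`: for functions supported in the filter, the `L²` norm of `f * g` is controlled
by `f` in the weight `⟨k⟩^s ⟨d_τ(σ-|k|²)⟩^b` and `g` in the same weight with `s = 0`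
(`BilinearBound`). By Cauchy–Schwarz this follows from a uniform bound on the convolution of the
inverse squared weights (`exists_lintegral_weight_le`).

In that convolution the time integral is elementary: `|d_τ|` is comparable to the circle norm, and
`(1+|·|)^{-2b}` convolved with itself is `O((1+|·|)^{-γ})` with `γ = 4b-1`. It is evaluated at `σ -
|p|² - |k-p|²`, where `|p|² + |k-p|² = |k|²/2 + |2p-k|²/2`. The filter forces this sum to be
`O(1/τ)`, so the periodicity in `σ` only produces a number of translates that depends on `d` alone.
What remains is to bound `∑_p ⟨p⟩^{-2s} (1+|c-|2p-k|²/2|)^{-γ}` uniformly in `c` and `k`, which is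
possible when `d/2 < s + γ` (`exists_tsum_lattice_le`). The upper bounds on `b₀` give exactly this
condition and `γ > 0`.

The lattice sum in dimension two rests on arithmetic: a circle carries `O(R^ε)` points `p` with `1 +
|p|² ≤ R`, wherever its centre is. If there are three such points, the area of their triangle bounds
the radius by a power of `R`, and the divisor bound in the Gaussian integers applies. Dimension one
only needs square roots; higher dimensions peel off coordinates.

From the bilinear bound: the `L⁴` estimate comes from `‖u‖₄⁴ = ‖u²‖₂²` and Plancherel, with the
derivatives shared equally. The trilinear estimates come by duality: the pairing of `h` with the
cubic term is an inner product of two bilinear expressions, each controlled by the bilinear bound.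
Complex conjugation is harmless because only moduli enter, and reflecting one factor of a
convolution of nonnegative functions preserves its `L²` norm. -/

theorem GaussianInt.mem_units_of_norm_eq_one {z : GaussianInt} (hz : z.norm = 1) :
    z ∈ ({⟨1, 0⟩, ⟨-1, 0⟩, ⟨0, 1⟩, ⟨0, -1⟩} : Finset GaussianInt) := by
  obtain ⟨x, y⟩ := z
  simp only [Zsqrtd.norm_def] at hz
  have h1 : x ^ 2 + y ^ 2 = 1 := by linarith
  have hx : x ^ 2 ≤ 1 := by nlinarith [sq_nonneg y]
  have hy : y ^ 2 ≤ 1 := by nlinarith [sq_nonneg x]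
  have hx1 : -1 ≤ x ∧ x ≤ 1 := abs_le.1 (by rwa [← sq_le_one_iff_abs_le_one])
  have hy1 : -1 ≤ y ∧ y ≤ 1 := abs_le.1 (by rwa [← sq_le_one_iff_abs_le_one])
  obtain ⟨a1, a2⟩ := hx1
  obtain ⟨c1, c2⟩ := hy1
  interval_cases x <;> interval_cases y <;> simp_all

/-- Since `q` divides `z * star z = p ^ e`, either `q` or `star q` divides `z`. Dividing it out
lowers the exponent because `q` is not a unit, so induction on `e` applies. -/
theorem GaussianInt.exists_prime_pow_form {p : ℕ} {q : GaussianInt} (hq : Prime q)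
    (hqp : q ∣ (p : GaussianInt)) (hp : p.Prime) (e : ℕ) (z : GaussianInt)
    (hz : z.norm = (p : ℤ) ^ e) :
    ∃ w : GaussianInt, w.norm = 1 ∧ ∃ a ≤ e, ∃ b ≤ e, z = w * q ^ a * star q ^ b := by
  induction e using Nat.strong_induction_on generalizing z with
  | _ e ih =>
  rcases Nat.eq_zero_or_pos e with rfl | he
  · exact ⟨z, by simpa using hz, 0, le_rfl, 0, le_rfl, by simp⟩
  have hzz : z * star z = ((p ^ e : ℕ) : GaussianInt) := by
    rw [← Zsqrtd.norm_eq_mul_conj, hz]; push_cast; rfl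
  have hqd : q ∣ z * star z := by
    rw [hzz]; push_cast
    exact hqp.trans (dvd_pow_self _ he.ne')
  have hstar : star q ∣ z ∨ q ∣ z := by
    rcases hq.dvd_or_dvd hqd with h | h
    · exact Or.inr h
    · left
      obtain ⟨c, hc⟩ := h
      exact ⟨star c, by rw [← star_star z, hc, star_mul']⟩
  have key : ∀ r w : GaussianInt, r.norm = q.norm → z = r * w →
      ∃ e' < e, w.norm = (p : ℤ) ^ e' := by
    intro r w hr hzw
    have hn : q.norm * w.norm = (p : ℤ) ^ e := by rw [← hz, hzw, Zsqrtd.norm_mul, hr]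
    have hwn : 0 ≤ w.norm := GaussianInt.norm_nonneg w
    have hqn : 0 ≤ q.norm := GaussianInt.norm_nonneg q
    lift w.norm to ℕ using hwn with wn hwn
    lift q.norm to ℕ using hqn with qn hqn'
    have hn' : qn * wn = p ^ e := by exact_mod_cast hn
    obtain ⟨e', he', rfl⟩ := (Nat.dvd_prime_pow hp).1 (Dvd.intro_left _ hn')
    refine ⟨e', lt_of_le_of_ne he' ?_, by push_cast; rfl⟩
    rintro rfl
    have : qn = 1 := by
      have hpos : 0 < p ^ e' := pow_pos hp.pos _
      exact Nat.eq_of_mul_eq_mul_right hpos (by simpa using hn')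
    apply hq.not_isUnit
    rw [Zsqrtd.isUnit_iff_norm_isUnit]
    rw [← hqn', this]; simp
  rcases hstar with ⟨c, hc⟩ | ⟨c, hc⟩
  · obtain ⟨e', he', hn⟩ := key _ c (Zsqrtd.norm_conj q) hc
    obtain ⟨w, hw, a, ha, b, hb, rfl⟩ := ih e' he' c hn
    exact ⟨w, hw, a, by omega, b + 1, by omega, by rw [hc]; ring⟩
  · obtain ⟨e', he', hn⟩ := key _ c rfl hc
    obtain ⟨w, hw, a, ha, b, hb, rfl⟩ := ih e' he' c hn
    exact ⟨w, hw, a + 1, by omega, b, by omega, by rw [hc]; ring⟩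

/-- Four units and two exponents in `[0, e]`. The count is crude, but any bound polynomial in `e`
suffices, so split and inert primes need not be separated. -/
theorem GaussianInt.exists_cover_prime_pow {p : ℕ} (hp : p.Prime) (e : ℕ) :
    ∃ s : Finset GaussianInt, s.card ≤ 4 * (e + 1) ^ 2 ∧
      ∀ z : GaussianInt, z.norm = ((p ^ e : ℕ) : ℤ) → z ∈ s := by
  have hnu : ¬ IsUnit (p : GaussianInt) := by
    rw [Zsqrtd.isUnit_iff_norm_isUnit, Zsqrtd.norm_natCast, Int.isUnit_iff]
    have := hp.two_le
    rintro (h | h) <;> nlinarith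
  have hn0 : (p : GaussianInt) ≠ 0 := by exact_mod_cast hp.ne_zero
  obtain ⟨q, hq, hqp⟩ := WfDvdMonoid.exists_irreducible_factor hnu hn0
  refine ⟨(({⟨1, 0⟩, ⟨-1, 0⟩, ⟨0, 1⟩, ⟨0, -1⟩} : Finset GaussianInt) ×ˢ
    (Finset.range (e + 1) ×ˢ Finset.range (e + 1))).image
      fun t => t.1 * q ^ t.2.1 * star q ^ t.2.2, ?_, ?_⟩
  · refine Finset.card_image_le.trans ?_
    rw [Finset.card_product, Finset.card_product, Finset.card_range, sq]
    exact Nat.mul_le_mul_right _ Finset.card_le_four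
  · intro z hz
    obtain ⟨w, hw, a, ha, b, hb, rfl⟩ :=
      GaussianInt.exists_prime_pow_form hq.prime hqp hp e z (by rw [hz]; push_cast; rfl)
    refine Finset.mem_image.2 ⟨(w, a, b), ?_, rfl⟩
    simp only [Finset.mem_product, Finset.mem_range]
    exact ⟨GaussianInt.mem_units_of_norm_eq_one hw, by omega, by omega⟩

/-- A divisor `z` of `a * b` factors as `x * y` with `x ∣ a` and `y ∣ b`. The norm of `x` divides
`a²`, hence is coprime to `b`, hence divides `a`; likewise the norm of `y` divides `b`. Their
product is `a * b`, so both are equalities. -/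
theorem GaussianInt.exists_cover_mul {a b : ℕ} (hab : a.Coprime b) (ha : a ≠ 0) (hb : b ≠ 0)
    {s t : Finset GaussianInt}
    (hs : ∀ z : GaussianInt, z.norm = (a : ℤ) → z ∈ s)
    (ht : ∀ z : GaussianInt, z.norm = (b : ℤ) → z ∈ t) :
    ∃ r : Finset GaussianInt, r.card ≤ s.card * t.card ∧
      ∀ z : GaussianInt, z.norm = ((a * b : ℕ) : ℤ) → z ∈ r := by
  refine ⟨Finset.image₂ (· * ·) s t, Finset.card_image₂_le _ _ _, fun z hz => ?_⟩
  have hdvd : z ∣ (a : GaussianInt) * (b : GaussianInt) := by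
    refine ⟨star z, ?_⟩
    rw [← Zsqrtd.norm_eq_mul_conj, hz]; push_cast; rfl
  obtain ⟨x, y, ⟨x', hx⟩, ⟨y', hy⟩, rfl⟩ := exists_dvd_and_dvd_of_dvd_mul hdvd
  have hxn : x.norm * x'.norm = (a : ℤ) * a := by
    rw [← Zsqrtd.norm_mul, ← hx, Zsqrtd.norm_natCast]
  have hyn : y.norm * y'.norm = (b : ℤ) * b := by
    rw [← Zsqrtd.norm_mul, ← hy, Zsqrtd.norm_natCast]
  rw [Zsqrtd.norm_mul] at hz
  have h1 := GaussianInt.norm_nonneg x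
  have h2 := GaussianInt.norm_nonneg y
  have h3 := GaussianInt.norm_nonneg x'
  have h4 := GaussianInt.norm_nonneg y'
  have hsx := hs x
  have hty := ht y
  generalize x.norm = nx at *
  generalize y.norm = ny at *
  generalize x'.norm = nx' at *
  generalize y'.norm = ny' at *
  lift nx to ℕ using h1
  lift ny to ℕ using h2
  lift nx' to ℕ using h3
  lift ny' to ℕ using h4
  norm_cast at hz hxn hyn hsx hty
  have c1 : nx.Coprime b := by
    refine Nat.Coprime.of_dvd_left (Dvd.intro _ hxn) (Nat.Coprime.mul_left hab hab)
  have c2 : ny.Coprime a := by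
    refine Nat.Coprime.of_dvd_left (Dvd.intro _ hyn) (Nat.Coprime.mul_left hab.symm hab.symm)
  have d1 : nx ∣ a := c1.dvd_of_dvd_mul_right (Dvd.intro _ hz)
  have d2 : ny ∣ b := c2.dvd_of_dvd_mul_left (Dvd.intro_left _ hz)
  have l1 := Nat.le_of_dvd (Nat.pos_of_ne_zero ha) d1
  have l2 := Nat.le_of_dvd (Nat.pos_of_ne_zero hb) d2
  have pa := Nat.pos_of_ne_zero ha
  have pb := Nat.pos_of_ne_zero hb
  have e1 : nx = a := by nlinarith
  have e2 : ny = b := by nlinarith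
  exact Finset.mem_image₂.2 ⟨x, hsx e1, y, hty e2, rfl⟩

theorem exists_sq_le_mul_pow {x : ℝ} (hx : 1 < x) :
    ∃ A : ℝ, 1 ≤ A ∧ ∀ e : ℕ, 4 * ((e : ℝ) + 1) ^ 2 ≤ A * x ^ e := by
  have h := (isLittleO_pow_const_const_pow_of_one_lt (R := ℝ) 2 hx).isBigO
  have h' : (fun n : ℕ => ((n : ℝ) + 1) ^ 2) =O[Filter.atTop] fun n : ℕ => x ^ n := by
    have := h.comp_tendsto (Filter.tendsto_add_atTop_nat 1)
    refine Asymptotics.IsBigO.trans (g := fun n : ℕ => x ^ (n + 1)) ?_ ?_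
    · refine this.congr (fun n => ?_) (fun n => ?_) <;> simp
    · refine Asymptotics.IsBigO.of_bound x (Filter.Eventually.of_forall fun n => ?_)
      rw [pow_succ, mul_comm, norm_mul, Real.norm_of_nonneg (by linarith : 0 ≤ x)]
  rw [← Nat.cofinite_eq_atTop] at h'
  obtain ⟨C, hC0, hC⟩ := Asymptotics.bound_of_isBigO_cofinite h'
  refine ⟨max 1 (4 * C), le_max_left _ _, fun e => ?_⟩
  have hpos : 0 < x ^ e := pow_pos (by linarith) e
  have := hC (x := e) hpos.ne'
  rw [Real.norm_of_nonneg (by positivity), Real.norm_of_nonneg hpos.le] at this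
  have h4 : 4 * C ≤ max 1 (4 * C) := le_max_right _ _
  nlinarith

/-- The divisor bound: the count is submultiplicative, large primes contribute at most `p ^ (ε e)`,
and the finitely many small ones lose a factor `A` each. -/
theorem GaussianInt.exists_cover_norm_eq {ε : ℝ} (hε : 0 < ε) :
    ∃ C : ℝ, 1 ≤ C ∧ ∀ m : ℕ, m ≠ 0 → ∃ s : Finset GaussianInt, (s.card : ℝ) ≤ C * (m : ℝ) ^ ε ∧
      ∀ z : GaussianInt, z.norm = (m : ℤ) → z ∈ s := by
  obtain ⟨A, hA1, hA⟩ := exists_sq_le_mul_pow (Real.one_lt_rpow one_lt_two hε)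
  -- 16 is the value of `4 (e + 1)²` at `e = 1`, and `4 (e + 1)² ≤ 16 ^ e` for `e ≥ 1`: beyond `P` a
  -- prime costs no constant.
  obtain ⟨P, hP⟩ : ∃ P : ℕ, (16 : ℝ) ≤ (P : ℝ) ^ ε :=
    (((tendsto_rpow_atTop hε).comp tendsto_natCast_atTop_atTop).eventually_ge_atTop 16).exists
  let h : ℕ → ℝ := fun p => if p < P then A else 1
  have hh1 : ∀ p, 1 ≤ h p := fun p => by dsimp only [h]; split_ifs <;> linarith
  have hpow : ∀ p e : ℕ, p.Prime → 0 < e →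
      4 * ((e : ℝ) + 1) ^ 2 ≤ h p * ((p ^ e : ℕ) : ℝ) ^ ε := by
    intro p e hp he
    have hcast : ((p ^ e : ℕ) : ℝ) ^ ε = ((p : ℝ) ^ ε) ^ e := by
      push_cast
      rw [← Real.rpow_natCast, ← Real.rpow_mul (Nat.cast_nonneg p), mul_comm,
        Real.rpow_mul (Nat.cast_nonneg p), Real.rpow_natCast]
    rw [hcast]
    dsimp only [h]
    split_ifs with hlt
    · refine (hA e).trans ?_
      have h2 : (2 : ℝ) ≤ p := by exact_mod_cast hp.two_le
      gcongr
    · rw [one_mul]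
      have hPp : (P : ℝ) ≤ p := by exact_mod_cast not_lt.1 hlt
      have h16 : (16 : ℝ) ≤ (p : ℝ) ^ ε :=
        hP.trans (Real.rpow_le_rpow (Nat.cast_nonneg _) hPp hε.le)
      calc 4 * ((e : ℝ) + 1) ^ 2 ≤ 16 ^ e := by
            obtain ⟨n, rfl⟩ : ∃ n, e = n + 1 := ⟨e - 1, by omega⟩
            clear he hcast
            induction n with
            | zero => norm_num
            | succ n ih =>
              rw [pow_succ (16 : ℝ)]; push_cast at ih ⊢
              nlinarith [(Nat.cast_nonneg n : (0 : ℝ) ≤ n)]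
        _ ≤ _ := by gcongr
  have main : ∀ m : ℕ, 1 < m → ∃ s : Finset GaussianInt,
      (s.card : ℝ) ≤ (∏ p ∈ m.primeFactors, h p) * (m : ℝ) ^ ε ∧
      ∀ z : GaussianInt, z.norm = (m : ℤ) → z ∈ s := by
    intro m
    induction m using Nat.recOnPosPrimePosCoprime with
    | prime_pow p n hp hn =>
      intro _
      obtain ⟨s, hs, hs'⟩ := GaussianInt.exists_cover_prime_pow hp n
      refine ⟨s, ?_, hs'⟩
      rw [Nat.primeFactors_prime_pow hn.ne' hp, Finset.prod_singleton]
      exact le_trans (by exact_mod_cast hs) (hpow p n hp hn)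
    | zero => simp
    | one => simp
    | coprime a b ha hb hab iha ihb =>
      intro _
      obtain ⟨s, hs, hs'⟩ := iha ha
      obtain ⟨t, ht, ht'⟩ := ihb hb
      obtain ⟨r, hr, hr'⟩ := GaussianInt.exists_cover_mul hab (by omega) (by omega) hs' ht'
      refine ⟨r, ?_, hr'⟩
      have h1 : (r.card : ℝ) ≤ s.card * t.card := by exact_mod_cast hr
      refine h1.trans ?_
      rw [hab.primeFactors_mul, Finset.prod_union hab.disjoint_primeFactors]
      push_cast
      rw [Real.mul_rpow (Nat.cast_nonneg _) (Nat.cast_nonneg _)]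
      calc (s.card : ℝ) * t.card ≤ _ := mul_le_mul hs ht (Nat.cast_nonneg _)
            ((Nat.cast_nonneg _).trans hs)
        _ = _ := by ring
  have hprod : ∀ m : ℕ, ∏ p ∈ m.primeFactors, h p ≤ A ^ P := by
    intro m
    calc ∏ p ∈ m.primeFactors, h p
        ≤ ∏ p ∈ m.primeFactors ∪ Finset.range P, h p :=
          Finset.prod_le_prod_of_subset_of_one_le Finset.subset_union_left
            (fun p _ => zero_le_one.trans (hh1 p)) fun p _ _ => hh1 p
      _ = ∏ p ∈ Finset.range P, h p := by
          refine (Finset.prod_subset Finset.subset_union_right fun p _ hp => ?_).symm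
          exact if_neg (by simpa using hp)
      _ = A ^ P := by
          rw [Finset.prod_congr rfl fun p hp => if_pos (Finset.mem_range.1 hp)]
          simp
  have hAP : 1 ≤ A ^ P := one_le_pow₀ hA1
  refine ⟨4 * A ^ P, by linarith, fun m hm => ?_⟩
  rcases (Nat.one_le_iff_ne_zero.2 hm).eq_or_lt with rfl | hm1
  · refine ⟨{⟨1, 0⟩, ⟨-1, 0⟩, ⟨0, 1⟩, ⟨0, -1⟩}, ?_, ?_⟩
    · have : (((({⟨1, 0⟩, ⟨-1, 0⟩, ⟨0, 1⟩, ⟨0, -1⟩} : Finset GaussianInt).card : ℕ)) : ℝ) ≤ 4 := by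
        exact_mod_cast Finset.card_le_four
      refine this.trans ?_
      rw [Nat.cast_one, Real.one_rpow]
      linarith
    · intro z hz
      exact GaussianInt.mem_units_of_norm_eq_one (by simpa using hz)
  · obtain ⟨s, hs, hs'⟩ := main m hm1
    refine ⟨s, hs.trans ?_, hs'⟩
    have := hprod m
    gcongr
    linarith

/-- The circumradius formula: radius = product of the sides / (4 · area), squared, with `D` twice
the signed area. -/
theorem four_mul_sq_area {m x₁ y₁ x₂ y₂ x₃ y₃ D : ℤ}
    (h₁ : x₁ ^ 2 + y₁ ^ 2 = m) (h₂ : x₂ ^ 2 + y₂ ^ 2 = m) (h₃ : x₃ ^ 2 + y₃ ^ 2 = m)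
    (hD : D = (x₂ - x₁) * (y₃ - y₁) - (x₃ - x₁) * (y₂ - y₁)) :
    4 * m * D ^ 2 = ((x₁ - x₂) ^ 2 + (y₁ - y₂) ^ 2) * ((x₂ - x₃) ^ 2 + (y₂ - y₃) ^ 2) *
      ((x₁ - x₃) ^ 2 + (y₁ - y₃) ^ 2) := by
  obtain ⟨a, ha⟩ : ∃ a, a = x₁ * x₂ + y₁ * y₂ := ⟨_, rfl⟩
  obtain ⟨b, hb⟩ : ∃ b, b = x₂ * x₃ + y₂ * y₃ := ⟨_, rfl⟩
  obtain ⟨c, hc⟩ : ∃ c, c = x₁ * x₃ + y₁ * y₃ := ⟨_, rfl⟩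
  -- The Gram determinant of three vectors of the plane vanishes.
  have gram : (x₁ ^ 2 + y₁ ^ 2) * (x₂ ^ 2 + y₂ ^ 2) * (x₃ ^ 2 + y₃ ^ 2) + 2 * a * b * c =
      (x₁ ^ 2 + y₁ ^ 2) * b ^ 2 + (x₂ ^ 2 + y₂ ^ 2) * c ^ 2 + (x₃ ^ 2 + y₃ ^ 2) * a ^ 2 := by
    rw [ha, hb, hc]; ring
  rw [h₁, h₂, h₃] at gram
  have e1 : (x₁ - x₂) ^ 2 + (y₁ - y₂) ^ 2 = 2 * (m - a) := by
    rw [ha]; linear_combination h₁ + h₂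
  have e2 : (x₂ - x₃) ^ 2 + (y₂ - y₃) ^ 2 = 2 * (m - b) := by
    rw [hb]; linear_combination h₃ + h₂
  have e3 : (x₁ - x₃) ^ 2 + (y₁ - y₃) ^ 2 = 2 * (m - c) := by
    rw [hc]; linear_combination h₁ + h₃
  have e4 : (x₂ - x₁) * (x₃ - x₁) + (y₂ - y₁) * (y₃ - y₁) = m + b - a - c := by
    rw [ha, hb, hc]; linear_combination h₁
  have e5 : D ^ 2 = 2 * (m - a) * (2 * (m - c)) - (m + b - a - c) ^ 2 := by
    rw [← e1, ← e3, ← e4, hD]; ring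
  rw [e1, e2, e3, e5]
  linear_combination 4 * gram

/-- Three distinct lattice points of a circle centred at the origin span a triangle of area at
least `1/2`, so they cannot all be close to each other. -/
theorem norm_sq_le_of_three_points_on_circle {m : ℤ} {x₁ y₁ x₂ y₂ x₃ y₃ : ℤ} {B : ℤ}
    (h₁ : x₁ ^ 2 + y₁ ^ 2 = m) (h₂ : x₂ ^ 2 + y₂ ^ 2 = m) (h₃ : x₃ ^ 2 + y₃ ^ 2 = m)
    (h₁₂ : (x₁, y₁) ≠ (x₂, y₂)) (h₂₃ : (x₂, y₂) ≠ (x₃, y₃)) (h₁₃ : (x₁, y₁) ≠ (x₃, y₃))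
    (hB₁ : (x₁ - x₂) ^ 2 + (y₁ - y₂) ^ 2 ≤ B) (hB₂ : (x₂ - x₃) ^ 2 + (y₂ - y₃) ^ 2 ≤ B)
    (hB₃ : (x₁ - x₃) ^ 2 + (y₁ - y₃) ^ 2 ≤ B) : m ≤ B ^ 3 := by
  have pos : ∀ {a b c e : ℤ}, (a, b) ≠ (c, e) → 0 < (a - c) ^ 2 + (b - e) ^ 2 := by
    intro a b c e h
    by_contra hc
    have h1 : (a - c) ^ 2 = 0 := by nlinarith [sq_nonneg (a - c), sq_nonneg (b - e)]
    have h2 : (b - e) ^ 2 = 0 := by nlinarith [sq_nonneg (a - c), sq_nonneg (b - e)]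
    rw [sq_eq_zero_iff, sub_eq_zero] at h1 h2
    exact h (by rw [h1, h2])
  obtain ⟨D, hD⟩ : ∃ D, D = (x₂ - x₁) * (y₃ - y₁) - (x₃ - x₁) * (y₂ - y₁) := ⟨_, rfl⟩
  have key : 4 * m * D ^ 2 = ((x₁ - x₂) ^ 2 + (y₁ - y₂) ^ 2) * ((x₂ - x₃) ^ 2 + (y₂ - y₃) ^ 2) *
      ((x₁ - x₃) ^ 2 + (y₁ - y₃) ^ 2) :=
    four_mul_sq_area h₁ h₂ h₃ hD
  have p1 := pos h₁₂
  have p2 := pos h₂₃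
  have p3 := pos h₁₃
  have hm : 0 ≤ m := by rw [← h₁]; positivity
  have hup : ((x₁ - x₂) ^ 2 + (y₁ - y₂) ^ 2) * ((x₂ - x₃) ^ 2 + (y₂ - y₃) ^ 2) *
      ((x₁ - x₃) ^ 2 + (y₁ - y₃) ^ 2) ≤ B * B * B := by
    have hB0 : 0 ≤ B := p1.le.trans hB₁
    gcongr
  have hlow := mul_pos (mul_pos p1 p2) p3
  rw [← key] at hup hlow
  have hD1 : 1 ≤ D ^ 2 := by
    by_contra hc
    have : D ^ 2 = 0 := by linarith [sq_nonneg D, Int.lt_iff_add_one_le.1 (not_le.1 hc)]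
    rw [this, mul_zero] at hlow
    exact lt_irrefl _ hlow
  calc m ≤ 4 * m * D ^ 2 := by linarith [mul_le_mul_of_nonneg_left hD1 hm]
    _ ≤ B ^ 3 := by linarith

/-! ### Lattice sums -/

/-- The centre is arbitrary, so `m` is not controlled by `R` a priori. With at most two points there
is nothing to prove; with three, the triangle argument gives `m ≤ (16 R)³`, and the divisor bound
with exponent `ε / 3` applies. -/
theorem exists_card_circle_le {ε : ℝ} (hε : 0 < ε) :
    ∃ C : ℝ, 0 ≤ C ∧ ∀ (k l m : ℤ) (R : ℝ), 1 ≤ R → ∀ s : Finset (ℤ × ℤ),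
      (∀ p ∈ s, (2 * p.1 - k) ^ 2 + (2 * p.2 - l) ^ 2 = m ∧
        (1 + (p.1 : ℝ) ^ 2 + (p.2 : ℝ) ^ 2) ≤ R) → (s.card : ℝ) ≤ C * R ^ ε := by
  obtain ⟨C, hC1, hC⟩ := GaussianInt.exists_cover_norm_eq (ε := ε / 3) (by positivity)
  refine ⟨2 + C * (4096 : ℝ) ^ (ε / 3), by positivity, fun k l m R hR s hs => ?_⟩
  have hRε : 1 ≤ R ^ ε := Real.one_le_rpow hR hε.le
  have hC4 : 0 ≤ C * (4096 : ℝ) ^ (ε / 3) := by positivity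
  rcases le_or_gt s.card 2 with h2 | h2
  · have : (s.card : ℝ) ≤ 2 := by exact_mod_cast h2
    nlinarith
  obtain ⟨p, hp, q, hq, r, hr, hpq, hpr, hqr⟩ := Finset.two_lt_card.1 h2
  -- `4 |x - y|² ≤ 8 (|x|² + |y|²) ≤ 16 R`.
  have hB : ∀ x ∈ s, ∀ y ∈ s, ((2 * x.1 - k) - (2 * y.1 - k)) ^ 2 +
      ((2 * x.2 - l) - (2 * y.2 - l)) ^ 2 ≤ ⌊16 * R⌋ := by
    intro x hx y hy
    rw [Int.le_floor]
    push_cast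
    have h1 := (hs x hx).2
    have h2 := (hs y hy).2
    nlinarith [sq_nonneg ((x.1 : ℝ) + y.1), sq_nonneg ((x.2 : ℝ) + y.2)]
  have hne : ∀ {x y : ℤ × ℤ}, x ≠ y → ((2 * x.1 - k), (2 * x.2 - l)) ≠
      ((2 * y.1 - k), (2 * y.2 - l)) := by
    intro x y h h'
    rw [Prod.mk.injEq] at h'
    exact h (Prod.ext (by linarith [h'.1]) (by linarith [h'.2]))
  have hm := norm_sq_le_of_three_points_on_circle (hs p hp).1 (hs q hq).1 (hs r hr).1 (hne hpq)
    (hne hqr) (hne hpr) (hB p hp q hq) (hB q hq r hr) (hB p hp r hr)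
  have hm0 : 0 ≤ m := by rw [← (hs p hp).1]; positivity
  have hmne : m ≠ 0 := by
    rintro rfl
    have e1 := (hs p hp).1
    have e2 := (hs q hq).1
    have z : ∀ {a b : ℤ}, a ^ 2 + b ^ 2 = 0 → a = 0 ∧ b = 0 := by
      intro a b h
      exact ⟨pow_eq_zero_iff two_ne_zero |>.1 (by linarith [sq_nonneg a, sq_nonneg b]),
        pow_eq_zero_iff two_ne_zero |>.1 (by linarith [sq_nonneg a, sq_nonneg b])⟩
    obtain ⟨a1, a2⟩ := z e1
    obtain ⟨b1, b2⟩ := z e2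
    exact hpq (Prod.ext (by omega) (by omega))
  have hmR : (m : ℝ) ≤ 4096 * R ^ 3 := by
    have h1 : (m : ℝ) ≤ ((⌊16 * R⌋ : ℤ) : ℝ) ^ 3 := by exact_mod_cast hm
    refine h1.trans ?_
    have h2 : ((⌊16 * R⌋ : ℤ) : ℝ) ≤ 16 * R := Int.floor_le _
    have h3 : (0 : ℝ) ≤ ((⌊16 * R⌋ : ℤ) : ℝ) := by
      exact_mod_cast Int.floor_nonneg.2 (by positivity)
    calc ((⌊16 * R⌋ : ℤ) : ℝ) ^ 3 ≤ (16 * R) ^ 3 := by gcongr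
      _ = _ := by ring
  lift m to ℕ using hm0
  obtain ⟨t, ht, ht'⟩ := hC m (by exact_mod_cast hmne)
  have hst : s.card ≤ t.card := by
    refine Finset.card_le_card_of_injOn (fun p => (⟨2 * p.1 - k, 2 * p.2 - l⟩ : GaussianInt))
      (fun x hx => ht' _ ?_) (fun x _ y _ h => ?_)
    · rw [← (hs x hx).1, Zsqrtd.norm_def]; ring
    · rw [Zsqrtd.mk.injEq] at h
      exact Prod.ext (by linarith [h.1]) (by linarith [h.2])
  calc (s.card : ℝ) ≤ t.card := by exact_mod_cast hst
    _ ≤ C * (m : ℝ) ^ (ε / 3) := ht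
    _ ≤ C * (4096 * R ^ 3) ^ (ε / 3) := by
        gcongr; exact_mod_cast hmR
    _ = C * (4096 : ℝ) ^ (ε / 3) * R ^ ε := by
        rw [Real.mul_rpow (by norm_num) (by positivity), ← Real.rpow_natCast R 3,
          ← Real.rpow_mul (by positivity)]
        rw [show ((3 : ℕ) : ℝ) * (ε / 3) = ε by push_cast; ring]
        ring
    _ ≤ _ := by nlinarith

/-- A sum of negative powers over a set whose points of height at most `R` number at most
`C R^ε`, with `ε` below the power. -/
theorem tsum_indicator_rpow_le_of_card_le {ε δ C : ℝ} (hεδ : ε < δ) (hδ : 0 < δ) (hC : 0 ≤ C) :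
    ∃ K : ℝ≥0, ∀ {α : Type} (N : α → ℝ) (A : Set α), (∀ a, 1 ≤ N a) →
      (∀ R : ℝ, 1 ≤ R → ∀ s : Finset α, (∀ a ∈ s, a ∈ A ∧ N a ≤ R) →
        (s.card : ℝ) ≤ C * R ^ ε) →
      ∑' a, A.indicator (fun a => ENNReal.ofReal (N a ^ (-δ))) a ≤ K := by
  have hgeo : Summable fun i : ℕ => (C * (2 : ℝ) ^ ε) * ((2 : ℝ) ^ (ε - δ)) ^ i := by
    refine (summable_geometric_of_lt_one (by positivity) ?_).mul_left _
    exact Real.rpow_lt_one_of_one_lt_of_neg one_lt_two (by linarith)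
  refine ⟨(∑' i : ℕ, (C * (2 : ℝ) ^ ε) * ((2 : ℝ) ^ (ε - δ)) ^ i).toNNReal, ?_⟩
  intro α N A hN hcard
  classical
  -- Dyadic layers `2^i ≤ N a ≤ 2^(i+1)`. Layer `i` has at most `C 2^((i+1)ε)` points, each of
  -- weight at most `2^(-δ i)`, which leaves a geometric series of ratio `2^(ε-δ)`.
  let f : α → ℕ → ℝ≥0∞ := fun a i =>
    if a ∈ A ∧ N a ≤ 2 ^ (i + 1) then ENNReal.ofReal ((2 : ℝ) ^ (-δ * i)) else 0
  have h1 : ∀ a, A.indicator (fun a => ENNReal.ofReal (N a ^ (-δ))) a ≤ ∑' i, f a i := by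
    intro a
    by_cases ha : a ∈ A
    · rw [Set.indicator_of_mem ha]
      have hfl : 1 ≤ ⌊N a⌋₊ := Nat.one_le_floor_iff _ |>.2 (hN a)
      set i := Nat.log 2 ⌊N a⌋₊ with hi
      have hlo : (2 : ℝ) ^ i ≤ N a := by
        have : 2 ^ i ≤ ⌊N a⌋₊ := Nat.pow_log_le_self 2 (by omega)
        calc (2 : ℝ) ^ i ≤ (⌊N a⌋₊ : ℝ) := by exact_mod_cast this
          _ ≤ N a := Nat.floor_le (by linarith [hN a])
      have hup : N a ≤ 2 ^ (i + 1) := by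
        have : ⌊N a⌋₊ < 2 ^ (i + 1) := Nat.lt_pow_succ_log_self one_lt_two _
        have h := (Nat.floor_lt (by linarith [hN a])).1 this
        push_cast at h
        exact h.le
      refine le_trans ?_ (ENNReal.le_tsum i)
      simp only [f]
      rw [if_pos ⟨ha, hup⟩]
      refine ENNReal.ofReal_le_ofReal ?_
      calc N a ^ (-δ) ≤ ((2 : ℝ) ^ i) ^ (-δ) :=
            Real.rpow_le_rpow_of_nonpos (by positivity) hlo (by linarith)
        _ = _ := by
            rw [← Real.rpow_natCast, ← Real.rpow_mul (by norm_num)]; ring_nf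
    · rw [Set.indicator_of_notMem ha]; exact zero_le
  have h2 : ∀ i, ∑' a, f a i ≤ ENNReal.ofReal ((C * (2 : ℝ) ^ ε) * ((2 : ℝ) ^ (ε - δ)) ^ i) := by
    intro i
    rw [ENNReal.tsum_eq_iSup_sum]
    refine iSup_le fun s => ?_
    simp only [f]
    rw [← Finset.sum_filter, Finset.sum_const, nsmul_eq_mul, ← ENNReal.ofReal_natCast,
      ← ENNReal.ofReal_mul (Nat.cast_nonneg _)]
    refine ENNReal.ofReal_le_ofReal ?_
    have h3 := hcard (2 ^ (i + 1)) (one_le_pow₀ one_le_two)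
      (s.filter fun a => a ∈ A ∧ N a ≤ 2 ^ (i + 1)) (fun a ha => (Finset.mem_filter.1 ha).2)
    calc _ ≤ C * ((2 : ℝ) ^ (i + 1)) ^ ε * (2 : ℝ) ^ (-δ * i) := by gcongr
      _ = _ := by
        rw [← Real.rpow_natCast, ← Real.rpow_natCast, ← Real.rpow_mul (by norm_num),
          ← Real.rpow_mul (by norm_num), mul_assoc, mul_assoc, ← Real.rpow_add (by norm_num),
          ← Real.rpow_add (by norm_num)]
        push_cast
        ring_nf
  calc _ ≤ ∑' a, ∑' i, f a i := ENNReal.tsum_le_tsum h1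
    _ = ∑' i, ∑' a, f a i := ENNReal.tsum_comm
    _ ≤ ∑' i : ℕ, ENNReal.ofReal ((C * (2 : ℝ) ^ ε) * ((2 : ℝ) ^ (ε - δ)) ^ i) :=
        ENNReal.tsum_le_tsum h2
    _ = ENNReal.ofReal (∑' i : ℕ, (C * (2 : ℝ) ^ ε) * ((2 : ℝ) ^ (ε - δ)) ^ i) :=
        (ENNReal.ofReal_tsum_of_nonneg (fun i => by positivity) hgeo).symm
    _ ≤ _ := le_of_eq rfl

theorem exists_tsum_circle_le {δ : ℝ} (hδ : 0 < δ) :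
    ∃ K : ℝ≥0, ∀ k l m : ℤ, ∑' p : ℤ × ℤ,
      {p : ℤ × ℤ | (2 * p.1 - k) ^ 2 + (2 * p.2 - l) ^ 2 = m}.indicator
        (fun p => ENNReal.ofReal ((1 + (p.1 : ℝ) ^ 2 + (p.2 : ℝ) ^ 2) ^ (-δ))) p ≤ K := by
  obtain ⟨C, hC0, hC⟩ := exists_card_circle_le (half_pos hδ)
  obtain ⟨K, hK⟩ := tsum_indicator_rpow_le_of_card_le (half_lt_self hδ) hδ hC0
  refine ⟨K, fun k l m => hK _ _ (fun p => ?_) (hC k l m)⟩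
  nlinarith [sq_nonneg (p.1 : ℝ), sq_nonneg (p.2 : ℝ)]

/-- The weight `(1 + |t|)^{-ρ}`. -/
def decay (ρ t : ℝ) : ℝ≥0∞ := ENNReal.ofReal ((1 + |t|) ^ (-ρ))

theorem decay_le_of_le_mul {ρ A t u : ℝ} (hρ : 0 ≤ ρ) (hA : 0 < A)
    (h : 1 + |u| ≤ A * (1 + |t|)) : decay ρ t ≤ ENNReal.ofReal (A ^ ρ) * decay ρ u := by
  rw [decay, decay, ← ENNReal.ofReal_mul (by positivity)]
  refine ENNReal.ofReal_le_ofReal ?_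
  have h1 : (A * (1 + |t|)) ^ (-ρ) ≤ (1 + |u|) ^ (-ρ) :=
    Real.rpow_le_rpow_of_nonpos (by positivity) h (by linarith)
  rw [Real.mul_rpow hA.le (by positivity), Real.rpow_neg hA.le] at h1
  have hAρ : 0 < A ^ ρ := by positivity
  calc (1 + |t|) ^ (-ρ) = A ^ ρ * ((A ^ ρ)⁻¹ * (1 + |t|) ^ (-ρ)) := by
        field_simp
    _ ≤ _ := by gcongr

theorem exists_tsum_decay_le {ρ : ℝ} (hρ : 1 < ρ) :
    ∃ K : ℝ≥0, ∀ c : ℝ, ∑' j : ℤ, decay ρ (j - c) ≤ K := by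
  have hsum : Summable fun j : ℤ => (1 + |(j : ℝ)|) ^ (-ρ) := by
    -- The shift by `1/2` keeps the comparison series `|j + 1/2|^(-ρ)` away from the singularity at
    -- zero.
    refine Summable.of_nonneg_of_le (fun j => by positivity) (fun j => ?_)
      ((Real.summable_one_div_int_add_rpow (1 / 2) ρ).2 hρ)
    have hpos : 0 < |(j : ℝ) + 1 / 2| := by
      rw [abs_pos]
      intro h0
      have : (2 * j + 1 : ℤ) = 0 := by
        have : (2 * (j : ℝ) + 1) = 0 := by linarith
        exact_mod_cast this
      omega
    rw [one_div, ← Real.rpow_neg (abs_nonneg _)]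
    refine Real.rpow_le_rpow_of_nonpos hpos ?_ (by linarith)
    refine (abs_add_le _ _).trans ?_
    rw [abs_of_pos (by norm_num : (0 : ℝ) < 1 / 2)]
    linarith
  refine ⟨((2 : ℝ) ^ ρ).toNNReal * (∑' j : ℤ, (1 + |(j : ℝ)|) ^ (-ρ)).toNNReal, fun c => ?_⟩
  calc ∑' j : ℤ, decay ρ (j - c)
      ≤ ∑' j : ℤ, ENNReal.ofReal (2 ^ ρ) * decay ρ ((j - ⌊c⌋ : ℤ) : ℝ) := by
        refine ENNReal.tsum_le_tsum fun j => decay_le_of_le_mul (by linarith) two_pos ?_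
        push_cast
        have h1 : |(j : ℝ) - ⌊c⌋| ≤ |(j : ℝ) - c| + |c - ⌊c⌋| := abs_sub_le _ _ _
        have h2 : |c - ⌊c⌋| ≤ 1 := by
          rw [Int.self_sub_floor, abs_of_nonneg (Int.fract_nonneg c)]
          exact (Int.fract_lt_one c).le
        linarith [abs_nonneg ((j : ℝ) - c)]
    _ = ENNReal.ofReal (2 ^ ρ) * ∑' j : ℤ, decay ρ (j : ℝ) := by
        rw [ENNReal.tsum_mul_left]
        congr 1
        exact (Equiv.subRight ⌊c⌋).tsum_eq fun j : ℤ => decay ρ (j : ℝ)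
    _ = _ := by
        rw [ENNReal.coe_mul]
        congr 1
        exact (ENNReal.ofReal_tsum_of_nonneg (fun i => by positivity) hsum).symm

theorem decay_mono {ρ t u : ℝ} (hρ : 0 ≤ ρ) (h : |u| ≤ |t|) : decay ρ t ≤ decay ρ u :=
  ENNReal.ofReal_le_ofReal
    (Real.rpow_le_rpow_of_nonpos (by positivity) (by linarith) (by linarith))

theorem decay_abs (ρ t : ℝ) : decay ρ |t| = decay ρ t := by rw [decay, decay, abs_abs]

theorem decay_neg (ρ t : ℝ) : decay ρ (-t) = decay ρ t := by rw [decay, decay, abs_neg]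

theorem ofReal_one_add_sq_rpow_le {a : ℝ} (ha : 0 ≤ a) (x : ℝ) :
    ENNReal.ofReal ((1 + x ^ 2) ^ (-(a / 2))) ≤ ENNReal.ofReal (2 ^ (a / 2)) * decay a x := by
  have h1 : (1 + |x|) ^ (-a) = ((1 + |x|) ^ 2) ^ (-(a / 2)) := by
    rw [← Real.rpow_natCast, ← Real.rpow_mul (by positivity)]
    congr 1; push_cast; ring
  rw [decay, h1, ← ENNReal.ofReal_mul (by positivity)]
  refine ENNReal.ofReal_le_ofReal ?_
  have h2 : (2 * (1 + x ^ 2)) ^ (-(a / 2)) ≤ ((1 + |x|) ^ 2) ^ (-(a / 2)) := by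
    refine Real.rpow_le_rpow_of_nonpos (by positivity) ?_ (by linarith)
    nlinarith [sq_nonneg (1 - |x|), sq_abs x]
  rw [Real.mul_rpow two_pos.le (by positivity)] at h2
  calc (1 + x ^ 2) ^ (-(a / 2)) =
        2 ^ (a / 2) * ((2 : ℝ) ^ (-(a / 2)) * (1 + x ^ 2) ^ (-(a / 2))) := by
        rw [← mul_assoc, ← Real.rpow_add two_pos, add_neg_cancel, Real.rpow_zero, one_mul]
    _ ≤ _ := by gcongr

/-- The smaller base can take the whole exponent. This decouples a product of weights with different
centres into a sum of weights. -/
theorem rpow_mul_rpow_le_add {a b x y : ℝ} (ha : 1 ≤ a) (hb : 1 ≤ b) (hx : 0 ≤ x) (hy : 0 ≤ y) :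
    a ^ (-x) * b ^ (-y) ≤ a ^ (-(x + y)) + b ^ (-(x + y)) := by
  have ha0 : 0 < a := by linarith
  have hb0 : 0 < b := by linarith
  rcases le_total a b with h | h
  · have h1 : b ^ (-y) ≤ a ^ (-y) := Real.rpow_le_rpow_of_nonpos ha0 h (by linarith)
    calc a ^ (-x) * b ^ (-y) ≤ a ^ (-x) * a ^ (-y) := by gcongr
      _ = a ^ (-(x + y)) := by rw [← Real.rpow_add ha0]; ring_nf
      _ ≤ _ := le_add_of_nonneg_right (by positivity)
  · have h1 : a ^ (-x) ≤ b ^ (-x) := Real.rpow_le_rpow_of_nonpos hb0 h (by linarith)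
    calc a ^ (-x) * b ^ (-y) ≤ b ^ (-x) * b ^ (-y) := by gcongr
      _ = b ^ (-(x + y)) := by rw [← Real.rpow_add hb0]; ring_nf
      _ ≤ _ := le_add_of_nonneg_left (by positivity)

theorem decay_mul_decay_le {β γ : ℝ} (hβ : 0 ≤ β) (hγ : 0 ≤ γ) (t u : ℝ) :
    decay β t * decay γ u ≤ decay (β + γ) t + decay (β + γ) u := by
  rw [decay, decay, decay, decay, ← ENNReal.ofReal_mul (by positivity),
    ← ENNReal.ofReal_add (by positivity) (by positivity)]
  exact ENNReal.ofReal_le_ofReal (rpow_mul_rpow_le_add (by linarith [abs_nonneg t])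
    (by linarith [abs_nonneg u]) hβ hγ)

theorem sq_abs_sub_sqrt_le (t e : ℝ) : (|t| - √e) ^ 2 ≤ |t ^ 2 - e| := by
  rcases le_total e 0 with h | h
  · rw [Real.sqrt_eq_zero_of_nonpos h, sub_zero, sq_abs, abs_of_nonneg (by nlinarith)]
    linarith
  · have h1 : t ^ 2 - e = (|t| - √e) * (|t| + √e) := by
      nlinarith [Real.sq_sqrt h, sq_abs t]
    rw [h1, abs_mul, abs_of_nonneg (by positivity : 0 ≤ |t| + √e), ← sq_abs, sq]
    refine mul_le_mul_of_nonneg_left ?_ (abs_nonneg _)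
    rw [abs_le]
    constructor <;> linarith [abs_nonneg t, Real.sqrt_nonneg e]

/-- The quadratic vanishes at `k/2 ± √(c/2)` and is bounded below by the squared distance to the
nearer root, so its weight acts like a linear weight of exponent `2 γ`. Decoupling leaves three
translates of a convergent series. -/
theorem exists_tsum_lattice_one_le {β γ : ℝ} (hβ : 0 ≤ β) (hγ : 0 ≤ γ) (h : 1 < β + 2 * γ) :
    ∃ K : ℝ≥0, ∀ (c : ℝ) (k : ℤ), ∑' j : ℤ, ENNReal.ofReal ((1 + (j : ℝ) ^ 2) ^ (-(β / 2))) *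
      decay γ (c - (2 * (j : ℝ) - k) ^ 2 / 2) ≤ K := by
  obtain ⟨K, hK⟩ := exists_tsum_decay_le h
  refine ⟨((2 : ℝ) ^ (β / 2)).toNNReal * ((2 : ℝ) ^ γ).toNNReal * (K + K + K), fun c k => ?_⟩
  -- For `c < 0` this is zero, and `sq_abs_sub_sqrt_le` still holds.
  set r := √(c / 2) with hr
  have key : ∀ j : ℤ, ENNReal.ofReal ((1 + (j : ℝ) ^ 2) ^ (-(β / 2))) *
      decay γ (c - (2 * (j : ℝ) - k) ^ 2 / 2) ≤
      ENNReal.ofReal (2 ^ (β / 2)) * ENNReal.ofReal (2 ^ γ) * (decay (β + 2 * γ) (j - 0) +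
        decay (β + 2 * γ) (j - (k / 2 + r)) + decay (β + 2 * γ) (j - (k / 2 - r))) := by
    intro j
    set t : ℝ := j - k / 2 with ht
    have hx : (|t| - r) ^ 2 ≤ |c - (2 * (j : ℝ) - k) ^ 2 / 2| := by
      refine (sq_abs_sub_sqrt_le t (c / 2)).trans ?_
      have : c - (2 * (j : ℝ) - k) ^ 2 / 2 = (-2) * (t ^ 2 - c / 2) := by rw [ht]; ring
      rw [this, abs_mul, abs_neg, abs_two]
      linarith [abs_nonneg (t ^ 2 - c / 2)]
    have h1 : decay γ (c - (2 * (j : ℝ) - k) ^ 2 / 2) ≤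
        ENNReal.ofReal (2 ^ γ) * decay (2 * γ) (|t| - r) := by
      have h2 := ofReal_one_add_sq_rpow_le (a := 2 * γ) (by linarith) (|t| - r)
      rw [mul_div_cancel_left₀ _ two_ne_zero] at h2
      refine le_trans (ENNReal.ofReal_le_ofReal ?_) h2
      exact Real.rpow_le_rpow_of_nonpos (by positivity) (by linarith) (by linarith)
    have h3 : decay (β + 2 * γ) (|t| - r) ≤ decay (β + 2 * γ) (j - (k / 2 + r)) +
        decay (β + 2 * γ) (j - (k / 2 - r)) := by
      rcases abs_choice t with h0 | h0
      · rw [h0, ht, sub_sub]; exact le_self_add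
      · rw [h0, ← decay_neg, show -(-t - r) = j - (k / 2 - r) by rw [ht]; ring]
        exact le_add_self
    calc _ ≤ (ENNReal.ofReal (2 ^ (β / 2)) * decay β j) *
          (ENNReal.ofReal (2 ^ γ) * decay (2 * γ) (|t| - r)) :=
          mul_le_mul' (ofReal_one_add_sq_rpow_le hβ _) h1
      _ = ENNReal.ofReal (2 ^ (β / 2)) * ENNReal.ofReal (2 ^ γ) *
          (decay β j * decay (2 * γ) (|t| - r)) := by ring
      _ ≤ _ := by
          refine mul_le_mul_right ((decay_mul_decay_le hβ (by linarith) _ _).trans ?_) _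
          rw [sub_zero, add_assoc]
          exact add_le_add le_rfl h3
  calc _ ≤ _ := ENNReal.tsum_le_tsum key
    _ = ENNReal.ofReal (2 ^ (β / 2)) * ENNReal.ofReal (2 ^ γ) *
      (∑' j : ℤ, decay (β + 2 * γ) (j - 0) +
        ∑' j : ℤ, decay (β + 2 * γ) (j - (k / 2 + r)) +
        ∑' j : ℤ, decay (β + 2 * γ) (j - (k / 2 - r))) := by
        rw [ENNReal.tsum_mul_left, ENNReal.tsum_add, ENNReal.tsum_add]
    _ ≤ _ := by
        push_cast
        gcongr
        · exact le_rfl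
        · exact le_rfl
        · exact hK 0
        · exact hK _
        · exact hK _

/-- Compare `N = 1 + |p|²` with `Y = 1 + |c - q(p)/2|`. If `N ≤ Y`, the whole decay passes to `N`
and the sum over `ℤ²` converges. Otherwise a power of `N` is traded to raise the exponent of `Y`
above one; the sum is then taken over the circles `q(p) = m`, each uniformly bounded thanks to the
remaining `N^(-η/2)`, and then over `m`. -/
theorem exists_tsum_lattice_two_le {σ γ : ℝ} (hγ : 0 < γ) (hγ1 : γ < 1)
    (h : 1 < σ + γ) :
    ∃ K : ℝ≥0, ∀ (c : ℝ) (k l : ℤ), ∑' p : ℤ × ℤ,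
      ENNReal.ofReal ((1 + (p.1 : ℝ) ^ 2 + (p.2 : ℝ) ^ 2) ^ (-σ)) *
        decay γ (c - ((2 * (p.1 : ℝ) - k) ^ 2 + (2 * (p.2 : ℝ) - l) ^ 2) / 2) ≤ K := by
  obtain ⟨η, hη⟩ : ∃ η, η = σ + γ - 1 := ⟨_, rfl⟩
  have hη0 : 0 < η := by linarith
  obtain ⟨K₁, hK₁⟩ := exists_tsum_decay_le (ρ := 1 + η) (by linarith)
  obtain ⟨K₂, hK₂⟩ := exists_tsum_decay_le (ρ := 1 + η / 2) (by linarith)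
  obtain ⟨K₃, hK₃⟩ := exists_tsum_circle_le (half_pos hη0)
  refine ⟨(((2 : ℝ) ^ ((1 + η) / 2)).toNNReal * K₁) * (((2 : ℝ) ^ ((1 + η) / 2)).toNNReal * K₁) +
    (((2 : ℝ) ^ (1 + η / 2)).toNNReal * K₂) * K₃, fun c k l => ?_⟩
  let N : ℤ × ℤ → ℝ := fun p => 1 + (p.1 : ℝ) ^ 2 + (p.2 : ℝ) ^ 2
  let q : ℤ × ℤ → ℤ := fun p => (2 * p.1 - k) ^ 2 + (2 * p.2 - l) ^ 2
  have hN : ∀ p, 1 ≤ N p := fun p => by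
    simp only [N]; nlinarith [sq_nonneg (p.1 : ℝ), sq_nonneg (p.2 : ℝ)]
  have key : ∀ p : ℤ × ℤ, ENNReal.ofReal (N p ^ (-σ)) * decay γ (c - (q p : ℝ) / 2) ≤
      ENNReal.ofReal (N p ^ (-(1 + η))) +
        ENNReal.ofReal (N p ^ (-(η / 2))) * decay (1 + η / 2) (c - (q p : ℝ) / 2) := by
    intro p
    have hNp := hN p
    have hN0 : 0 < N p := by linarith
    obtain ⟨Y, hY⟩ : ∃ Y, Y = 1 + |c - (q p : ℝ) / 2| := ⟨_, rfl⟩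
    have hY1 : 1 ≤ Y := by rw [hY]; linarith [abs_nonneg (c - (q p : ℝ) / 2)]
    have hY0 : 0 < Y := by linarith
    simp only [decay, ← hY]
    rw [← ENNReal.ofReal_mul (by positivity), ← ENNReal.ofReal_mul (by positivity),
      ← ENNReal.ofReal_add (by positivity) (by positivity)]
    refine ENNReal.ofReal_le_ofReal ?_
    rcases le_total (N p) Y with hle | hle
    · calc N p ^ (-σ) * Y ^ (-γ) ≤ N p ^ (-σ) * N p ^ (-γ) := by
            gcongr ?_ * ?_
            exact Real.rpow_le_rpow_of_nonpos hN0 hle (by linarith)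
        _ = N p ^ (-(1 + η)) := by rw [← Real.rpow_add hN0, hη]; ring_nf
        _ ≤ _ := le_add_of_nonneg_right (by positivity)
    · calc N p ^ (-σ) * Y ^ (-γ) = N p ^ (-σ) * (Y ^ (1 + η / 2 - γ) * Y ^ (-(1 + η / 2))) := by
            rw [← Real.rpow_add hY0]; ring_nf
        -- The exponent `1 + η / 2 - γ` is positive because `γ < 1`.
        _ ≤ N p ^ (-σ) * (N p ^ (1 + η / 2 - γ) * Y ^ (-(1 + η / 2))) := by
            gcongr
            linarith
        _ = N p ^ (-(η / 2)) * Y ^ (-(1 + η / 2)) := by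
            rw [← mul_assoc, ← Real.rpow_add hN0]
            congr 2
            linarith
        _ ≤ _ := le_add_of_nonneg_left (by positivity)
  have hfirst : ∑' p, ENNReal.ofReal (N p ^ (-(1 + η))) ≤
      (((2 : ℝ) ^ ((1 + η) / 2)).toNNReal * K₁) * (((2 : ℝ) ^ ((1 + η) / 2)).toNNReal * K₁) := by
    have hp : ∀ p : ℤ × ℤ, ENNReal.ofReal (N p ^ (-(1 + η))) ≤
        (ENNReal.ofReal (2 ^ ((1 + η) / 2)) * decay (1 + η) (p.1 - (0 : ℝ))) *
          (ENNReal.ofReal (2 ^ ((1 + η) / 2)) * decay (1 + η) (p.2 - (0 : ℝ))) := by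
      intro p
      rw [sub_zero, sub_zero]
      refine le_trans ?_ (mul_le_mul' (ofReal_one_add_sq_rpow_le (by linarith) _)
        (ofReal_one_add_sq_rpow_le (by linarith) _))
      rw [← ENNReal.ofReal_mul (by positivity), ← Real.mul_rpow (by positivity) (by positivity)]
      refine ENNReal.ofReal_le_ofReal ?_
      have h2 : N p ^ (-(1 + η)) = (N p ^ 2) ^ (-((1 + η) / 2)) := by
        rw [← Real.rpow_natCast, ← Real.rpow_mul (by linarith [hN p])]
        congr 1; push_cast; ring
      rw [h2]
      refine Real.rpow_le_rpow_of_nonpos (by positivity) ?_ (by linarith)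
      rw [sq (N p)]
      simp only [N]
      exact mul_le_mul (by nlinarith [sq_nonneg (p.2 : ℝ)]) (by nlinarith [sq_nonneg (p.1 : ℝ)])
        (by positivity) (by positivity)
    refine (ENNReal.tsum_le_tsum hp).trans ?_
    rw [ENNReal.tsum_prod']
    simp only [ENNReal.tsum_mul_left, ENNReal.tsum_mul_right]
    exact mul_le_mul' (mul_le_mul' le_rfl (hK₁ 0)) (mul_le_mul' le_rfl (hK₁ 0))
  have hsecond : ∑' p, ENNReal.ofReal (N p ^ (-(η / 2))) *
      decay (1 + η / 2) (c - (q p : ℝ) / 2) ≤ (((2 : ℝ) ^ (1 + η / 2)).toNNReal * K₂) * K₃ := by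
    have hp : ∀ p : ℤ × ℤ, ENNReal.ofReal (N p ^ (-(η / 2))) *
        decay (1 + η / 2) (c - (q p : ℝ) / 2) ≤ ∑' m : ℤ, decay (1 + η / 2) (c - (m : ℝ) / 2) *
          {p : ℤ × ℤ | (2 * p.1 - k) ^ 2 + (2 * p.2 - l) ^ 2 = m}.indicator
        (fun p => ENNReal.ofReal ((1 + (p.1 : ℝ) ^ 2 + (p.2 : ℝ) ^ 2) ^ (-(η / 2)))) p := by
      intro p
      refine le_trans ?_ (ENNReal.le_tsum (q p))
      rw [Set.indicator_of_mem (by simp [q]), mul_comm]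
    refine (ENNReal.tsum_le_tsum hp).trans ?_
    rw [ENNReal.tsum_comm]
    simp only [ENNReal.tsum_mul_left]
    refine (ENNReal.tsum_le_tsum fun m => mul_le_mul' le_rfl (hK₃ k l m)).trans ?_
    rw [ENNReal.tsum_mul_right]
    refine mul_le_mul' ?_ le_rfl
    have hm : ∀ m : ℤ, decay (1 + η / 2) (c - (m : ℝ) / 2) ≤
        ENNReal.ofReal (2 ^ (1 + η / 2)) * decay (1 + η / 2) (m - 2 * c) := by
      intro m
      refine decay_le_of_le_mul (by linarith) two_pos ?_
      have : (m : ℝ) - 2 * c = (-2) * (c - m / 2) := by ring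
      rw [this, abs_mul, abs_neg, abs_two]
      linarith
    refine (ENNReal.tsum_le_tsum hm).trans ?_
    rw [ENNReal.tsum_mul_left]
    exact mul_le_mul' le_rfl (hK₂ _)
  have hq : ∀ p : ℤ × ℤ, c - ((2 * (p.1 : ℝ) - k) ^ 2 + (2 * (p.2 : ℝ) - l) ^ 2) / 2 =
      c - (q p : ℝ) / 2 := by intro p; simp [q]
  simp only [hq]
  refine (ENNReal.tsum_le_tsum key).trans ?_
  rw [ENNReal.tsum_add]
  push_cast
  exact add_le_add hfirst hsecond

/-- Induction on the dimension: the new coordinate `j` takes the summable weight `⟨j⟩^(-(1+2δ))`,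
and its square `(2j - k 0)²/2` is absorbed into `c`, over which the bound is uniform. -/
theorem exists_tsum_lattice_ge_two_le {γ : ℝ} (hγ : 0 < γ) (hγ1 : γ < 1) (d : ℕ) (hd : 2 ≤ d)
    (σ : ℝ) (h : (d : ℝ) / 2 < σ + γ) :
    ∃ K : ℝ≥0, ∀ (c : ℝ) (k : Fin d → ℤ), ∑' p : Fin d → ℤ,
      ENNReal.ofReal ((1 + ∑ j, (p j : ℝ) ^ 2) ^ (-σ)) *
        decay γ (c - (∑ j, (2 * (p j : ℝ) - k j) ^ 2) / 2) ≤ K := by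
  induction d, hd using Nat.le_induction generalizing σ with
  | base =>
    push_cast at h
    obtain ⟨K, hK⟩ := exists_tsum_lattice_two_le (σ := σ) hγ hγ1 (by linarith)
    refine ⟨K, fun c k => ?_⟩
    rw [← (finTwoArrowEquiv ℤ).symm.tsum_eq]
    refine le_of_eq_of_le (tsum_congr fun p => ?_) (hK c (k 0) (k 1))
    simp [Fin.sum_univ_two, add_assoc]
  | succ d hd ih =>
    push_cast at h
    have hd2 : (2 : ℝ) ≤ d := by exact_mod_cast hd
    -- Half of the slack: the other half remains for the `d` coordinates left.
    obtain ⟨δ, hδ⟩ : ∃ δ, δ = (σ + γ - (d + 1) / 2) / 2 := ⟨_, rfl⟩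
    obtain ⟨K, hK⟩ := ih (σ - (1 / 2 + δ)) (by linarith)
    obtain ⟨K', hK'⟩ := exists_tsum_decay_le (ρ := 2 * (1 / 2 + δ)) (by linarith)
    refine ⟨((2 : ℝ) ^ (1 / 2 + δ)).toNNReal * K' * K, fun c k => ?_⟩
    rw [← (Fin.consEquiv fun _ => ℤ).tsum_eq, ENNReal.tsum_prod']
    have hj : ∀ j : ℤ, ∑' p : Fin d → ℤ,
        ENNReal.ofReal ((1 + ∑ i, ((Fin.consEquiv fun _ => ℤ) (j, p) i : ℝ) ^ 2) ^ (-σ)) *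
        decay γ (c - (∑ i, (2 * ((Fin.consEquiv fun _ => ℤ) (j, p) i : ℝ) - k i) ^ 2) / 2) ≤
        ENNReal.ofReal (2 ^ (1 / 2 + δ)) * decay (2 * (1 / 2 + δ)) (j - (0 : ℝ)) * K := by
      intro j
      refine le_trans ?_ (mul_le_mul' le_rfl (hK (c - (2 * (j : ℝ) - k 0) ^ 2 / 2)
        fun i => k i.succ))
      rw [← ENNReal.tsum_mul_left]
      refine ENNReal.tsum_le_tsum fun p => ?_
      simp only [Fin.consEquiv_apply, Fin.sum_univ_succ, Fin.cons_zero, Fin.cons_succ]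
      rw [← mul_assoc]
      refine mul_le_mul' ?_ (le_of_eq (by ring_nf))
      have h1 := ofReal_one_add_sq_rpow_le (a := 2 * (1 / 2 + δ)) (by linarith) (j : ℝ)
      rw [mul_div_cancel_left₀ _ two_ne_zero] at h1
      rw [sub_zero]
      refine le_trans ?_ (mul_le_mul' h1 le_rfl)
      rw [← ENNReal.ofReal_mul (by positivity)]
      refine ENNReal.ofReal_le_ofReal ?_
      have hS : 0 ≤ ∑ i, (p i : ℝ) ^ 2 := by positivity
      have hM : 0 < 1 + ((j : ℝ) ^ 2 + ∑ i, (p i : ℝ) ^ 2) := by positivity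
      rw [show -σ = -(1 / 2 + δ) + -(σ - (1 / 2 + δ)) by ring, Real.rpow_add hM]
      gcongr ?_ * ?_
      · exact Real.rpow_le_rpow_of_nonpos (by positivity) (by linarith) (by linarith)
      -- The exponent has the right sign because `σ - (1/2 + δ) > d/2 - γ > 0`, by `d ≥ 2` and `γ <
      -- 1`.
      · exact Real.rpow_le_rpow_of_nonpos (by positivity) (by nlinarith) (by linarith)
    refine (ENNReal.tsum_le_tsum hj).trans ?_
    rw [ENNReal.tsum_mul_right, ENNReal.tsum_mul_left]
    push_cast
    exact mul_le_mul' (mul_le_mul' le_rfl (hK' 0)) le_rfl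

/-- The lattice sum that governs the bilinear estimate, in every dimension. -/
theorem exists_tsum_lattice_le {γ σ : ℝ} (hγ : 0 < γ) (hγ1 : γ < 1) (hσ : 0 < σ) {d : ℕ}
    (hd : 1 ≤ d) (h : (d : ℝ) / 2 < σ + γ) :
    ∃ K : ℝ≥0, ∀ (c : ℝ) (k : Fin d → ℤ), ∑' p : Fin d → ℤ,
      ENNReal.ofReal ((1 + ∑ j, (p j : ℝ) ^ 2) ^ (-σ)) *
        decay γ (c - (∑ j, (2 * (p j : ℝ) - k j) ^ 2) / 2) ≤ K := by
  rcases hd.eq_or_lt with rfl | hd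
  · push_cast at h
    obtain ⟨K, hK⟩ := exists_tsum_lattice_one_le (β := 2 * σ) (by linarith) hγ.le (by linarith)
    refine ⟨K, fun c k => ?_⟩
    rw [← (Equiv.funUnique (Fin 1) ℤ).symm.tsum_eq]
    refine le_of_eq_of_le (tsum_congr fun p => ?_) (hK c (k 0))
    simp
  · exact exists_tsum_lattice_ge_two_le hγ hγ1 d hd σ h

/-! ### The modulation weight on the circle of time frequencies -/

theorem lintegral_comp_abs_eq (g : ℝ → ℝ≥0∞) (hg : Measurable g) :
    ∫⁻ t, g |t| = 2 * ∫⁻ t in Set.Ioi 0, g t := by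
  rw [← lintegral_add_compl _ (measurableSet_Ioi (a := (0 : ℝ))), Set.compl_Ioi, two_mul]
  congr 1
  · exact setLIntegral_congr_fun measurableSet_Ioi fun t ht => by rw [abs_of_pos ht]
  · rw [setLIntegral_congr Iio_ae_eq_Iic.symm]
    have h := (Measure.measurePreserving_neg (volume : Measure ℝ)).setLIntegral_comp_preimage
      (measurableSet_Ioi (a := (0 : ℝ))) hg
    rw [← h]
    have hs : Neg.neg ⁻¹' (Set.Ioi (0 : ℝ)) = Set.Iio 0 := by ext; simp
    rw [hs]
    exact setLIntegral_congr_fun measurableSet_Iio fun t ht => by rw [abs_of_neg ht]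

theorem measurable_decay (ρ : ℝ) : Measurable (decay ρ) := by
  unfold decay
  fun_prop

theorem lintegral_addCircle_comp_norm_le {T : ℝ} [hT : Fact (0 < T)] (g : ℝ → ℝ≥0∞)
    (hg : Measurable g) : ∫⁻ x : AddCircle T, g ‖x‖ ≤ 2 * ∫⁻ t in Set.Ioi 0, g t := by
  rw [← AddCircle.lintegral_preimage T (-(T / 2)), ← lintegral_comp_abs_eq g hg]
  refine le_trans (le_of_eq ?_) (setLIntegral_le_lintegral (Set.Ioc (-(T / 2)) (-(T / 2) + T)) _)
  refine setLIntegral_congr_fun measurableSet_Ioc fun t ht => ?_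
  have hT0 := hT.out
  rw [(AddCircle.norm_coe_eq_abs_iff T hT0.ne').2]
  rw [abs_of_pos hT0, abs_le]
  exact ⟨ht.1.le, by linarith [ht.2]⟩

/-- The larger of `‖x‖` and `‖y - x‖` is at least `‖y‖ / 2`, so the integrand is bounded by a
function `ψ` of the smaller one. The integral of `ψ` up to `1 + ‖y‖` converges by `a < 1`, the rest
by `2 a > 1`. Bounding by integrals over a half-line makes the constant independent of the period.
-/
theorem exists_lintegral_decay_mul_decay_le {a : ℝ} (ha : 1 / 2 < a) (ha1 : a < 1) :
    ∃ C : ℝ≥0, ∀ (T : ℝ) [Fact (0 < T)] (y : AddCircle T),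
      ∫⁻ x, decay a ‖x‖ * decay a ‖y - x‖ ≤ C * decay (2 * a - 1) ‖y‖ := by
  refine ⟨2 * (2 * ((2 : ℝ) ^ a / (1 - a) + 1 / (2 * a - 1)).toNNReal), fun T _ y => ?_⟩
  obtain ⟨Z, hZ⟩ : ∃ Z, Z = 1 + ‖y‖ := ⟨_, rfl⟩
  have hZ1 : 1 ≤ Z := by rw [hZ]; linarith [norm_nonneg y]
  have hZ0 : 0 < Z := by linarith
  let ψ : ℝ → ℝ≥0∞ := fun t => decay a t * decay a (max t (‖y‖ / 2))
  have hψm : Measurable ψ :=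
    (measurable_decay a).mul ((measurable_decay a).comp (measurable_id.max measurable_const))
  have hpt : ∀ x : AddCircle T, decay a ‖x‖ * decay a ‖y - x‖ ≤ ψ ‖x‖ + ψ ‖y - x‖ := by
    intro x
    have htri : ‖y‖ ≤ ‖x‖ + ‖y - x‖ := by
      simpa using norm_add_le x (y - x)
    have hab : ∀ s t : ℝ, 0 ≤ s → s ≤ t → ‖y‖ ≤ s + t → decay a t ≤ decay a (max s (‖y‖ / 2)) := by
      intro s t hs hst hy
      refine decay_mono (by linarith) ?_
      rw [abs_of_nonneg (hs.trans (le_max_left _ _)), abs_of_nonneg (hs.trans hst)]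
      exact max_le hst (by linarith)
    rcases le_total ‖x‖ ‖y - x‖ with h | h
    · exact le_add_right (mul_le_mul' le_rfl (hab _ _ (norm_nonneg _) h htri))
    · rw [mul_comm]
      exact le_add_left (mul_le_mul' le_rfl (hab _ _ (norm_nonneg _) h (by linarith)))
  have hψ : ∫⁻ t in Set.Ioi 0, ψ t ≤
      ENNReal.ofReal ((2 : ℝ) ^ a / (1 - a) + 1 / (2 * a - 1)) * decay (2 * a - 1) ‖y‖ := by
    have hdec : decay (2 * a - 1) ‖y‖ = ENNReal.ofReal (Z ^ (1 - 2 * a)) := by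
      rw [decay, abs_of_nonneg (norm_nonneg y), hZ]; ring_nf
    have h1 : ∫⁻ t in Set.Ioc 0 Z, ψ t ≤
        ENNReal.ofReal ((2 : ℝ) ^ a / (1 - a) * Z ^ (1 - 2 * a)) := by
      have hle : ∀ t ∈ Set.Ioc 0 Z, ψ t ≤ ENNReal.ofReal (t ^ (-a) * ((2 : ℝ) ^ a * Z ^ (-a))) := by
        intro t ht
        simp only [ψ, decay]
        rw [← ENNReal.ofReal_mul (by positivity)]
        refine ENNReal.ofReal_le_ofReal ?_
        have hmax : 0 ≤ max t (‖y‖ / 2) := ht.1.le.trans (le_max_left _ _)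
        rw [abs_of_pos ht.1, abs_of_nonneg hmax]
        refine mul_le_mul (Real.rpow_le_rpow_of_nonpos ht.1 (by linarith) (by linarith)) ?_
          (by positivity) (Real.rpow_nonneg ht.1.le _)
        have h2 : (2 : ℝ) ^ a * Z ^ (-a) = (Z / 2) ^ (-a) := by
          rw [Real.div_rpow hZ0.le two_pos.le, Real.rpow_neg two_pos.le, div_inv_eq_mul, mul_comm]
        rw [h2]
        refine Real.rpow_le_rpow_of_nonpos (by positivity) ?_ (by linarith)
        have := le_max_right t (‖y‖ / 2)
        linarith
      refine (setLIntegral_mono' measurableSet_Ioc hle).trans ?_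
      have hintb : IntervalIntegrable (fun t : ℝ => t ^ (-a)) volume 0 Z :=
        intervalIntegral.intervalIntegrable_rpow' (by linarith)
      have hintb' : IntegrableOn (fun t : ℝ => t ^ (-a) * ((2 : ℝ) ^ a * Z ^ (-a)))
          (Set.Ioc 0 Z) :=
        ((intervalIntegrable_iff_integrableOn_Ioc_of_le hZ0.le).1 hintb).mul_const _
      rw [← ofReal_integral_eq_lintegral_ofReal hintb' ?_]
      · refine le_of_eq ?_
        congr 1
        rw [integral_mul_const, ← intervalIntegral.integral_of_le hZ0.le,
          integral_rpow (Or.inl (by linarith)), Real.zero_rpow (by linarith), sub_zero]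
        have e : Z ^ (1 - 2 * a) = Z ^ (-a + 1) * Z ^ (-a) := by
          rw [← Real.rpow_add hZ0]; ring_nf
        rw [e, show -a + 1 = 1 - a by ring]
        field_simp
      · filter_upwards [ae_restrict_mem measurableSet_Ioc] with t ht
        exact mul_nonneg (Real.rpow_nonneg ht.1.le _) (by positivity)
    have h2 : ∫⁻ t in Set.Ioi Z, ψ t ≤
        ENNReal.ofReal (1 / (2 * a - 1) * Z ^ (1 - 2 * a)) := by
      have hle : ∀ t ∈ Set.Ioi Z, ψ t ≤ ENNReal.ofReal (t ^ (-(2 * a))) := by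
        intro t ht
        have ht0 : 0 < t := hZ0.trans ht
        simp only [ψ, decay]
        rw [← ENNReal.ofReal_mul (by positivity)]
        refine ENNReal.ofReal_le_ofReal ?_
        have hmax : 0 ≤ max t (‖y‖ / 2) := ht0.le.trans (le_max_left _ _)
        rw [abs_of_pos ht0, abs_of_nonneg hmax, show -(2 * a) = -a + -a by ring,
          Real.rpow_add ht0]
        refine mul_le_mul (Real.rpow_le_rpow_of_nonpos ht0 (by linarith) (by linarith))
          (Real.rpow_le_rpow_of_nonpos ht0 ?_ (by linarith))
          (by positivity) (Real.rpow_nonneg ht0.le _)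
        have := le_max_left t (‖y‖ / 2)
        linarith
      refine (setLIntegral_mono' measurableSet_Ioi hle).trans ?_
      rw [← ofReal_integral_eq_lintegral_ofReal
        (integrableOn_Ioi_rpow_of_lt (by linarith) hZ0) ?_]
      · refine le_of_eq ?_
        congr 1
        rw [integral_Ioi_rpow_of_lt (by linarith) hZ0, show -(2 * a) + 1 = 1 - 2 * a by ring]
        have : (1 - 2 * a) ≠ 0 := by linarith
        have : (2 * a - 1) ≠ 0 := by linarith
        rw [show 1 - 2 * a = -(2 * a - 1) by ring]
        field_simp
      · filter_upwards [ae_restrict_mem measurableSet_Ioi] with t ht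
        exact Real.rpow_nonneg (hZ0.trans ht).le _
    have h3 : 0 < 1 - a := by linarith
    have h4 : 0 < 2 * a - 1 := by linarith
    rw [← Set.Ioc_union_Ioi_eq_Ioi hZ0.le, hdec]
    refine (lintegral_union_le _ _ _).trans ((add_le_add h1 h2).trans (le_of_eq ?_))
    rw [← ENNReal.ofReal_add (by positivity) (by positivity), ← ENNReal.ofReal_mul (by positivity)]
    congr 1
    ring
  have hcirc := (lintegral_addCircle_comp_norm_le (T := T) ψ hψm).trans (mul_le_mul' le_rfl hψ)
  calc ∫⁻ x, decay a ‖x‖ * decay a ‖y - x‖ ≤ ∫⁻ x, (ψ ‖x‖ + ψ ‖y - x‖) := lintegral_mono hpt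
    _ = (∫⁻ x : AddCircle T, ψ ‖x‖) + ∫⁻ x : AddCircle T, ψ ‖x‖ := by
        rw [lintegral_add_left (f := fun x : AddCircle T => ψ ‖x‖) (hψm.comp measurable_norm)]
        congr 1
        exact lintegral_sub_left_eq_self (fun x => ψ ‖x‖) y
    _ ≤ _ := by
        refine (add_le_add hcirc hcirc).trans (le_of_eq ?_)
        push_cast
        rw [← two_mul, ← mul_assoc, ← mul_assoc, ← mul_assoc]
        rfl

/-! ### The circle of time frequencies, the modulation weight and the kernel bound. -/

instance fact_two_pi_div_pos (τ : ℝ) [hτ : Fact (0 < τ)] : Fact (0 < 2 * Real.pi / τ) :=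
  ⟨div_pos Real.two_pi_pos hτ.out⟩

/-- The circle `ℝ / (2π/τ)ℤ` of time frequencies. -/
abbrev TimeCircle (τ : ℝ) : Type := AddCircle (2 * Real.pi / τ)

/-- The function `d_τ` on the circle of time frequencies. -/
def dCircle (τ : ℝ) (x : TimeCircle τ) : ℂ := (fourier 1 x - 1) / τ

theorem fourier_timeCircle_coe {τ : ℝ} (hτ : 0 < τ) (n : ℤ) (σ : ℝ) :
    fourier n (σ : TimeCircle τ) = timeMode τ n σ := by
  rw [fourier_coe_apply, timeMode]
  congr 1
  have h1 : (Real.pi : ℂ) ≠ 0 := by exact_mod_cast Real.pi_ne_zero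
  have h2 : (τ : ℂ) ≠ 0 := by exact_mod_cast hτ.ne'
  push_cast
  field_simp

theorem dCircle_coe {τ : ℝ} (hτ : 0 < τ) (σ : ℝ) : dCircle τ (σ : TimeCircle τ) = dTau τ σ := by
  rw [dCircle, fourier_timeCircle_coe hτ, timeMode, dTau]
  push_cast
  rw [mul_one]

theorem continuous_dCircle (τ : ℝ) : Continuous (dCircle τ) := by
  unfold dCircle
  fun_prop

/-- `|e^{iτσ} - 1| = 2 |sin(τσ/2)|`, and Jordan's inequality applies on the symmetric period. -/
theorem norm_le_norm_dCircle {τ : ℝ} (hτ : 0 < τ) (x : TimeCircle τ) :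
    2 / Real.pi * ‖x‖ ≤ ‖dCircle τ x‖ := by
  have hT : 0 < 2 * Real.pi / τ := div_pos Real.two_pi_pos hτ
  have : Fact (0 < 2 * Real.pi / τ) := ⟨hT⟩
  obtain ⟨σ, hσ, rfl⟩ : ∃ σ ∈ Set.Ioc (-(Real.pi / τ)) (-(Real.pi / τ) + 2 * Real.pi / τ),
      (σ : TimeCircle τ) = x := by
    have := AddCircle.coe_image_Ioc_eq (2 * Real.pi / τ) (-(Real.pi / τ))
    have hx : x ∈ (Set.univ : Set (TimeCircle τ)) := trivial
    rw [← this] at hx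
    exact hx
  have hσ' : |σ| ≤ Real.pi / τ := by
    rw [abs_le]
    exact ⟨hσ.1.le, by have := hσ.2; ring_nf at this ⊢; linarith⟩
  rw [(AddCircle.norm_coe_eq_abs_iff _ hT.ne').2
    (by rw [abs_of_pos hT]; refine hσ'.trans (le_of_eq (by ring)))]
  rw [dCircle_coe hτ, dTau, norm_div, Complex.norm_of_nonneg hτ.le,
    show Complex.I * τ * σ = Complex.I * ((τ * σ : ℝ) : ℂ) by push_cast; ring,
    Complex.norm_exp_I_mul_ofReal_sub_one, le_div_iff₀ hτ, norm_mul, Real.norm_eq_abs,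
    Real.norm_eq_abs, abs_two]
  have h := Real.mul_abs_le_abs_sin (x := τ * σ / 2) (by
    rw [abs_div, abs_mul, abs_of_pos hτ, abs_two]
    have : τ * |σ| ≤ Real.pi := by
      rw [le_div_iff₀ hτ] at hσ'; linarith
    linarith)
  rw [abs_div, abs_mul, abs_of_pos hτ, abs_two] at h
  linarith

theorem one_add_norm_le_bracket_dCircle {τ : ℝ} (hτ : 0 < τ) (x : TimeCircle τ) :
    1 + ‖x‖ ≤ 4 * bracket (dCircle τ x) := by
  have h := norm_le_norm_dCircle hτ x
  have hpi : ‖x‖ ≤ 2 * ‖dCircle τ x‖ := by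
    have h2 : 1 / 2 ≤ 2 / Real.pi := by
      rw [div_le_div_iff₀ two_pos Real.pi_pos]; linarith [Real.pi_le_four]
    nlinarith [norm_nonneg x]
  rw [bracket, ← Real.sqrt_eq_rpow]
  have h0 : 0 ≤ 1 + ‖dCircle τ x‖ ^ 2 := by positivity
  have hs := Real.sq_sqrt h0
  have hs0 := Real.sqrt_nonneg (1 + ‖dCircle τ x‖ ^ 2)
  have hn := norm_nonneg (dCircle τ x)
  refine le_of_sq_le_sq ?_ (by positivity)
  have h1 : ‖x‖ ^ 2 ≤ 4 * ‖dCircle τ x‖ ^ 2 := by nlinarith [norm_nonneg x]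
  nlinarith [sq_nonneg (1 - ‖x‖)]

theorem one_le_bracket {E : Type*} [NormedAddCommGroup E] (x : E) : 1 ≤ bracket x := by
  rw [bracket]
  exact Real.one_le_rpow (by nlinarith [norm_nonneg x]) (by norm_num)

theorem bracket_pos {E : Type*} [NormedAddCommGroup E] (x : E) : 0 < bracket x :=
  zero_lt_one.trans_le (one_le_bracket x)

theorem ofReal_bracket_dCircle_le {τ a : ℝ} (hτ : 0 < τ) (ha : 0 ≤ a) (x : TimeCircle τ) :
    ENNReal.ofReal (bracket (dCircle τ x) ^ (-a)) ≤ ENNReal.ofReal (4 ^ a) * decay a ‖x‖ := by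
  have h1 : 1 + |‖x‖| ≤ 4 * (1 + |bracket (dCircle τ x) - 1|) := by
    rw [abs_of_nonneg (norm_nonneg x), abs_of_nonneg (by linarith [one_le_bracket (dCircle τ x)])]
    linarith [one_add_norm_le_bracket_dCircle hτ x]
  have h := decay_le_of_le_mul ha (by norm_num) h1
  refine le_trans (le_of_eq ?_) h
  rw [decay, abs_of_nonneg (by linarith [one_le_bracket (dCircle τ x)])]
  ring_nf

theorem norm_freqVec_sq {d : ℕ} (k : Fin d → ℤ) : ‖freqVec k‖ ^ 2 = ∑ j, (k j : ℝ) ^ 2 := by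
  rw [EuclideanSpace.norm_sq_eq]
  simp [freqVec]

theorem norm_freqVec_sq_le {d : ℕ} {τ : ℝ} (hτ : 0 < τ) {k : Fin d → ℤ} (hk : k ∈ filterSet d τ) :
    ‖freqVec k‖ ^ 2 ≤ d / τ := by
  rw [norm_freqVec_sq]
  rw [mem_filterSet] at hk
  have h : ∀ j ∈ Finset.univ, (k j : ℝ) ^ 2 ≤ 1 / τ := by
    intro j _
    have h1 : (k j : ℝ) ^ 2 ≤ (τ ^ (-(1 / 2) : ℝ)) ^ 2 := sq_le_sq' (abs_le.1 (hk j)).1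
      (abs_le.1 (hk j)).2
    refine h1.trans (le_of_eq ?_)
    rw [← Real.rpow_natCast, ← Real.rpow_mul hτ.le]
    norm_num [Real.rpow_neg_one]
  refine (Finset.sum_le_sum h).trans (le_of_eq ?_)
  simp [div_eq_mul_inv]

/-- The circle norm is the distance to the nearest multiple of `2π/τ`. Since `|σ - Q| ≤ (π + 2d)/τ`,
only `2d + 3` multiples compete, a number independent of `τ`. The bound on `Q` comes from the
filter. -/
theorem decay_norm_le_sum {τ γ : ℝ} (hτ : 0 < τ) (d : ℕ) {σ Q : ℝ}
    (hσ : |σ| ≤ Real.pi / τ) (hQ : 0 ≤ Q) (hQ' : Q ≤ 2 * d / τ) :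
    decay γ ‖((σ - Q : ℝ) : TimeCircle τ)‖ ≤ ∑ j ∈ Finset.Icc (-((d : ℤ) + 1)) (d + 1),
      decay γ (σ - j * (2 * Real.pi / τ) - Q) := by
  have hT : 0 < 2 * Real.pi / τ := div_pos Real.two_pi_pos hτ
  rw [AddCircle.norm_eq, decay_abs]
  set j := round ((2 * Real.pi / τ)⁻¹ * (σ - Q)) with hj
  have hmem : j ∈ Finset.Icc (-((d : ℤ) + 1)) (d + 1) := by
    have h1 := abs_sub_round ((2 * Real.pi / τ)⁻¹ * (σ - Q))
    rw [← hj] at h1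
    have h2 : |(2 * Real.pi / τ)⁻¹ * (σ - Q)| ≤ 1 / 2 + d / 3 := by
      -- The true value is `1/2 + d/π`, weakened by `π ≥ 3`; rounding costs another `1/2`.
      rw [abs_mul, abs_of_pos (inv_pos.2 hT), inv_mul_le_iff₀ hT]
      have h3 : |σ - Q| ≤ Real.pi / τ + 2 * d / τ := by
        rw [abs_le] at hσ ⊢
        have : 0 ≤ Real.pi / τ := by positivity
        constructor <;> linarith
      refine h3.trans ?_
      have h4 : 2 * Real.pi / τ * (1 / 2 + d / 3) = Real.pi / τ + 2 * d / τ * (Real.pi / 3) := by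
        field_simp
      rw [h4]
      have h5 : 1 ≤ Real.pi / 3 := by linarith [Real.pi_gt_three]
      have h6 : 0 ≤ 2 * d / τ := by positivity
      nlinarith
    have h3 : |(j : ℝ)| ≤ d + 1 := by
      have h4 : |(j : ℝ)| ≤ |(2 * Real.pi / τ)⁻¹ * (σ - Q)| +
          |(2 * Real.pi / τ)⁻¹ * (σ - Q) - j| := by
        have := abs_sub ((2 * Real.pi / τ)⁻¹ * (σ - Q)) ((2 * Real.pi / τ)⁻¹ * (σ - Q) - j)
        simpa using this
      have : (0 : ℝ) ≤ d := Nat.cast_nonneg d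
      linarith
    rw [Finset.mem_Icc, ← abs_le]
    exact_mod_cast h3
  refine le_trans (le_of_eq ?_) (Finset.single_le_sum (fun _ _ => zero_le) hmem)
  congr 1
  ring

/-- The group of time and space frequencies. -/
abbrev FreqGroup (τ : ℝ) (d : ℕ) : Type := TimeCircle τ × (Fin d → ℤ)

/-- Haar measure `dσ dk` on the group of frequencies. -/
def freqMeasure (τ : ℝ) (d : ℕ) [Fact (0 < τ)] : Measure (FreqGroup τ d) :=
  volume.prod Measure.count

/-- The modulation weight `⟨d_τ(σ - |k|²)⟩`. -/
def modWeight {τ : ℝ} {d : ℕ} (z : FreqGroup τ d) : ℝ :=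
  bracket (dCircle τ (z.1 - ((‖freqVec z.2‖ ^ 2 : ℝ) : TimeCircle τ)))

/-- The weight `⟨k⟩^s ⟨d_τ(σ - |k|²)⟩^b`. -/
def weight {τ : ℝ} {d : ℕ} (s b : ℝ) (z : FreqGroup τ d) : ℝ≥0∞ :=
  ENNReal.ofReal (bracket (freqVec z.2) ^ s * modWeight z ^ b)

theorem modWeight_pos {τ : ℝ} {d : ℕ} (z : FreqGroup τ d) : 0 < modWeight z := bracket_pos _

theorem measurable_bracket : Measurable (bracket : ℂ → ℝ) := by
  unfold bracket
  fun_prop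

theorem measurable_weight {τ : ℝ} {d : ℕ} (s b : ℝ) :
    Measurable (weight s b : FreqGroup τ d → ℝ≥0∞) := by
  refine measurable_from_prod_countable_left fun k => ?_
  simp only [weight, modWeight]
  have h : Measurable fun x : TimeCircle τ =>
      bracket (dCircle τ (x - ((‖freqVec k‖ ^ 2 : ℝ) : TimeCircle τ))) :=
    measurable_bracket.comp ((continuous_dCircle τ).comp (by fun_prop)).measurable
  fun_prop

theorem lintegral_freqMeasure {τ : ℝ} {d : ℕ} [Fact (0 < τ)] {f : FreqGroup τ d → ℝ≥0∞}
    (hf : Measurable f) : ∫⁻ z, f z ∂(freqMeasure τ d) = ∑' k, ∫⁻ x, f (x, k) := by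
  rw [freqMeasure, lintegral_prod_symm' _ hf, lintegral_count]

theorem weight_mul_weight {τ : ℝ} {d : ℕ} (s s' b b' : ℝ) (z : FreqGroup τ d) :
    weight s b z * weight s' b' z = weight (s + s') (b + b') z := by
  have h1 := bracket_pos (freqVec z.2)
  have h2 := modWeight_pos z
  rw [weight, weight, weight, ← ENNReal.ofReal_mul (by positivity), Real.rpow_add h1,
    Real.rpow_add h2]
  congr 1
  ring

theorem bracket_freqVec_rpow {d : ℕ} (k : Fin d → ℤ) (s : ℝ) :
    bracket (freqVec k) ^ (-(2 * s)) = (1 + ∑ j, (k j : ℝ) ^ 2) ^ (-s) := by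
  rw [bracket, norm_freqVec_sq, ← Real.rpow_mul (by positivity)]
  congr 1
  ring

/-- The kernel of the Cauchy–Schwarz argument. For fixed `p` the time integral is a convolution of
two decays of exponent `2b` and gives exponent `2 (2b) - 1 = 4b - 1`; unfolding the circle then
leaves finitely many lattice sums, each bounded uniformly in its centre. -/
theorem exists_lintegral_weight_le {d : ℕ} (hd : 1 ≤ d) {s b : ℝ} (hs : 0 < s) (hb : 1 / 4 < b)
    (hb' : b < 1 / 2) (h : (d : ℝ) / 2 < s + (4 * b - 1)) :
    ∃ K : ℝ≥0, ∀ (τ : ℝ) [Fact (0 < τ)] (z : FreqGroup τ d),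
      ∫⁻ y, {y : FreqGroup τ d | y.2 ∈ filterSet d τ ∧ z.2 - y.2 ∈ filterSet d τ}.indicator
        (fun y => weight (-(2 * s)) (-(2 * b)) y * weight 0 (-(2 * b)) (z - y)) y
          ∂(freqMeasure τ d) ≤ K := by
  obtain ⟨C, hC⟩ := exists_lintegral_decay_mul_decay_le (a := 2 * b) (by linarith) (by linarith)
  obtain ⟨K, hK⟩ := exists_tsum_lattice_le (γ := 4 * b - 1) (by linarith) (by linarith) hs hd h
  refine ⟨((4 : ℝ) ^ (2 * b)).toNNReal * ((4 : ℝ) ^ (2 * b)).toNNReal * C *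
    ((Finset.Icc (-((d : ℤ) + 1)) (d + 1)).card * K), ?_⟩
  intro τ hτF z
  have hτ : 0 < τ := hτF.out
  have hT : 0 < 2 * Real.pi / τ := div_pos Real.two_pi_pos hτ
  obtain ⟨x₀, k⟩ := z
  obtain ⟨σ, hσ, rfl⟩ : ∃ σ : ℝ, |σ| ≤ Real.pi / τ ∧ (σ : TimeCircle τ) = x₀ := by
    have := AddCircle.coe_image_Ioc_eq (2 * Real.pi / τ) (-(Real.pi / τ))
    have hx : x₀ ∈ (Set.univ : Set (TimeCircle τ)) := trivial
    rw [← this] at hx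
    obtain ⟨σ, hσ, rfl⟩ := hx
    refine ⟨σ, ?_, rfl⟩
    rw [abs_le]
    exact ⟨hσ.1.le, by have := hσ.2; ring_nf at this ⊢; linarith⟩
  have hmeas : Measurable
      ({y : FreqGroup τ d | y.2 ∈ filterSet d τ ∧ k - y.2 ∈ filterSet d τ}.indicator
        (fun y => weight (-(2 * s)) (-(2 * b)) y *
          weight 0 (-(2 * b)) (((σ : TimeCircle τ), k) - y))) := by
    refine ((measurable_weight _ _).mul ((measurable_weight _ _).comp
      (measurable_const.sub measurable_id))).indicator ?_
    exact measurable_snd (Set.to_countable {p : Fin d → ℤ | p ∈ filterSet d τ ∧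
      k - p ∈ filterSet d τ}).measurableSet
  rw [lintegral_freqMeasure hmeas]
  have key : ∀ p : Fin d → ℤ, ∫⁻ x : TimeCircle τ,
      {y : FreqGroup τ d | y.2 ∈ filterSet d τ ∧ k - y.2 ∈ filterSet d τ}.indicator
        (fun y => weight (-(2 * s)) (-(2 * b)) y * weight 0 (-(2 * b)) (((σ : TimeCircle τ), k) - y))
          (x, p) ≤
      ENNReal.ofReal (4 ^ (2 * b)) * ENNReal.ofReal (4 ^ (2 * b)) * C *
        ∑ j ∈ Finset.Icc (-((d : ℤ) + 1)) (d + 1),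
          ENNReal.ofReal ((1 + ∑ i, (p i : ℝ) ^ 2) ^ (-s)) *
          decay (4 * b - 1) ((σ - j * (2 * Real.pi / τ) - (∑ i, (k i : ℝ) ^ 2) / 2) -
            (∑ i, (2 * (p i : ℝ) - k i) ^ 2) / 2) := by
    intro p
    by_cases hp : p ∈ filterSet d τ ∧ k - p ∈ filterSet d τ
    swap
    · have : ∀ x : TimeCircle τ,
        {y : FreqGroup τ d | y.2 ∈ filterSet d τ ∧ k - y.2 ∈ filterSet d τ}.indicator
        (fun y => weight (-(2 * s)) (-(2 * b)) y * weight 0 (-(2 * b)) (((σ : TimeCircle τ), k) - y))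
          (x, p) = 0 := fun x => Set.indicator_of_notMem (by simpa using hp) _
      simp only [this, lintegral_zero]
      exact zero_le
    have hind : ∀ x : TimeCircle τ,
        {y : FreqGroup τ d | y.2 ∈ filterSet d τ ∧ k - y.2 ∈ filterSet d τ}.indicator
        (fun y => weight (-(2 * s)) (-(2 * b)) y * weight 0 (-(2 * b)) (((σ : TimeCircle τ), k) - y))
          (x, p) = weight (-(2 * s)) (-(2 * b)) (x, p) *
            weight 0 (-(2 * b)) ((σ : TimeCircle τ) - x, k - p) :=
      fun x => Set.indicator_of_mem (by simpa using hp) _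
    simp only [hind]
    set q₁ : TimeCircle τ := ((‖freqVec p‖ ^ 2 : ℝ) : TimeCircle τ) with hq₁
    set q₂ : TimeCircle τ := ((‖freqVec (k - p)‖ ^ 2 : ℝ) : TimeCircle τ) with hq₂
    have hpt : ∀ x : TimeCircle τ, weight (-(2 * s)) (-(2 * b)) (x, p) *
        weight 0 (-(2 * b)) ((σ : TimeCircle τ) - x, k - p) ≤
        ENNReal.ofReal ((1 + ∑ i, (p i : ℝ) ^ 2) ^ (-s)) *
        (ENNReal.ofReal (4 ^ (2 * b)) * ENNReal.ofReal (4 ^ (2 * b))) *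
        (decay (2 * b) ‖x - q₁‖ * decay (2 * b) ‖((σ : TimeCircle τ) - q₁ - q₂) - (x - q₁)‖) := by
      intro x
      simp only [weight, modWeight]
      rw [Real.rpow_zero, one_mul, bracket_freqVec_rpow,
        ENNReal.ofReal_mul (by positivity), mul_assoc, mul_assoc]
      refine mul_le_mul' le_rfl ?_
      refine (mul_le_mul' (ofReal_bracket_dCircle_le hτ (by linarith) _)
        (ofReal_bracket_dCircle_le hτ (by linarith) _)).trans (le_of_eq ?_)
      rw [← hq₁, ← hq₂, show (σ : TimeCircle τ) - q₁ - q₂ - (x - q₁) = σ - x - q₂ by abel]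
      ring
    have hsub : ∫⁻ x : TimeCircle τ,
        decay (2 * b) ‖x - q₁‖ * decay (2 * b) ‖((σ : TimeCircle τ) - q₁ - q₂) - (x - q₁)‖ =
        ∫⁻ x : TimeCircle τ,
          decay (2 * b) ‖x‖ * decay (2 * b) ‖((σ : TimeCircle τ) - q₁ - q₂) - x‖ :=
      lintegral_sub_right_eq_self (fun x : TimeCircle τ =>
        decay (2 * b) ‖x‖ * decay (2 * b) ‖((σ : TimeCircle τ) - q₁ - q₂) - x‖) q₁
    have hmeas : Measurable fun x : TimeCircle τ =>
        decay (2 * b) ‖x - q₁‖ * decay (2 * b) ‖((σ : TimeCircle τ) - q₁ - q₂) - (x - q₁)‖ := by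
      have := measurable_decay (2 * b)
      exact (this.comp (by fun_prop)).mul (this.comp (by fun_prop))
    refine (lintegral_mono hpt).trans ?_
    rw [lintegral_const_mul _ hmeas, hsub]
    refine (mul_le_mul' le_rfl (hC _ _)).trans ?_
    set Q := ‖freqVec p‖ ^ 2 + ‖freqVec (k - p)‖ ^ 2 with hQ
    -- The parallelogram identity: with the output frequency `k` fixed, the level sets in `p` are
    -- spheres about `k/2`.
    have hQeq : Q = (∑ i, (k i : ℝ) ^ 2) / 2 + (∑ i, (2 * (p i : ℝ) - k i) ^ 2) / 2 := by
      rw [hQ, norm_freqVec_sq, norm_freqVec_sq, ← add_div, ← Finset.sum_add_distrib,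
        ← Finset.sum_add_distrib, Finset.sum_div]
      refine Finset.sum_congr rfl fun i _ => ?_
      simp only [Pi.sub_apply]
      push_cast
      ring
    have hdec := decay_norm_le_sum (γ := 4 * b - 1) hτ d hσ (Q := Q) (by positivity) (by
      have h1 := norm_freqVec_sq_le hτ hp.1
      have h2 := norm_freqVec_sq_le hτ hp.2
      rw [hQ]
      refine (add_le_add h1 h2).trans (le_of_eq (by ring)))
    have hcoe : ((σ - Q : ℝ) : TimeCircle τ) = (σ : TimeCircle τ) - q₁ - q₂ := by
      rw [hQ, hq₁, hq₂, sub_sub]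
      rfl
    rw [hcoe] at hdec
    rw [show 2 * (2 * b) - 1 = 4 * b - 1 by ring]
    rw [← Finset.mul_sum]
    have hcongr : ∀ j : ℤ, σ - j * (2 * Real.pi / τ) - (∑ i, (k i : ℝ) ^ 2) / 2 -
        (∑ i, (2 * (p i : ℝ) - k i) ^ 2) / 2 = σ - j * (2 * Real.pi / τ) - Q := by
      intro j; rw [hQeq]; ring
    simp only [hcongr]
    refine le_trans (mul_le_mul' le_rfl (mul_le_mul' le_rfl hdec)) (le_of_eq ?_)
    ring
  refine (ENNReal.tsum_le_tsum key).trans ?_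
  rw [ENNReal.tsum_mul_left, Summable.tsum_finsetSum (fun _ _ => ENNReal.summable)]
  push_cast
  refine mul_le_mul' le_rfl ?_
  refine (Finset.sum_le_card_nsmul _ _ (K : ℝ≥0∞) fun j _ => hK _ _).trans (le_of_eq ?_)
  simp

/-! ### Convolution of nonnegative functions -/

/-- Cauchy–Schwarz; the hypothesis on squares avoids roots and quotients of weights with values in
`[0,∞]`. -/
theorem sq_lintegral_le_of_sq_le_mul {α : Type*} [MeasurableSpace α] {μ : Measure α}
    {a p q : α → ℝ≥0∞} (hp : AEMeasurable p μ) (hq : AEMeasurable q μ)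
    (h : ∀ x, a x ^ 2 ≤ p x * q x) : (∫⁻ x, a x ∂μ) ^ 2 ≤ (∫⁻ x, p x ∂μ) * ∫⁻ x, q x ∂μ := by
  have h1 : ∀ x, a x ≤ ((fun x => p x ^ (1 / 2 : ℝ)) * fun x => q x ^ (1 / 2 : ℝ)) x := by
    intro x
    have := ENNReal.rpow_le_rpow (h x) (by norm_num : (0 : ℝ) ≤ 1 / 2)
    rw [ENNReal.mul_rpow_of_nonneg _ _ (by norm_num), ← ENNReal.rpow_natCast, ← ENNReal.rpow_mul]
      at this
    simpa using this
  have h2 := (lintegral_mono h1).trans (ENNReal.lintegral_mul_le_Lp_mul_Lq μ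
    (by constructor <;> norm_num : Real.HolderConjugate 2 2) (hp.pow_const _) (hq.pow_const _))
  have h3 : ∀ r : ℝ≥0∞, (r ^ (1 / 2 : ℝ)) ^ (2 : ℝ) = r := fun r => by
    rw [← ENNReal.rpow_mul]; norm_num
  have h4 : ∀ r : ℝ≥0∞, (r ^ (1 / 2 : ℝ)) ^ 2 = r := fun r => by
    rw [← ENNReal.rpow_natCast, ← ENNReal.rpow_mul]; norm_num
  simp only [h3] at h2
  calc _ ≤ _ := pow_le_pow_left' h2 2
    _ = _ := by rw [mul_pow, h4, h4]

theorem sq_lintegral_mul_le {α : Type*} [MeasurableSpace α] {μ : Measure α}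
    {f g : α → ℝ≥0∞} (hf : Measurable f) (hg : Measurable g) :
    (∫⁻ x, f x * g x ∂μ) ^ 2 ≤ (∫⁻ x, f x ^ 2 ∂μ) * ∫⁻ x, g x ^ 2 ∂μ :=
  sq_lintegral_le_of_sq_le_mul (hf.pow_const 2).aemeasurable (hg.pow_const 2).aemeasurable
    fun _ => (mul_pow _ _ _).le

/-- Duality in `L²` for nonnegative functions. -/
theorem lintegral_sq_le_of_forall_sq_lintegral_mul_le {α : Type*} [MeasurableSpace α]
    {μ : Measure α} {Φ : α → ℝ≥0∞} (hΦ : Measurable Φ) {A : Set α} (hA : μ A ≠ ∞)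
    (hΦA : ∀ x ∉ A, Φ x = 0) {K : ℝ≥0∞}
    (h : ∀ H : α → ℝ≥0∞, Measurable H → (∫⁻ x, H x * Φ x ∂μ) ^ 2 ≤ K * ∫⁻ x, H x ^ 2 ∂μ) :
    ∫⁻ x, Φ x ^ 2 ∂μ ≤ K := by
  -- `Φ` itself may fail to be square integrable. Its truncations are, since `A` has finite measure,
  -- so the common factor can be cancelled after testing against them; monotone convergence
  -- concludes.
  let F : ℕ → α → ℝ≥0∞ := fun n x => min (Φ x) n
  have hF : ∀ n, Measurable (F n) := fun n => hΦ.min measurable_const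
  have hle : ∀ n, ∫⁻ x, F n x ^ 2 ∂μ ≤ K := by
    intro n
    have hfin : ∫⁻ x, F n x ^ 2 ∂μ ≠ ∞ := by
      have hb : ∀ x, F n x ^ 2 ≤ (toMeasurable μ A).indicator (fun _ => (n : ℝ≥0∞) ^ 2) x := by
        intro x
        by_cases hx : x ∈ A
        · rw [Set.indicator_of_mem (subset_toMeasurable μ A hx)]
          exact pow_le_pow_left' (min_le_right _ _) 2
        · simp [F, hΦA x hx]
      refine ne_top_of_le_ne_top ?_ (lintegral_mono hb)
      rw [lintegral_indicator_const (measurableSet_toMeasurable μ A), measure_toMeasurable]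
      exact ENNReal.mul_ne_top (by simp) hA
    have h1 : (∫⁻ x, F n x ^ 2 ∂μ) ^ 2 ≤ K * ∫⁻ x, F n x ^ 2 ∂μ := by
      refine le_trans (pow_le_pow_left' (lintegral_mono fun x => ?_) 2) (h (F n) (hF n))
      rw [sq]
      exact mul_le_mul' le_rfl (min_le_left _ _)
    by_cases h0 : ∫⁻ x, F n x ^ 2 ∂μ = 0
    · rw [h0]; exact zero_le
    · rw [sq] at h1
      exact (ENNReal.mul_le_mul_iff_left h0 hfin).1 h1
  have hmono : Monotone fun n x => F n x ^ 2 := by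
    intro m n hmn x
    refine pow_le_pow_left' (min_le_min le_rfl ?_) 2
    exact_mod_cast hmn
  have hsup : ∀ x, Φ x ^ 2 = ⨆ n, F n x ^ 2 := by
    intro x
    refine le_antisymm ?_ (iSup_le fun n => pow_le_pow_left' (min_le_left _ _) 2)
    rcases eq_or_ne (Φ x) ∞ with hx | hx
    · have h2 : ∀ n : ℕ, (n : ℝ≥0∞) ≤ ⨆ n, F n x ^ 2 := by
        intro n
        refine le_trans ?_ (le_iSup (fun n => F n x ^ 2) n)
        simp only [F, hx]
        rw [min_eq_right le_top]
        exact_mod_cast Nat.le_self_pow two_ne_zero n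
      rw [ENNReal.eq_top_of_forall_nnreal_le (x := ⨆ n, F n x ^ 2)]
      · exact le_top
      · intro r
        obtain ⟨n, hn⟩ := exists_nat_ge r
        exact le_trans (by exact_mod_cast hn) (h2 n)
    · obtain ⟨n, hn⟩ := ENNReal.exists_nat_gt hx
      refine le_trans ?_ (le_iSup (fun n => F n x ^ 2) n)
      simp only [F]
      rw [min_eq_left hn.le]
  simp only [hsup]
  rw [lintegral_iSup (fun n => (hF n).pow_const 2) hmono]
  exact iSup_le hle

section Group

variable {G : Type*} [AddCommGroup G] [MeasurableSpace G] {μ : Measure G}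

theorem lconvolution_mono {f f' g g' : G → ℝ≥0∞} (hf : ∀ x, f x ≤ f' x) (hg : ∀ x, g x ≤ g' x)
    (z : G) : (f ⋆ₗ[μ] g) z ≤ (f' ⋆ₗ[μ] g') z :=
  lintegral_mono fun _ => mul_le_mul' (hf _) (hg _)

variable [MeasurableAdd₂ G] [MeasurableNeg G]

/-- A Leibniz rule: a weight that is subadditive up to a constant can be moved onto one of the two
factors. -/
theorem mul_lconvolution_le {m : G → ℝ≥0∞} (hm : Measurable m) {c : ℝ≥0∞}
    (hmc : ∀ x y, m (x + y) ≤ c * (m x + m y)) {f g : G → ℝ≥0∞} (hf : Measurable f)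
    (hg : Measurable g) (z : G) :
    m z * (f ⋆ₗ[μ] g) z ≤
      c * (((fun x => m x * f x) ⋆ₗ[μ] g) z + (f ⋆ₗ[μ] fun x => m x * g x) z) := by
  simp only [lconvolution_def]
  rw [← lintegral_add_left (by fun_prop), ← lintegral_const_mul _ (by fun_prop),
    ← lintegral_const_mul _ (by fun_prop)]
  refine lintegral_mono fun y => ?_
  have h := hmc y (-y + z)
  rw [add_neg_cancel_left] at h
  calc m z * (f y * g (-y + z)) ≤ c * (m y + m (-y + z)) * (f y * g (-y + z)) :=
        mul_le_mul' h le_rfl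
    _ = _ := by ring

theorem const_mul_add_lconvolution {f g h : G → ℝ≥0∞} (c : ℝ≥0∞) (hf : Measurable f)
    (hg : Measurable g) (hh : Measurable h) (z : G) :
    ((fun x => c * (f x + g x)) ⋆ₗ[μ] h) z = c * ((f ⋆ₗ[μ] h) z + (g ⋆ₗ[μ] h) z) := by
  simp only [lconvolution_def]
  rw [← lintegral_add_left (by fun_prop), ← lintegral_const_mul _ (by fun_prop)]
  exact lintegral_congr fun y => by ring

variable [SFinite μ]

/-- Convolution with the reflection of `g` is the adjoint of convolution with `g`. -/
theorem lintegral_mul_lconvolution_neg {f g h : G → ℝ≥0∞} (hf : Measurable f) (hg : Measurable g)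
    (hh : Measurable h) :
    ∫⁻ z, h z * (f ⋆ₗ[μ] fun x => g (-x)) z ∂μ = ∫⁻ z, f z * (h ⋆ₗ[μ] g) z ∂μ := by
  simp only [lconvolution_def]
  have h1 : ∀ z, h z * ∫⁻ y, f y * g (-(-y + z)) ∂μ = ∫⁻ y, h z * (f y * g (-(-y + z))) ∂μ :=
    fun z => (lintegral_const_mul _ (by fun_prop)).symm
  have h2 : ∀ z, f z * ∫⁻ y, h y * g (-y + z) ∂μ = ∫⁻ y, f z * (h y * g (-y + z)) ∂μ :=
    fun z => (lintegral_const_mul _ (by fun_prop)).symm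
  simp only [h1, h2]
  rw [lintegral_lintegral_swap (by fun_prop)]
  refine lintegral_congr fun y => lintegral_congr fun z => ?_
  rw [neg_add, neg_neg, add_comm y (-z)]
  ring

variable [μ.IsAddLeftInvariant]

/-- Schur's test for convolutions. -/
theorem lintegral_sq_lconvolution_le {f g w v F H : G → ℝ≥0∞} (hw : Measurable w)
    (hv : Measurable v) (hF : Measurable F) (hH : Measurable H)
    (hf : ∀ x, f x ^ 2 ≤ w x * F x) (hg : ∀ x, g x ^ 2 ≤ v x * H x) {K : ℝ≥0∞}
    (hK : ∀ z, (w ⋆ₗ[μ] v) z ≤ K) :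
    ∫⁻ z, (f ⋆ₗ[μ] g) z ^ 2 ∂μ ≤ K * ((∫⁻ x, F x ∂μ) * ∫⁻ x, H x ∂μ) := by
  have h1 : ∀ z, (f ⋆ₗ[μ] g) z ^ 2 ≤ K * (F ⋆ₗ[μ] H) z := by
    intro z
    rw [lconvolution_def]
    refine (sq_lintegral_le_of_sq_le_mul (p := fun y => w y * v (-y + z))
      (q := fun y => F y * H (-y + z)) (by fun_prop) (by fun_prop) fun y => ?_).trans
      (mul_le_mul' (hK z) le_rfl)
    rw [mul_pow]
    exact (mul_le_mul' (hf y) (hg _)).trans (le_of_eq (by ring))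
  refine (lintegral_mono h1).trans ?_
  rw [lintegral_const_mul _ (measurable_lconvolution μ hF hH)]
  refine mul_le_mul' le_rfl (le_of_eq ?_)
  simp only [lconvolution_def]
  rw [lintegral_lintegral_swap (by fun_prop)]
  have h2 : ∀ y, ∫⁻ z, F y * H (-y + z) ∂μ = F y * ∫⁻ z, H z ∂μ := fun y => by
    rw [lintegral_const_mul _ (by fun_prop), lintegral_add_left_eq_self]
  simp only [h2]
  rw [lintegral_mul_const _ hF]

variable [μ.IsNegInvariant]

theorem lconvolution_right_comm {f g h : G → ℝ≥0∞} (hf : Measurable f) (hg : Measurable g)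
    (hh : Measurable h) : (f ⋆ₗ[μ] g) ⋆ₗ[μ] h = (f ⋆ₗ[μ] h) ⋆ₗ[μ] g := by
  rw [← lconvolution_assoc hf hg hh, ← lconvolution_assoc hf hh hg, lconvolution_comm (f := g)]

/-- Passing to adjoints and commuting the convolutions identifies the two sides. Thus products `u ū`
obey the same bound as `u u`, and the modulation weight is never needed at reflected frequencies. -/
theorem lintegral_sq_lconvolution_neg {f g : G → ℝ≥0∞} (hf : Measurable f) (hg : Measurable g) :
    ∫⁻ z, (f ⋆ₗ[μ] fun x => g (-x)) z ^ 2 ∂μ = ∫⁻ z, (f ⋆ₗ[μ] g) z ^ 2 ∂μ := by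
  have hg' : Measurable fun x => g (-x) := by fun_prop
  simp only [sq]
  rw [lintegral_mul_lconvolution_neg hf hg (measurable_lconvolution μ hf hg'),
    lconvolution_right_comm hf hg' hg, lintegral_mul_lconvolution_neg
      (measurable_lconvolution μ hf hg) hg hf]

end Group

/-! ### Weighted bilinear and trilinear estimates on the group of frequencies. -/

section Weighted

variable {τ : ℝ} {d : ℕ}

theorem weight_zero_zero (z : FreqGroup τ d) : weight 0 0 z = 1 := by simp [weight]

theorem weight_mul_weight_neg (s b : ℝ) (z : FreqGroup τ d) :
    weight s b z * weight (-s) (-b) z = 1 := by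
  rw [weight_mul_weight, add_neg_cancel, add_neg_cancel, weight_zero_zero]

theorem weight_sq (s b : ℝ) (z : FreqGroup τ d) : weight s b z ^ 2 = weight (2 * s) (2 * b) z := by
  rw [sq, weight_mul_weight, two_mul, two_mul]

theorem measurableSet_snd_mem_filterSet :
    MeasurableSet {z : FreqGroup τ d | z.2 ∈ filterSet d τ} :=
  measurable_snd (Set.to_countable {p : Fin d → ℤ | p ∈ filterSet d τ}).measurableSet

theorem bracket_add_le {E : Type*} [NormedAddCommGroup E] (x y : E) :
    bracket (x + y) ≤ bracket x + bracket y := by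
  have e : ∀ z : E, bracket z = √(1 + ‖z‖ ^ 2) := fun z => by rw [bracket, Real.sqrt_eq_rpow]
  rw [e, e, e]
  refine Real.sqrt_le_iff.2 ⟨by positivity, ?_⟩
  have h := norm_add_le x y
  have hx : ‖x‖ ≤ √(1 + ‖x‖ ^ 2) := Real.le_sqrt_of_sq_le (by linarith)
  have hy : ‖y‖ ≤ √(1 + ‖y‖ ^ 2) := Real.le_sqrt_of_sq_le (by linarith)
  have hx2 := Real.sq_sqrt (by positivity : 0 ≤ 1 + ‖x‖ ^ 2)
  have hy2 := Real.sq_sqrt (by positivity : 0 ≤ 1 + ‖y‖ ^ 2)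
  have h1 : ‖x + y‖ ^ 2 ≤ (‖x‖ + ‖y‖) ^ 2 := pow_le_pow_left₀ (norm_nonneg _) h 2
  have h2 := mul_le_mul hx hy (norm_nonneg y) (Real.sqrt_nonneg _)
  nlinarith

theorem weight_add_le {s : ℝ} (hs : 0 ≤ s) (x y : FreqGroup τ d) :
    weight s 0 (x + y) ≤ ENNReal.ofReal (2 ^ s) * (weight s 0 x + weight s 0 y) := by
  simp only [weight, Real.rpow_zero, mul_one]
  have hbx := bracket_pos (freqVec x.2)
  have hby := bracket_pos (freqVec y.2)
  rw [← ENNReal.ofReal_add (by positivity) (by positivity), ← ENNReal.ofReal_mul (by positivity)]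
  refine ENNReal.ofReal_le_ofReal ?_
  have hadd : freqVec (x + y).2 = freqVec x.2 + freqVec y.2 := by
    ext j; simp [freqVec]
  rw [hadd]
  have hb := bracket_add_le (freqVec x.2) (freqVec y.2)
  have hmax : bracket (freqVec x.2) + bracket (freqVec y.2) ≤
      2 * max (bracket (freqVec x.2)) (bracket (freqVec y.2)) := by
    linarith [le_max_left (bracket (freqVec x.2)) (bracket (freqVec y.2)),
      le_max_right (bracket (freqVec x.2)) (bracket (freqVec y.2))]
  calc bracket (freqVec x.2 + freqVec y.2) ^ s
      ≤ (2 * max (bracket (freqVec x.2)) (bracket (freqVec y.2))) ^ s :=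
        Real.rpow_le_rpow (bracket_pos _).le (hb.trans hmax) hs
    _ = 2 ^ s * max (bracket (freqVec x.2)) (bracket (freqVec y.2)) ^ s :=
        Real.mul_rpow two_pos.le (hbx.le.trans (le_max_left _ _))
    _ ≤ _ := by
        gcongr
        rcases max_choice (bracket (freqVec x.2)) (bracket (freqVec y.2)) with h | h <;> rw [h]
        · exact le_add_of_nonneg_right (by positivity)
        · exact le_add_of_nonneg_left (by positivity)

theorem weight_neg (s : ℝ) (x : FreqGroup τ d) : weight s 0 (-x) = weight s 0 x := by
  have h : freqVec (-x).2 = -freqVec x.2 := by ext j; simp [freqVec]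
  rw [weight, weight, h]
  simp [bracket]

theorem add_three_sq_le (a b c : ℝ≥0∞) : (a + b + c) ^ 2 ≤ 9 * (a ^ 2 + b ^ 2 + c ^ 2) := by
  have h : ∀ m : ℝ≥0∞, a ≤ m → b ≤ m → c ≤ m → (a + b + c) ^ 2 ≤ 9 * m ^ 2 := by
    intro m ha hb hc
    refine (pow_le_pow_left' (add_le_add (add_le_add ha hb) hc) 2).trans (le_of_eq ?_)
    ring
  rcases le_total a b with h1 | h1 <;> rcases le_total b c with h2 | h2 <;>
    rcases le_total a c with h3 | h3
  · exact (h c h3 h2 le_rfl).trans (mul_le_mul' le_rfl le_add_self)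
  · exact (h c (h1.trans h2) h2 le_rfl).trans (mul_le_mul' le_rfl le_add_self)
  · exact (h b h1 le_rfl h2).trans (mul_le_mul' le_rfl (le_add_self.trans le_self_add))
  · exact (h b h1 le_rfl h2).trans (mul_le_mul' le_rfl (le_add_self.trans le_self_add))
  · exact (h c h3 h2 le_rfl).trans (mul_le_mul' le_rfl le_add_self)
  · exact (h a le_rfl h1 h3).trans (mul_le_mul' le_rfl (le_self_add.trans le_self_add))
  · exact (h a le_rfl h1 (h2.trans h1)).trans
      (mul_le_mul' le_rfl (le_self_add.trans le_self_add))
  · exact (h a le_rfl h1 h3).trans (mul_le_mul' le_rfl (le_self_add.trans le_self_add))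

variable [Fact (0 < τ)]

instance : SFinite (freqMeasure τ d) := by unfold freqMeasure; infer_instance

instance : (freqMeasure τ d).IsAddLeftInvariant := by unfold freqMeasure; infer_instance

instance : (freqMeasure τ d).IsNegInvariant :=
  ⟨((Measure.measurePreserving_neg (volume : Measure (TimeCircle τ))).prod
    (Measure.measurePreserving_neg (Measure.count : Measure (Fin d → ℤ)))).map_eq⟩

/-- The square of the weighted `L²` norm. -/
def weightedSq (s b : ℝ) (f : FreqGroup τ d → ℝ≥0∞) : ℝ≥0∞ :=
  ∫⁻ z, (weight s b z * f z) ^ 2 ∂(freqMeasure τ d)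

theorem weightedSq_weight_mul (s s' b b' : ℝ) (f : FreqGroup τ d → ℝ≥0∞) :
    weightedSq s b (fun z => weight s' b' z * f z) = weightedSq (s + s') (b + b') f := by
  simp only [weightedSq, ← mul_assoc, weight_mul_weight]

theorem freqMeasure_filterSet_ne_top :
    freqMeasure τ d {z : FreqGroup τ d | z.2 ∈ filterSet d τ} ≠ ∞ := by
  have h : {z : FreqGroup τ d | z.2 ∈ filterSet d τ} =
      Set.univ ×ˢ (filterSet d τ : Set (Fin d → ℤ)) := by ext; simp
  rw [h, freqMeasure, Measure.prod_prod, Measure.count_apply_finset]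
  exact ENNReal.mul_ne_top (measure_ne_top _ _) (by simp)

/-- The frequency support of `f` lies in the range of the filter. -/
def IsFiltered (f : FreqGroup τ d → ℝ≥0∞) : Prop := ∀ z, z.2 ∉ filterSet d τ → f z = 0

/-- The bilinear estimate on the Fourier side. -/
def BilinearBound (τ : ℝ) (d : ℕ) [Fact (0 < τ)] (s b : ℝ) (K : ℝ≥0∞) : Prop :=
  ∀ f g : FreqGroup τ d → ℝ≥0∞, Measurable f → Measurable g → IsFiltered f → IsFiltered g →
    ∫⁻ z, (f ⋆ₗ[freqMeasure τ d] g) z ^ 2 ∂(freqMeasure τ d) ≤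
      K * (weightedSq s b f * weightedSq 0 b g)

theorem bilinearBound_of_lintegral_weight_le {s b : ℝ} {K : ℝ≥0∞}
    (hK : ∀ z : FreqGroup τ d,
      ∫⁻ y, {y : FreqGroup τ d | y.2 ∈ filterSet d τ ∧ z.2 - y.2 ∈ filterSet d τ}.indicator
        (fun y => weight (-(2 * s)) (-(2 * b)) y * weight 0 (-(2 * b)) (z - y)) y
          ∂(freqMeasure τ d) ≤ K) : BilinearBound τ d s b K := by
  intro f g hf hg hfS hgS
  have hS := measurableSet_snd_mem_filterSet (τ := τ) (d := d)
  have hpt : ∀ (s : ℝ) (f : FreqGroup τ d → ℝ≥0∞), IsFiltered f → ∀ x, f x ^ 2 ≤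
      {z : FreqGroup τ d | z.2 ∈ filterSet d τ}.indicator (weight (-(2 * s)) (-(2 * b))) x *
        (weight s b x * f x) ^ 2 := by
    intro s f hf x
    by_cases hx : x.2 ∈ filterSet d τ
    · rw [Set.indicator_of_mem (by simpa using hx), mul_pow, weight_sq, ← mul_assoc, mul_comm
        (weight _ _ _), weight_mul_weight_neg, one_mul]
    · simp [hf x hx]
  have hg' := hpt 0 g hgS
  rw [mul_zero, neg_zero] at hg'
  refine lintegral_sq_lconvolution_le ((measurable_weight _ _).indicator hS)
    ((measurable_weight _ _).indicator hS) (((measurable_weight _ _).mul hf).pow_const 2)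
    (((measurable_weight _ _).mul hg).pow_const 2) (hpt s f hfS) hg' fun z => ?_
  refine le_trans (le_of_eq ?_) (hK z)
  rw [lconvolution_def]
  refine lintegral_congr fun y => ?_
  rw [neg_add_eq_sub]
  by_cases h1 : y.2 ∈ filterSet d τ <;> by_cases h2 : z.2 - y.2 ∈ filterSet d τ <;>
    simp [Set.indicator, h1, h2]

theorem BilinearBound.swap {s b : ℝ} {K : ℝ≥0∞} (hB : BilinearBound τ d s b K)
    {f g : FreqGroup τ d → ℝ≥0∞} (hf : Measurable f) (hg : Measurable g) (hfS : IsFiltered f)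
    (hgS : IsFiltered g) :
    ∫⁻ z, (f ⋆ₗ[freqMeasure τ d] g) z ^ 2 ∂(freqMeasure τ d) ≤
      K * (weightedSq 0 b f * weightedSq s b g) := by
  rw [lconvolution_comm, mul_comm (weightedSq 0 b f)]
  exact hB g f hg hf hgS hfS

/-- The Fourier side `f₀ * f₂ * f̃₁` of the cubic term. -/
def triConv (f : Fin 3 → FreqGroup τ d → ℝ≥0∞) : FreqGroup τ d → ℝ≥0∞ :=
  (f 0 ⋆ₗ[freqMeasure τ d] f 2) ⋆ₗ[freqMeasure τ d] fun z => f 1 (-z)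

theorem measurable_triConv {f : Fin 3 → FreqGroup τ d → ℝ≥0∞} (hf : ∀ i, Measurable (f i)) :
    Measurable (triConv f) :=
  measurable_lconvolution _ (measurable_lconvolution _ (hf 0) (hf 2))
    ((hf 1).comp measurable_neg)

/-- One factor is moved next to `h` by adjunction, Cauchy–Schwarz splits the integral into two
convolutions, and each is controlled by the bilinear bound. -/
theorem lintegral_mul_triConv_sq_le {s b : ℝ} {K : ℝ≥0∞} (hB : BilinearBound τ d s b K)
    {f : Fin 3 → FreqGroup τ d → ℝ≥0∞} (hf : ∀ i, Measurable (f i)) (hfS : ∀ i, IsFiltered (f i))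
    {h : FreqGroup τ d → ℝ≥0∞} (hh : Measurable h) (hhS : IsFiltered h) (i : Fin 3) :
    (∫⁻ z, h z * triConv f z ∂(freqMeasure τ d)) ^ 2 ≤
      K ^ 2 * (∏ j, weightedSq (if j = i then 0 else s) b (f j)) * weightedSq 0 b h := by
  have hneg : ∀ j, Measurable fun z => f j (-z) := fun j => (hf j).comp measurable_neg
  have h02 : (∫⁻ z, h z * triConv f z ∂(freqMeasure τ d)) ^ 2 ≤
      (∫⁻ z, (f 0 ⋆ₗ[freqMeasure τ d] f 2) z ^ 2 ∂(freqMeasure τ d)) *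
      ∫⁻ z, (h ⋆ₗ[freqMeasure τ d] f 1) z ^ 2 ∂(freqMeasure τ d) := by
    rw [triConv, lintegral_mul_lconvolution_neg (measurable_lconvolution _ (hf 0) (hf 2)) (hf 1) hh]
    exact sq_lintegral_mul_le (measurable_lconvolution _ (hf 0) (hf 2))
      (measurable_lconvolution _ hh (hf 1))
  have h01 : (∫⁻ z, h z * triConv f z ∂(freqMeasure τ d)) ^ 2 ≤
      (∫⁻ z, (f 0 ⋆ₗ[freqMeasure τ d] f 1) z ^ 2 ∂(freqMeasure τ d)) *
      ∫⁻ z, (h ⋆ₗ[freqMeasure τ d] f 2) z ^ 2 ∂(freqMeasure τ d) := by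
    rw [triConv, lconvolution_right_comm (hf 0) (hf 2) (hneg 1),
      ← lintegral_sq_lconvolution_neg (hf 0) (hf 1), ← lintegral_sq_lconvolution_neg hh (hf 2)]
    have e := lintegral_mul_lconvolution_neg (μ := freqMeasure τ d)
      (measurable_lconvolution (freqMeasure τ d) (hf 0) (hneg 1)) (hneg 2) hh
    simp only [neg_neg] at e
    rw [e]
    exact sq_lintegral_mul_le (measurable_lconvolution _ (hf 0) (hneg 1))
      (measurable_lconvolution _ hh (hneg 2))
  rw [Fin.prod_univ_three]
  -- Neither `f i` nor `h` carries derivatives, so they must land in different pairs: `{0, 2}, {h,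
  -- 1}` for `i = 0` and `i = 2`, but `{0, 1}, {h, 2}` for `i = 1`.
  fin_cases i
  · refine h02.trans ((mul_le_mul' (hB.swap (hf 0) (hf 2) (hfS 0) (hfS 2))
      (hB.swap hh (hf 1) hhS (hfS 1))).trans (le_of_eq ?_))
    simp
    ring
  · refine h01.trans ((mul_le_mul' (hB _ _ (hf 0) (hf 1) (hfS 0) (hfS 1))
      (hB.swap hh (hf 2) hhS (hfS 2))).trans (le_of_eq ?_))
    simp
    ring
  · refine h02.trans ((mul_le_mul' (hB _ _ (hf 0) (hf 2) (hfS 0) (hfS 2))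
      (hB.swap hh (hf 1) hhS (hfS 1))).trans (le_of_eq ?_))
    simp
    ring

/-- The trilinear estimate, with the function `f i` measured without derivatives. -/
theorem weightedSq_triConv_le {s b : ℝ} {K : ℝ≥0∞} (hB : BilinearBound τ d s b K)
    {f : Fin 3 → FreqGroup τ d → ℝ≥0∞} (hf : ∀ i, Measurable (f i)) (hfS : ∀ i, IsFiltered (f i))
    (i : Fin 3) :
    weightedSq 0 (-b) ({z : FreqGroup τ d | z.2 ∈ filterSet d τ}.indicator (triConv f)) ≤
      K ^ 2 * ∏ j, weightedSq (if j = i then 0 else s) b (f j) := by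
  have hS := measurableSet_snd_mem_filterSet (τ := τ) (d := d)
  refine lintegral_sq_le_of_forall_sq_lintegral_mul_le
    ((measurable_weight _ _).mul ((measurable_triConv hf).indicator hS))
    freqMeasure_filterSet_ne_top (fun z hz => ?_) fun h hh => ?_
  · rw [Pi.mul_apply, Set.indicator_of_notMem hz, mul_zero]
  -- The weight and the filter move onto the test function, where `weight 0 b` cancels `weight 0
  -- (-b)`.
  have e : ∀ z, h z * (weight 0 (-b) z *
      {z : FreqGroup τ d | z.2 ∈ filterSet d τ}.indicator (triConv f) z) =
      {z : FreqGroup τ d | z.2 ∈ filterSet d τ}.indicator (fun z => weight 0 (-b) z * h z) z *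
        triConv f z := by
    intro z
    by_cases hz : z.2 ∈ filterSet d τ
    · have hz' : z ∈ {z : FreqGroup τ d | z.2 ∈ filterSet d τ} := hz
      rw [Set.indicator_of_mem hz', Set.indicator_of_mem hz']; ring
    · simp [Set.indicator, hz]
  simp only [Pi.mul_apply, e]
  refine (lintegral_mul_triConv_sq_le hB hf hfS (((measurable_weight _ _).mul hh).indicator hS)
    (fun z hz => Set.indicator_of_notMem (by simpa using hz) _) i).trans ?_
  refine mul_le_mul' le_rfl (lintegral_mono fun z => pow_le_pow_left' ?_ 2)
  by_cases hz : z.2 ∈ filterSet d τ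
  · have hz' : z ∈ {z : FreqGroup τ d | z.2 ∈ filterSet d τ} := hz
    rw [Set.indicator_of_mem hz', Pi.mul_apply, ← mul_assoc, weight_mul_weight, add_zero, add_neg_cancel, weight_zero_zero, one_mul]
  · simp [Set.indicator, hz]

/-- The Leibniz rule applied twice. It reduces the estimate with `s` derivatives to the one where a
single factor, now weighted, is measured without derivatives. -/
theorem weight_mul_triConv_le {s : ℝ} (hs : 0 ≤ s) {f : Fin 3 → FreqGroup τ d → ℝ≥0∞}
    (hf : ∀ i, Measurable (f i)) (z : FreqGroup τ d) :
    weight s 0 z * triConv f z ≤ ENNReal.ofReal (2 ^ s) ^ 2 *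
      ∑ i, triConv (Function.update f i fun z => weight s 0 z * f i z) z := by
  have hm := measurable_weight (τ := τ) (d := d) s 0
  have hc1 : 1 ≤ ENNReal.ofReal ((2 : ℝ) ^ s) := by
    rw [ENNReal.one_le_ofReal]; exact Real.one_le_rpow one_le_two hs
  have hneg : Measurable fun z => f 1 (-z) := (hf 1).comp measurable_neg
  have h1 := mul_lconvolution_le (μ := freqMeasure τ d) hm (weight_add_le hs)
    (measurable_lconvolution (freqMeasure τ d) (hf 0) (hf 2)) hneg z
  have h2 : ((fun x => weight s 0 x * (f 0 ⋆ₗ[freqMeasure τ d] f 2) x) ⋆ₗ[freqMeasure τ d]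
      fun z => f 1 (-z)) z ≤ ENNReal.ofReal (2 ^ s) *
      (triConv (Function.update f 0 fun z => weight s 0 z * f 0 z) z +
        triConv (Function.update f 2 fun z => weight s 0 z * f 2 z) z) := by
    simp only [triConv]
    simp only [Function.update_self, ne_eq, Fin.reduceEq, not_false_eq_true,
      Function.update_of_ne]
    refine (lconvolution_mono (fun x => mul_lconvolution_le hm (weight_add_le hs) (hf 0) (hf 2) x)
      (fun x => le_rfl) z).trans (le_of_eq ?_)
    exact const_mul_add_lconvolution _ (measurable_lconvolution _ (hm.mul (hf 0)) (hf 2))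
      (measurable_lconvolution _ (hf 0) (hm.mul (hf 2))) hneg z
  have h3 : ((f 0 ⋆ₗ[freqMeasure τ d] f 2) ⋆ₗ[freqMeasure τ d] fun x => weight s 0 x * f 1 (-x)) z =
      triConv (Function.update f 1 fun z => weight s 0 z * f 1 z) z := by
    simp only [triConv, Function.update_self, ne_eq, Fin.reduceEq, not_false_eq_true,
      Function.update_of_ne, weight_neg]
  rw [h3] at h1
  rw [triConv, Fin.sum_univ_three]
  refine (h1.trans (mul_le_mul' le_rfl (add_le_add h2 le_rfl))).trans ?_
  generalize triConv (Function.update f 0 fun z => weight s 0 z * f 0 z) z = t₀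
  generalize triConv (Function.update f 1 fun z => weight s 0 z * f 1 z) z = t₁
  generalize triConv (Function.update f 2 fun z => weight s 0 z * f 2 z) z = t₂
  generalize ENNReal.ofReal ((2 : ℝ) ^ s) = c at hc1
  calc c * (c * (t₀ + t₂) + t₁) ≤ c * (c * (t₀ + t₂) + c * t₁) := by
        gcongr
        exact le_mul_of_one_le_left zero_le hc1
    _ = c ^ 2 * (t₀ + t₁ + t₂) := by ring

/-- The trilinear estimate with all functions measured with `s` derivatives. -/
theorem weightedSq_triConv_le_of_nonneg {s b : ℝ} (hs : 0 ≤ s) {K : ℝ≥0∞}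
    (hB : BilinearBound τ d s b K) {f : Fin 3 → FreqGroup τ d → ℝ≥0∞}
    (hf : ∀ i, Measurable (f i)) (hfS : ∀ i, IsFiltered (f i)) :
    weightedSq s (-b) ({z : FreqGroup τ d | z.2 ∈ filterSet d τ}.indicator (triConv f)) ≤
      27 * ENNReal.ofReal (2 ^ s) ^ 4 * K ^ 2 * ∏ j, weightedSq s b (f j) := by
  have hS := measurableSet_snd_mem_filterSet (τ := τ) (d := d)
  have hm := measurable_weight (τ := τ) (d := d) s 0
  let g : Fin 3 → Fin 3 → FreqGroup τ d → ℝ≥0∞ := fun i =>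
    Function.update f i fun z => weight s 0 z * f i z
  have hg : ∀ i j, Measurable (g i j) := by
    intro i j
    by_cases h : j = i
    · subst h; simp only [g, Function.update_self]; exact hm.mul (hf j)
    · simp only [g]; rw [Function.update_of_ne h]; exact hf j
  have hgS : ∀ i j, IsFiltered (g i j) := by
    intro i j z hz
    by_cases h : j = i
    · subst h; simp only [g, Function.update_self]; rw [hfS j z hz, mul_zero]
    · simp only [g]; rw [Function.update_of_ne h]; exact hfS j z hz
  have hi : ∀ i, weightedSq 0 (-b)
      ({z : FreqGroup τ d | z.2 ∈ filterSet d τ}.indicator (triConv (g i))) ≤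
      K ^ 2 * ∏ j, weightedSq s b (f j) := by
    intro i
    refine (weightedSq_triConv_le hB (hg i) (hgS i) i).trans (le_of_eq ?_)
    congr 1
    refine Finset.prod_congr rfl fun j _ => ?_
    by_cases h : j = i
    · subst h
      simp only [g, Function.update_self, if_true]
      rw [weightedSq_weight_mul, zero_add, add_zero]
    · simp only [g, h, if_false]; rw [Function.update_of_ne h]
  have hpt : ∀ z, (weight s (-b) z *
      {z : FreqGroup τ d | z.2 ∈ filterSet d τ}.indicator (triConv f) z) ^ 2 ≤
      9 * ENNReal.ofReal (2 ^ s) ^ 4 * ∑ i, (weight 0 (-b) z *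
        {z : FreqGroup τ d | z.2 ∈ filterSet d τ}.indicator (triConv (g i)) z) ^ 2 := by
    intro z
    by_cases hz : z.2 ∈ filterSet d τ
    swap
    · simp [Set.indicator, hz]
    have e : ∀ φ : FreqGroup τ d → ℝ≥0∞,
        {z : FreqGroup τ d | z.2 ∈ filterSet d τ}.indicator φ z = φ z :=
      fun φ => Set.indicator_of_mem (s := {z : FreqGroup τ d | z.2 ∈ filterSet d τ}) hz φ
    simp only [e]
    have e2 : weight s (-b) z = weight 0 (-b) z * weight s 0 z := by
      rw [weight_mul_weight, zero_add, add_zero]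
    rw [e2, mul_assoc]
    refine (pow_le_pow_left' (mul_le_mul' le_rfl (weight_mul_triConv_le hs hf z)) 2).trans ?_
    rw [Fin.sum_univ_three, Fin.sum_univ_three]
    calc _ = ENNReal.ofReal (2 ^ s) ^ 4 * (weight 0 (-b) z * triConv (g 0) z +
          weight 0 (-b) z * triConv (g 1) z + weight 0 (-b) z * triConv (g 2) z) ^ 2 := by ring
      _ ≤ _ := mul_le_mul' le_rfl (add_three_sq_le _ _ _)
      _ = _ := by ring
  have hmeas : ∀ i, Measurable fun z => (weight 0 (-b) z *
        {z : FreqGroup τ d | z.2 ∈ filterSet d τ}.indicator (triConv (g i)) z) ^ 2 := fun i =>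
    ((measurable_weight _ _).mul ((measurable_triConv (hg i)).indicator hS)).pow_const 2
  -- In the constant, `27 = 9 · 3`: nine from squaring a sum of three terms, three from their
  -- number.
  calc _ ≤ _ := lintegral_mono hpt
    _ = 9 * ENNReal.ofReal (2 ^ s) ^ 4 * ∑ i, weightedSq 0 (-b)
        ({z : FreqGroup τ d | z.2 ∈ filterSet d τ}.indicator (triConv (g i))) := by
        rw [lintegral_const_mul _ (Finset.measurable_fun_sum _ fun i _ => hmeas i),
          lintegral_finsetSum _ fun i _ => hmeas i]
        rfl
    _ ≤ 9 * ENNReal.ofReal (2 ^ s) ^ 4 * ∑ _i : Fin 3, K ^ 2 * ∏ j, weightedSq s b (f j) :=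
        mul_le_mul' le_rfl (Finset.sum_le_sum fun i _ => hi i)
    _ = _ := by
        rw [Fin.sum_univ_three]
        ring

/-- The bilinear estimate with the derivatives shared equally. -/
theorem lintegral_sq_lconvolution_self_le {s b : ℝ} {K : ℝ≥0∞} (hB : BilinearBound τ d s b K)
    {f : FreqGroup τ d → ℝ≥0∞} (hf : Measurable f) (hfS : IsFiltered f) :
    ∫⁻ z, (f ⋆ₗ[freqMeasure τ d] f) z ^ 2 ∂(freqMeasure τ d) ≤
      4 * K * weightedSq (s / 2) b f ^ 2 := by
  let A : FreqGroup τ d → ℝ≥0∞ := fun z => weight (-(s / 2)) 0 z * f z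
  let B : FreqGroup τ d → ℝ≥0∞ := fun z => weight (s / 2) 0 z * f z
  have hA : Measurable A := (measurable_weight _ _).mul hf
  have hBm : Measurable B := (measurable_weight _ _).mul hf
  -- For each pair of frequencies one of the two ratios of the weights `⟨k⟩^(s/2)` is at least one.
  -- Hence `s/2` derivatives may be taken from one factor and put on the other; the bilinear bound
  -- then leaves `s/2` on both.
  have hpt : ∀ z, (f ⋆ₗ[freqMeasure τ d] f) z ≤ 2 * (A ⋆ₗ[freqMeasure τ d] B) z := by
    intro z
    rw [two_mul ((A ⋆ₗ[freqMeasure τ d] B) z)]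
    nth_rewrite 2 [lconvolution_comm]
    simp only [lconvolution_def]
    rw [← lintegral_add_left (by fun_prop)]
    refine lintegral_mono fun y => ?_
    simp only [A, B]
    obtain ⟨x, hx⟩ : ∃ x, x = -y + z := ⟨_, rfl⟩
    rw [← hx]
    have h1 : 1 ≤ weight (-(s / 2)) 0 y * weight (s / 2) 0 x +
        weight (s / 2) 0 y * weight (-(s / 2)) 0 x := by
      have e1 := weight_mul_weight_neg (s / 2) 0 y
      have e2 := weight_mul_weight_neg (s / 2) 0 x
      rw [neg_zero] at e1 e2
      rcases le_total (weight (s / 2) 0 y) (weight (s / 2) 0 x) with h | h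
      · refine le_trans ?_ le_self_add
        rw [← e1, mul_comm]
        exact mul_le_mul' le_rfl h
      · refine le_trans ?_ le_add_self
        rw [← e2]
        exact mul_le_mul' h le_rfl
    calc f y * f x ≤ (weight (-(s / 2)) 0 y * weight (s / 2) 0 x +
        weight (s / 2) 0 y * weight (-(s / 2)) 0 x) * (f y * f x) :=
          le_mul_of_one_le_left zero_le h1
      _ = _ := by ring
  have hAS : IsFiltered A := fun z hz => by simp only [A]; rw [hfS z hz, mul_zero]
  have hBS : IsFiltered B := fun z hz => by simp only [B]; rw [hfS z hz, mul_zero]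
  have hAB := hB A B hA hBm hAS hBS
  rw [weightedSq_weight_mul, weightedSq_weight_mul, zero_add, add_zero,
    show s + -(s / 2) = s / 2 by ring] at hAB
  calc _ ≤ ∫⁻ z, 4 * (A ⋆ₗ[freqMeasure τ d] B) z ^ 2 ∂(freqMeasure τ d) := by
        refine lintegral_mono fun z => (pow_le_pow_left' (hpt z) 2).trans (le_of_eq ?_)
        ring
    _ = 4 * ∫⁻ z, (A ⋆ₗ[freqMeasure τ d] B) z ^ 2 ∂(freqMeasure τ d) :=
        lintegral_const_mul _ ((measurable_lconvolution _ hA hBm).pow_const 2)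
    _ ≤ _ := (mul_le_mul' le_rfl hAB).trans (le_of_eq (by ring))

end Weighted

/-! ### Trigonometric polynomials on the torus -/

theorem integral_fourier {T : ℝ} [hT : Fact (0 < T)] (n : ℤ) :
    ∫ x : AddCircle T, fourier n x = if n = 0 then (T : ℂ) else 0 := by
  have h : fourierCoeff (T := T) (fourier n) 0 =
      ∫ x : AddCircle T, fourier n x ∂AddCircle.haarAddCircle := by
    simp [fourierCoeff]
  rw [fourierCoeff_fourier, AddCircle.integral_haarAddCircle] at h
  have hT0 : (T : ℂ) ≠ 0 := by exact_mod_cast hT.out.ne'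
  have h2 : ∫ x : AddCircle T, fourier n x = (T : ℂ) * (Pi.single n (1 : ℂ) : ℤ → ℂ) 0 := by
    rw [h, Complex.real_smul]
    push_cast
    field_simp
  rw [h2]
  by_cases hn : n = 0
  · subst hn; simp
  · rw [Pi.single_eq_of_ne (Ne.symm hn), if_neg hn, mul_zero]

theorem continuous_character {d : ℕ} (k : Fin d → ℤ) : Continuous (character k) := by
  unfold character
  fun_prop

theorem character_add {d : ℕ} (k l : Fin d → ℤ) (x : Torus d) :
    character (k + l) x = character k x * character l x := by
  simp only [character, Pi.add_apply, fourier_add, Finset.prod_mul_distrib]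

theorem character_neg {d : ℕ} (k : Fin d → ℤ) (x : Torus d) :
    character (-k) x = starRingEnd ℂ (character k x) := by
  simp only [character, Pi.neg_apply, fourier_neg, map_prod]

theorem norm_character {d : ℕ} (k : Fin d → ℤ) (x : Torus d) : ‖character k x‖ = 1 := by
  rw [character, norm_prod]
  exact Finset.prod_eq_one fun j _ => by rw [fourier_apply]; exact Circle.norm_coe _

theorem integral_character {d : ℕ} (k : Fin d → ℤ) :
    ∫ x, character k x = if k = 0 then ((2 * Real.pi) ^ d : ℂ) else 0 := by
  unfold character
  rw [integral_fintype_prod_volume_eq_prod (fun j (y : AddCircle (2 * Real.pi)) => fourier (k j) y)]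
  simp only [integral_fourier]
  split_ifs with h
  · subst h; simp
  · obtain ⟨j, hj⟩ := Function.ne_iff.1 h
    exact Finset.prod_eq_zero (Finset.mem_univ j) (if_neg hj)

/-- The trigonometric polynomial with coefficients `c` and frequencies in `A`. -/
def trigPoly {d : ℕ} (A : Finset (Fin d → ℤ)) (c : (Fin d → ℤ) → ℂ) (x : Torus d) : ℂ :=
  ∑ k ∈ A, c k * character k x

theorem continuous_trigPoly {d : ℕ} (A : Finset (Fin d → ℤ)) (c : (Fin d → ℤ) → ℂ) :
    Continuous (trigPoly A c) := by
  unfold trigPoly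
  have := continuous_character (d := d)
  fun_prop

theorem Continuous.integrable_torus {d : ℕ} {f : Torus d → ℂ} (hf : Continuous f) :
    Integrable f := hf.integrable_of_hasCompactSupport (HasCompactSupport.of_compactSpace f)

theorem spaceCoeff_trigPoly {d : ℕ} (A : Finset (Fin d → ℤ)) (c : (Fin d → ℤ) → ℂ)
    (l : Fin d → ℤ) : spaceCoeff (trigPoly A c) l = if l ∈ A then c l else 0 := by
  have hpi : ((2 * Real.pi) ^ d : ℂ) ≠ 0 :=
    pow_ne_zero _ (mul_ne_zero two_ne_zero (Complex.ofReal_ne_zero.2 Real.pi_ne_zero))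
  have h1 : ∀ x, trigPoly A c x * character (-l) x = ∑ k ∈ A, c k * character (k + -l) x := by
    intro x
    rw [trigPoly, Finset.sum_mul]
    exact Finset.sum_congr rfl fun k _ => by rw [character_add]; ring
  rw [spaceCoeff]
  simp only [h1]
  rw [integral_finsetSum _ fun k _ => ((continuous_character _).integrable_torus).const_mul _]
  simp only [integral_const_mul, integral_character, add_neg_eq_zero, mul_ite, mul_zero]
  rw [Finset.sum_ite_eq']
  split_ifs
  · field_simp
  · simp

theorem integral_norm_sq_trigPoly {d : ℕ} (A : Finset (Fin d → ℤ)) (c : (Fin d → ℤ) → ℂ) :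
    ∫ x, ‖trigPoly A c x‖ ^ 2 = (2 * Real.pi) ^ d * ∑ k ∈ A, ‖c k‖ ^ 2 := by
  have hintb : ∀ l, ∫ x, trigPoly A c x * character (-l) x =
      (2 * Real.pi) ^ d * if l ∈ A then c l else 0 := by
    intro l
    have hpi : ((2 * Real.pi) ^ d : ℂ) ≠ 0 :=
      pow_ne_zero _ (mul_ne_zero two_ne_zero (Complex.ofReal_ne_zero.2 Real.pi_ne_zero))
    rw [← spaceCoeff_trigPoly, spaceCoeff]
    field_simp
  have h1 : ∀ x, ((‖trigPoly A c x‖ ^ 2 : ℝ) : ℂ) =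
      ∑ k ∈ A, starRingEnd ℂ (c k) * (trigPoly A c x * character (-k) x) := by
    intro x
    push_cast
    rw [← Complex.mul_conj']
    nth_rewrite 2 [trigPoly]
    rw [map_sum, Finset.mul_sum]
    refine Finset.sum_congr rfl fun k _ => ?_
    rw [map_mul, character_neg]
    ring
  have h2 : ((∫ x, ‖trigPoly A c x‖ ^ 2 : ℝ) : ℂ) =
      (((2 * Real.pi) ^ d * ∑ k ∈ A, ‖c k‖ ^ 2 : ℝ) : ℂ) := by
    rw [← integral_complex_ofReal]
    simp only [h1]
    have hi : ∀ k, Integrable fun x => trigPoly A c x * character (-k) x := fun k =>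
      ((continuous_trigPoly A c).mul (continuous_character _)).integrable_torus
    rw [integral_finsetSum _ fun k _ => (hi k).const_mul _]
    simp only [integral_const_mul, hintb]
    push_cast
    rw [Finset.mul_sum]
    refine Finset.sum_congr rfl fun k hk => ?_
    rw [if_pos hk, ← Complex.conj_mul']
    ring
  exact_mod_cast h2

theorem spaceCoeff_conj {d : ℕ} (f : Torus d → ℂ) (k : Fin d → ℤ) :
    spaceCoeff (fun y => starRingEnd ℂ (f y)) k = starRingEnd ℂ (spaceCoeff f (-k)) := by
  rw [spaceCoeff, spaceCoeff, map_mul, ← integral_conj]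
  congr 1
  · rw [show ((1 / (2 * Real.pi) ^ d : ℂ)) = ((1 / (2 * Real.pi) ^ d : ℝ) : ℂ) by push_cast; rfl,
      Complex.conj_ofReal]
  · refine integral_congr_ae (Filter.Eventually.of_forall fun x => ?_)
    simp only [map_mul, neg_neg, character_neg]

theorem neg_mem_filterSet {d : ℕ} {τ : ℝ} {k : Fin d → ℤ} :
    -k ∈ filterSet d τ ↔ k ∈ filterSet d τ := by
  simp [mem_filterSet]

theorem filterOp_conj {d : ℕ} (τ : ℝ) (f : Torus d → ℂ) (x : Torus d) :
    filterOp τ (fun y => starRingEnd ℂ (f y)) x = starRingEnd ℂ (filterOp τ f x) := by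
  rw [filterOp, filterOp, map_sum]
  refine Finset.sum_nbij' (fun k => -k) (fun k => -k) (fun k hk => neg_mem_filterSet.2 hk)
    (fun k hk => neg_mem_filterSet.2 hk) (fun k _ => neg_neg k) (fun k _ => neg_neg k)
    fun k _ => ?_
  rw [spaceCoeff_conj, map_mul, ← character_neg, neg_neg]

/-! ### The time transform on the circle -/

section Time

theorem timeFreqMeasure_eq (τ : ℝ) :
    timeFreqMeasure τ = volume.restrict
      (Set.Ioc (-(Real.pi / τ)) (-(Real.pi / τ) + 2 * Real.pi / τ)) := by
  rw [timeFreqMeasure]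
  congr 2
  ring

variable {τ : ℝ} [hτ : Fact (0 < τ)]

/-- The integral of `A` against `e^{-inτσ}` over the circle of time frequencies. -/
def timeCoeff (A : TimeCircle τ → ℂ) (n : ℤ) : ℂ := ∫ x, fourier (-n) x * A x

theorem fourierCoeff_eq_timeCoeff (A : TimeCircle τ → ℂ) (n : ℤ) :
    fourierCoeff A n = (τ / (2 * Real.pi) : ℂ) * timeCoeff A n := by
  rw [fourierCoeff, AddCircle.integral_haarAddCircle, timeCoeff, Complex.real_smul, inv_div]
  push_cast
  rfl

theorem integral_timeFreqMeasure (f : TimeCircle τ → ℂ) :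
    ∫ σ, f (σ : TimeCircle τ) ∂(timeFreqMeasure τ) = ∫ x, f x := by
  rw [timeFreqMeasure_eq, AddCircle.integral_preimage]

theorem lintegral_timeFreqMeasure (f : TimeCircle τ → ℝ≥0∞) :
    ∫⁻ σ, f (σ : TimeCircle τ) ∂(timeFreqMeasure τ) = ∫⁻ x, f x := by
  rw [timeFreqMeasure_eq, AddCircle.lintegral_preimage]

/-- The element `e^{imτσ}` of `L²(dσ)`. -/
def modeLp (τ : ℝ) (m : ℤ) : Lp ℂ 2 (timeFreqMeasure τ) := (memLp_timeMode τ m).toLp (timeMode τ m)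

theorem inner_modeLp (m : ℤ) (g : Lp ℂ 2 (timeFreqMeasure τ)) :
    inner ℂ (modeLp τ m) g = ∫ σ, fourier (-m) (σ : TimeCircle τ) * g σ ∂(timeFreqMeasure τ) := by
  rw [L2.inner_def]
  refine integral_congr_ae ?_
  filter_upwards [(memLp_timeMode τ m).coeFn_toLp] with σ hσ
  rw [RCLike.inner_apply', modeLp, hσ, ← fourier_timeCircle_coe hτ.out, fourier_neg]

theorem inner_modeLp_modeLp (m n : ℤ) :
    inner ℂ (modeLp τ m) (modeLp τ n) = if m = n then (2 * Real.pi / τ : ℂ) else 0 := by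
  rw [inner_modeLp]
  have h : ∫ σ, fourier (-m) (σ : TimeCircle τ) * modeLp τ n σ ∂(timeFreqMeasure τ) =
      ∫ σ, fourier (-m + n) (σ : TimeCircle τ) ∂(timeFreqMeasure τ) := by
    refine integral_congr_ae ?_
    filter_upwards [(memLp_timeMode τ n).coeFn_toLp] with σ hσ
    rw [modeLp, hσ, ← fourier_timeCircle_coe hτ.out, fourier_add]
  rw [h, integral_timeFreqMeasure (fun x => fourier (-m + n) x), integral_fourier]
  simp only [neg_add_eq_zero]
  push_cast
  rfl

/-- The lift to the circle of a function over one period. -/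
def circleLift (g : ℝ → ℂ) : TimeCircle τ → ℂ :=
  AddCircle.liftIoc (2 * Real.pi / τ) (-(Real.pi / τ)) g

theorem circleLift_coe (g : ℝ → ℂ) :
    ∀ᵐ σ : ℝ ∂(timeFreqMeasure τ), circleLift g (σ : TimeCircle τ) = g σ := by
  rw [timeFreqMeasure_eq]
  filter_upwards [ae_restrict_mem measurableSet_Ioc] with σ hσ
  exact AddCircle.liftIoc_coe_apply hσ

theorem measurable_circleLift {g : ℝ → ℂ} (hg : Measurable g) :
    Measurable (circleLift g : TimeCircle τ → ℂ) := by
  refine (hg.comp measurable_subtype_coe).comp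
    (AddCircle.measurableEquivIoc (2 * Real.pi / τ) (-(Real.pi / τ))).measurable

theorem memLp_circleLift {g : ℝ → ℂ} (hg : MemLp g 2 (timeFreqMeasure τ)) :
    MemLp (circleLift g : TimeCircle τ → ℂ) 2 := by
  rw [timeFreqMeasure_eq] at hg
  exact hg.memLp_liftIoc

theorem timeCoeff_circleLift (g : ℝ → ℂ) (n : ℤ) :
    timeCoeff (circleLift g : TimeCircle τ → ℂ) n =
      ∫ σ, fourier (-n) (σ : TimeCircle τ) * g σ ∂(timeFreqMeasure τ) := by
  rw [timeCoeff, ← integral_timeFreqMeasure]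
  refine integral_congr_ae ?_
  filter_upwards [circleLift_coe g] with σ hσ
  rw [hσ]

/-- The inner product with a mode is continuous on `L²`, so it acts termwise on the series. The
factor is `τ · (2π/τ)`. -/
theorem timeCoeff_circleLift_transform {d : ℕ} {u : ℤ → Torus d → ℂ} {k : Fin d → ℤ}
    (h : Summable (transformTerm τ u k)) (n : ℤ) :
    timeCoeff (circleLift (transform τ u k) : TimeCircle τ → ℂ) n =
      2 * Real.pi * spaceCoeff (u n) k := by
  rw [timeCoeff_circleLift, ← inner_modeLp]
  have h1 := h.hasSum.mapL (innerSL ℂ (modeLp τ n))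
  have h2 : ∀ m, innerSL ℂ (modeLp τ n) (transformTerm τ u k m) =
      if m = n then (2 * Real.pi * spaceCoeff (u n) k : ℂ) else 0 := by
    intro m
    have hτ0 : (τ : ℂ) ≠ 0 := by exact_mod_cast hτ.out.ne'
    rw [innerSL_apply_apply, transformTerm, inner_smul_right]
    change _ * inner ℂ (modeLp τ n) (modeLp τ m) = _
    rw [inner_modeLp_modeLp]
    by_cases hm : m = n
    · subst hm; simp only [if_true]; field_simp
    · rw [if_neg (Ne.symm hm), if_neg hm, mul_zero]
  simp only [h2] at h1
  exact h1.unique (hasSum_ite_eq n _)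

theorem memLp_haar_iff_lintegral {A : TimeCircle τ → ℂ} (hA : Measurable A)
    (h : ∫⁻ x, ‖A x‖ₑ ^ 2 ≠ ∞) : MemLp A 2 := by
  refine ⟨hA.aestronglyMeasurable, ?_⟩
  rw [eLpNorm_lt_top_iff_lintegral_rpow_enorm_lt_top (by norm_num) (by norm_num)]
  simpa using lt_top_iff_ne_top.2 h

theorem tsum_enorm_timeCoeff_sq {A : TimeCircle τ → ℂ} (hA : MemLp A 2) :
    Summable (fun n => ‖timeCoeff A n‖ ^ 2) ∧
    ∑' n, ‖timeCoeff A n‖ₑ ^ 2 = ENNReal.ofReal (2 * Real.pi / τ) * ∫⁻ x, ‖A x‖ₑ ^ 2 := by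
  have hτ0 : (0 : ℝ) < τ := hτ.out
  have hA' : MemLp A 2 AddCircle.haarAddCircle := memLp_haarAddCircle_iff.2 hA
  have hs := hasSum_sq_fourierCoeff (hA'.toLp A)
  have hc : ∀ n, fourierCoeff (hA'.toLp A) n = (τ / (2 * Real.pi) : ℂ) * timeCoeff A n := fun n => by
    rw [fourierCoeff_congr_ae hA'.coeFn_toLp, fourierCoeff_eq_timeCoeff]
  have hI : ∫ x, ‖hA'.toLp A x‖ ^ 2 ∂AddCircle.haarAddCircle =
      (2 * Real.pi / τ)⁻¹ * ∫ x, ‖A x‖ ^ 2 := by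
    rw [← smul_eq_mul (2 * Real.pi / τ)⁻¹, ← AddCircle.integral_haarAddCircle]
    refine integral_congr_ae ?_
    filter_upwards [hA'.coeFn_toLp] with x hx
    rw [hx]
  simp only [hc, hI, norm_mul, mul_pow] at hs
  have hn : ‖(τ / (2 * Real.pi) : ℂ)‖ = (2 * Real.pi / τ)⁻¹ := by
    rw [inv_div, norm_div, norm_mul, Complex.norm_of_nonneg hτ0.le,
      Complex.norm_of_nonneg Real.pi_pos.le]
    simp
  rw [hn] at hs
  have hT : 0 < 2 * Real.pi / τ := div_pos Real.two_pi_pos hτ0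
  have hs2 : HasSum (fun n => ‖timeCoeff A n‖ ^ 2) ((2 * Real.pi / τ) * ∫ x, ‖A x‖ ^ 2) := by
    have := hs.mul_left ((2 * Real.pi / τ) ^ 2)
    have h1 : ∀ T I : ℝ, T ≠ 0 → I = T ^ 2 * (T⁻¹ ^ 2 * I) := fun T I hT => by field_simp
    have h2 : ∀ T I : ℝ, T ≠ 0 → T * I = T ^ 2 * (T⁻¹ * I) := fun T I hT => by field_simp
    rw [← h2 _ _ hT.ne'] at this
    have e : (fun n => ‖timeCoeff A n‖ ^ 2) = fun n => (2 * Real.pi / τ) ^ 2 *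
        ((2 * Real.pi / τ)⁻¹ ^ 2 * ‖timeCoeff A n‖ ^ 2) := funext fun n => h1 _ _ hT.ne'
    rw [e]
    exact this
  refine ⟨hs2.summable, ?_⟩
  have e1 : ∀ n, ‖timeCoeff A n‖ₑ ^ 2 = ENNReal.ofReal (‖timeCoeff A n‖ ^ 2) := fun n => by
    rw [ENNReal.ofReal_pow (norm_nonneg _), ofReal_norm]
  have e2 : ∀ x, ‖A x‖ₑ ^ 2 = ENNReal.ofReal (‖A x‖ ^ 2) := fun n => by
    rw [ENNReal.ofReal_pow (norm_nonneg _), ofReal_norm]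
  simp only [e1, e2]
  rw [← ENNReal.ofReal_tsum_of_nonneg (fun n => by positivity) hs2.summable, hs2.tsum_eq,
    ENNReal.ofReal_mul hT.le, ofReal_integral_eq_lintegral_ofReal]
  · exact hA.integrable_norm_pow (by norm_num)
  · exact Filter.Eventually.of_forall fun x => by positivity

theorem ae_eq_of_timeCoeff_eq {A B : TimeCircle τ → ℂ} (hA : MemLp A 2) (hB : MemLp B 2)
    (h : ∀ n, timeCoeff A n = timeCoeff B n) : A =ᵐ[volume] B := by
  have hA' : MemLp A 2 AddCircle.haarAddCircle := memLp_haarAddCircle_iff.2 hA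
  have hB' : MemLp B 2 AddCircle.haarAddCircle := memLp_haarAddCircle_iff.2 hB
  have he : hA'.toLp A = hB'.toLp B := by
    apply fourierBasis.repr.injective
    ext n
    rw [fourierBasis_repr, fourierBasis_repr, fourierCoeff_congr_ae hA'.coeFn_toLp,
      fourierCoeff_congr_ae hB'.coeFn_toLp, fourierCoeff_eq_timeCoeff, fourierCoeff_eq_timeCoeff, h]
  have h2 := (MemLp.toLp_eq_toLp_iff hA' hB').1 he
  rw [AddCircle.volume_eq_smul_haarAddCircle]
  exact Measure.smul_absolutelyContinuous.ae_eq h2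

/-- The modes are orthogonal, of norm `√(2π/τ)`. Convergence has to be proved for the cubic term,
whose `bourgainNorm` would otherwise be `∞` by definition. -/
theorem summable_transformTerm {d : ℕ} {u : ℤ → Torus d → ℂ} {k : Fin d → ℤ}
    (h : Summable fun n => ‖spaceCoeff (u n) k‖ ^ 2) : Summable (transformTerm τ u k) := by
  have hτ0 : (0 : ℝ) < τ := hτ.out
  have hT : 0 < 2 * Real.pi / τ := div_pos Real.two_pi_pos hτ0
  obtain ⟨r, hr⟩ : ∃ r, r = √(2 * Real.pi / τ) := ⟨_, rfl⟩
  have hr0 : 0 < r := by rw [hr]; exact Real.sqrt_pos.2 hT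
  have hr2 : (r : ℂ) * r = 2 * Real.pi / τ := by
    rw [hr]; exact_mod_cast Real.mul_self_sqrt hT.le
  have hrc : (r : ℂ) ≠ 0 := by exact_mod_cast hr0.ne'
  have horth : Orthonormal ℂ fun m => (r⁻¹ : ℂ) • modeLp τ m := by
    rw [orthonormal_iff_ite]
    intro m n
    rw [inner_smul_left, inner_smul_right, inner_modeLp_modeLp]
    split_ifs
    · rw [← hr2]
      simp
      field_simp
    · simp
  have := (horth.orthogonalFamily.summable_iff_norm_sq_summable
    fun m => (τ * spaceCoeff (u m) k * r : ℂ)).2 (by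
      have := h.mul_left (‖(τ : ℂ)‖ ^ 2 * ‖(r : ℂ)‖ ^ 2)
      refine this.congr fun m => ?_
      rw [norm_mul, norm_mul]
      ring)
  refine this.congr fun m => ?_
  rw [LinearIsometry.toSpanSingleton_apply, smul_smul, mul_assoc, mul_inv_cancel₀ hrc, mul_one]
  rfl

end Time

/-! ### The Fourier transform on the group of frequencies -/

section Hat

variable {τ : ℝ} {d : ℕ}

/-- The character `(σ, k) ↦ e^{-inτσ} e^{i⟨k,x⟩}`. -/
def freqChar (n : ℤ) (x : Torus d) (z : FreqGroup τ d) : ℂ := fourier (-n) z.1 * character z.2 x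

theorem freqChar_add (n : ℤ) (x : Torus d) (z w : FreqGroup τ d) :
    freqChar n x (z + w) = freqChar n x z * freqChar n x w := by
  have h : fourier (-n) (z.1 + w.1) = fourier (-n) z.1 * fourier (-n) w.1 := by
    simp only [fourier_apply, smul_add, AddCircle.toCircle_add, Circle.coe_mul]
  simp only [freqChar, Prod.fst_add, Prod.snd_add, character_add, h]
  ring

theorem freqChar_neg (n : ℤ) (x : Torus d) (z : FreqGroup τ d) :
    freqChar n x (-z) = starRingEnd ℂ (freqChar n x z) := by
  have h : fourier (-n) (-z.1) = starRingEnd ℂ (fourier (-n) z.1) := by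
    rw [← fourier_neg]
    simp only [fourier_apply, neg_neg, smul_neg, neg_smul]
  simp only [freqChar, Prod.fst_neg, Prod.snd_neg, character_neg, map_mul, h]

theorem norm_freqChar (n : ℤ) (x : Torus d) (z : FreqGroup τ d) : ‖freqChar n x z‖ = 1 := by
  rw [freqChar, norm_mul, norm_character, mul_one, fourier_apply]
  exact Circle.norm_coe _

theorem measurable_freqChar (n : ℤ) (x : Torus d) :
    Measurable (freqChar n x : FreqGroup τ d → ℂ) := by
  refine measurable_from_prod_countable_left fun k => ?_
  simp only [freqChar]
  exact ((fourier (-n)).continuous.measurable).mul_const _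

/-- The function `A` vanishes unless the space frequency lies in `F`. -/
def SuppIn (F : Finset (Fin d → ℤ)) (A : FreqGroup τ d → ℂ) : Prop := ∀ z, z.2 ∉ F → A z = 0

/-- The function `z ↦ conj (A (-z))`. -/
def reflect (A : FreqGroup τ d → ℂ) (z : FreqGroup τ d) : ℂ := starRingEnd ℂ (A (-z))

theorem measurable_reflect {A : FreqGroup τ d → ℂ} (hA : Measurable A) : Measurable (reflect A) :=
  Complex.continuous_conj.measurable.comp (hA.comp measurable_neg)

theorem SuppIn.reflect {F : Finset (Fin d → ℤ)} {A : FreqGroup τ d → ℂ} (hA : SuppIn F A) :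
    SuppIn (F.image fun k => -k) (reflect A) := by
  intro z hz
  rw [DiscBourgain.reflect, hA (-z), map_zero]
  intro h
  exact hz (Finset.mem_image.2 ⟨-z.2, h, neg_neg _⟩)

variable [Fact (0 < τ)]

/-- The inverse transform of a function of the frequencies. -/
def hat (A : FreqGroup τ d → ℂ) (n : ℤ) (x : Torus d) : ℂ :=
  ∫ z, freqChar n x z * A z ∂(freqMeasure τ d)

/-- Convolution on the group of frequencies. -/
def conv (A B : FreqGroup τ d → ℂ) (z : FreqGroup τ d) : ℂ :=
  ∫ y, A y * B (z - y) ∂(freqMeasure τ d)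

theorem conv_eq (A B : FreqGroup τ d → ℂ) :
    conv A B = convolution A B (ContinuousLinearMap.mul ℂ ℂ) (freqMeasure τ d) := rfl

theorem integrable_freqChar_mul {A : FreqGroup τ d → ℂ} (hA : Integrable A (freqMeasure τ d))
    (n : ℤ) (x : Torus d) : Integrable (fun z => freqChar n x z * A z) (freqMeasure τ d) :=
  hA.bdd_mul (c := 1) (measurable_freqChar n x).aestronglyMeasurable
    (Filter.Eventually.of_forall fun z => (norm_freqChar n x z).le)

theorem integrable_conv {A B : FreqGroup τ d → ℂ} (hA : Integrable A (freqMeasure τ d))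
    (hB : Integrable B (freqMeasure τ d)) : Integrable (conv A B) (freqMeasure τ d) := by
  rw [conv_eq]
  exact hA.integrable_convolution _ hB

theorem hat_conv {A B : FreqGroup τ d → ℂ} (hA : Integrable A (freqMeasure τ d))
    (hB : Integrable B (freqMeasure τ d)) (n : ℤ) (x : Torus d) :
    hat (conv A B) n x = hat A n x * hat B n x := by
  have h := integral_convolution (ContinuousLinearMap.mul ℂ ℂ) (integrable_freqChar_mul hA n x)
    (integrable_freqChar_mul hB n x)
  rw [ContinuousLinearMap.mul_apply'] at h
  rw [hat, hat, hat, ← h]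
  refine integral_congr_ae (Filter.Eventually.of_forall fun z => ?_)
  simp only [conv, convolution, ContinuousLinearMap.mul_apply']
  rw [← integral_const_mul]
  refine integral_congr_ae (Filter.Eventually.of_forall fun y => ?_)
  have hz : freqChar n x z = freqChar n x y * freqChar n x (z - y) := by
    rw [← freqChar_add, add_sub_cancel]
  simp only [hz]
  ring

theorem measurable_conv {A B : FreqGroup τ d → ℂ} (hA : Measurable A) (hB : Measurable B) :
    Measurable (conv A B) := by
  have h : Measurable fun p : FreqGroup τ d × FreqGroup τ d => A p.2 * B (p.1 - p.2) := by
    fun_prop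
  exact (h.stronglyMeasurable.integral_prod_right' (ν := freqMeasure τ d)).measurable

theorem enorm_conv_le (A B : FreqGroup τ d → ℂ) (z : FreqGroup τ d) :
    ‖conv A B z‖ₑ ≤ ((fun z => ‖A z‖ₑ) ⋆ₗ[freqMeasure τ d] fun z => ‖B z‖ₑ) z := by
  refine (enorm_integral_le_lintegral_enorm _).trans (le_of_eq ?_)
  rw [lconvolution_def]
  refine lintegral_congr fun y => ?_
  rw [enorm_mul, neg_add_eq_sub]

theorem SuppIn.conv {F F' : Finset (Fin d → ℤ)} {A B : FreqGroup τ d → ℂ} (hA : SuppIn F A)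
    (hB : SuppIn F' B) : SuppIn (Finset.image₂ (· + ·) F F') (conv A B) := by
  intro z hz
  have h : ∀ y, A y * B (z - y) = 0 := by
    intro y
    by_cases hy : y.2 ∈ F
    · by_cases hy' : (z - y).2 ∈ F'
      · refine absurd (Finset.mem_image₂.2 ⟨y.2, hy, (z - y).2, hy', ?_⟩) hz
        simp
      · rw [hB _ hy', mul_zero]
    · rw [hA _ hy, zero_mul]
  simp only [DiscBourgain.conv, h, integral_zero]

theorem hat_reflect (A : FreqGroup τ d → ℂ) (n : ℤ) (x : Torus d) :
    hat (reflect A) n x = starRingEnd ℂ (hat A n x) := by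
  rw [hat, hat, ← integral_conj, ← integral_neg_eq_self]
  refine integral_congr_ae (Filter.Eventually.of_forall fun z => ?_)
  simp only [reflect, neg_neg, freqChar_neg, map_mul]

theorem integrable_reflect {A : FreqGroup τ d → ℂ} (hA : Integrable A (freqMeasure τ d)) :
    Integrable (reflect A) (freqMeasure τ d) := by
  have h : Integrable (fun z => A (-z)) (freqMeasure τ d) := hA.comp_neg
  exact (LinearIsometryEquiv.integrable_comp_iff Complex.conjLIE).2 h

theorem lintegral_freqMeasure_of_suppIn {F : Finset (Fin d → ℤ)} {f : FreqGroup τ d → ℝ≥0∞}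
    (hf : Measurable f) (hF : ∀ z, z.2 ∉ F → f z = 0) :
    ∫⁻ z, f z ∂(freqMeasure τ d) = ∑ k ∈ F, ∫⁻ x, f (x, k) := by
  rw [lintegral_freqMeasure hf, tsum_eq_sum]
  intro k hk
  have : ∀ x, f (x, k) = 0 := fun x => hF _ hk
  simp only [this, lintegral_zero]

theorem integrable_of_suppIn {F : Finset (Fin d → ℤ)} {A : FreqGroup τ d → ℂ} (hA : Measurable A)
    (hF : SuppIn F A) (h : ∀ k ∈ F, Integrable fun x => A (x, k)) :
    Integrable A (freqMeasure τ d) := by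
  refine ⟨hA.aestronglyMeasurable, ?_⟩
  rw [HasFiniteIntegral, lintegral_freqMeasure_of_suppIn (F := F) hA.enorm
    (fun z hz => by rw [hF z hz, enorm_zero])]
  exact ENNReal.sum_lt_top.2 fun k hk => (h k hk).2

theorem hat_of_suppIn {F : Finset (Fin d → ℤ)} {A : FreqGroup τ d → ℂ}
    (hA : Integrable A (freqMeasure τ d)) (hF : SuppIn F A) (n : ℤ) (x : Torus d) :
    hat A n x = trigPoly F (fun k => timeCoeff (fun σ => A (σ, k)) n) x := by
  have hi := integrable_freqChar_mul hA n x
  rw [hat]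
  rw [freqMeasure] at hi ⊢
  rw [integral_prod_symm _ hi]
  have hz : ∀ k ∉ (F : Set (Fin d → ℤ)),
      ∫ σ : TimeCircle τ, freqChar n x (σ, k) * A (σ, k) = 0 := by
    intro k hk
    have : ∀ σ : TimeCircle τ, A (σ, k) = 0 := fun σ => hF _ hk
    simp only [this, mul_zero, integral_zero]
  rw [← setIntegral_eq_integral_of_forall_compl_eq_zero hz, setIntegral_finset _ (hi.integral_prod_right).integrableOn,
    trigPoly]
  refine Finset.sum_congr rfl fun k _ => ?_
  rw [Measure.real, Measure.count_singleton, ENNReal.toReal_one, one_smul, timeCoeff,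
    mul_comm _ (character k x), ← integral_const_mul]
  refine integral_congr_ae (Filter.Eventually.of_forall fun σ => ?_)
  simp only [freqChar]
  ring

end Hat

/-! ### The transform of a sequence as a function of the frequencies -/

section Lift

variable {τ : ℝ} {d : ℕ}

theorem MemBourgain.summable {s b : ℝ} {u : ℤ → Torus d → ℂ} (hu : MemBourgain τ s b u) :
    ∀ k, Summable (transformTerm τ u k) := by
  by_contra h
  have := hu.2
  rw [bourgainNorm, if_neg h] at this
  exact lt_irrefl _ this

variable [hτ : Fact (0 < τ)]

/-- The filtered transform `1_{k ∈ filterSet} ũ(σ, k)` on the group of frequencies. -/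
def freqLift (u : ℤ → Torus d → ℂ) (z : FreqGroup τ d) : ℂ :=
  if z.2 ∈ filterSet d τ then circleLift (transform τ u z.2) z.1 else 0

theorem measurable_freqLift (u : ℤ → Torus d → ℂ) :
    Measurable (freqLift u : FreqGroup τ d → ℂ) := by
  refine measurable_from_prod_countable_left fun k => ?_
  simp only [freqLift]
  split_ifs
  · exact measurable_circleLift (Lp.stronglyMeasurable _).measurable
  · exact measurable_const

theorem suppIn_freqLift (u : ℤ → Torus d → ℂ) :
    SuppIn (filterSet d τ) (freqLift u : FreqGroup τ d → ℂ) := fun _ hz => if_neg hz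

/-- The filter keeps finitely many `k`, and `L² ⊂ L¹` on the circle. The convolution theorem
therefore applies without any approximation. -/
theorem integrable_freqLift (u : ℤ → Torus d → ℂ) :
    Integrable (freqLift u : FreqGroup τ d → ℂ) (freqMeasure τ d) := by
  refine integrable_of_suppIn (measurable_freqLift u) (suppIn_freqLift u) fun k hk => ?_
  simp only [freqLift, hk, if_true]
  exact (memLp_circleLift (Lp.memLp _)).integrable (by norm_num)

theorem hat_freqLift {u : ℤ → Torus d → ℂ} (hu : ∀ k, Summable (transformTerm τ u k)) (n : ℤ)
    (x : Torus d) :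
    hat (freqLift u : FreqGroup τ d → ℂ) n x = 2 * Real.pi * filterOp τ (u n) x := by
  rw [hat_of_suppIn (integrable_freqLift u) (suppIn_freqLift u), trigPoly, filterOp,
    Finset.mul_sum]
  refine Finset.sum_congr rfl fun k hk => ?_
  simp only [freqLift, hk, if_true]
  have := timeCoeff_circleLift_transform (hu k) n
  rw [this]
  ring

theorem lintegral_transform_eq (s b : ℝ) (u : ℤ → Torus d → ℂ) (k : Fin d → ℤ) :
    ∫⁻ σ, ENNReal.ofReal (bracket (freqVec k) ^ s *
      bracket (dTau τ (σ - ‖freqVec k‖ ^ 2)) ^ b * ‖transform τ u k σ‖) ^ 2 ∂(timeFreqMeasure τ) =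
    ∫⁻ x : TimeCircle τ, (weight s b (x, k) * ‖circleLift (transform τ u k) x‖ₑ) ^ 2 := by
  rw [← lintegral_timeFreqMeasure]
  refine lintegral_congr_ae ?_
  filter_upwards [circleLift_coe (τ := τ) (transform τ u k)] with σ hσ
  have h1 := bracket_pos (freqVec k)
  have h2 := bracket_pos (dTau τ (σ - ‖freqVec k‖ ^ 2))
  rw [hσ, weight, modWeight, ← AddCircle.coe_sub, dCircle_coe hτ.out,
    ENNReal.ofReal_mul (by positivity), ofReal_norm]

theorem bourgainNorm_eq {s b : ℝ} {u : ℤ → Torus d → ℂ}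
    (hu : ∀ k, Summable (transformTerm τ u k)) :
    bourgainNorm τ s b u = (∑' k, ∫⁻ x : TimeCircle τ,
      (weight s b (x, k) * ‖circleLift (transform τ u k) x‖ₑ) ^ 2) ^ (1 / 2 : ℝ) := by
  rw [bourgainNorm, if_pos hu]
  simp only [lintegral_transform_eq]

/-- The lift drops the frequencies outside the filter, hence an inequality only. -/
theorem weightedSq_freqLift_le {s b : ℝ} {u : ℤ → Torus d → ℂ}
    (hu : ∀ k, Summable (transformTerm τ u k)) :
    weightedSq s b (fun z : FreqGroup τ d => ‖freqLift u z‖ₑ) ≤ bourgainNorm τ s b u ^ 2 := by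
  rw [bourgainNorm_eq hu, ← ENNReal.rpow_natCast, ← ENNReal.rpow_mul]
  norm_num
  have h := lintegral_freqMeasure
    (((measurable_weight (τ := τ) s b).mul (measurable_freqLift u).enorm).pow_const 2)
  refine h.trans_le (ENNReal.tsum_le_tsum fun k => lintegral_mono fun x => ?_)
  by_cases hk : k ∈ filterSet d τ
  · simp only [Pi.mul_apply, freqLift, hk, if_true]; exact le_rfl
  · simp [freqLift, hk]

theorem norm_dCircle_le (x : TimeCircle τ) : ‖dCircle τ x‖ ≤ 2 / τ := by
  have h1 : ‖(fourier 1 x : ℂ)‖ = 1 := by rw [fourier_apply]; exact Circle.norm_coe _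
  rw [dCircle, norm_div, Complex.norm_of_nonneg hτ.out.le]
  refine div_le_div_of_nonneg_right ?_ hτ.out.le
  refine (norm_sub_le _ _).trans (le_of_eq ?_)
  rw [h1, norm_one]
  norm_num

/-- `|d_τ| ≤ 2/τ`. The constant depends on `τ`, but it only serves to deduce membership in `L²`, not
to bound norms. -/
theorem exists_le_weight {s b : ℝ} (hs : 0 ≤ s) (hb : 0 ≤ b) :
    ∃ c : ℝ≥0∞, c ≠ 0 ∧ c ≠ ∞ ∧ ∀ z : FreqGroup τ d, c ≤ weight s (-b) z := by
  have hM : 0 < (1 + (2 / τ) ^ 2) ^ (1 / 2 : ℝ) := by positivity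
  refine ⟨ENNReal.ofReal (((1 + (2 / τ) ^ 2) ^ (1 / 2 : ℝ)) ^ (-b)), ?_, ENNReal.ofReal_ne_top,
    fun z => ENNReal.ofReal_le_ofReal ?_⟩
  · rw [ne_eq, ENNReal.ofReal_eq_zero, not_le]
    positivity
  · have h1 : modWeight z ≤ (1 + (2 / τ) ^ 2) ^ (1 / 2 : ℝ) := by
      rw [modWeight, bracket]
      have := norm_dCircle_le (z.1 - ((‖freqVec z.2‖ ^ 2 : ℝ) : TimeCircle τ))
      gcongr
    have h2 : 1 ≤ bracket (freqVec z.2) ^ s := Real.one_le_rpow (one_le_bracket _) hs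
    have h3 := Real.rpow_le_rpow_of_nonpos (modWeight_pos z) h1 (by linarith : -b ≤ 0)
    have h4 : 0 ≤ modWeight z ^ (-b) := Real.rpow_nonneg (modWeight_pos z).le _
    nlinarith

/-- A finite weighted norm puts each `D(·, k)` in `L²`, so its Fourier coefficients are square
summable and the series defining the transform of `v` converges. Uniqueness of Fourier coefficients
then identifies this transform with `D` on the filter. -/
theorem bourgainNorm_le_of_timeCoeff {s b : ℝ} (hs : 0 ≤ s) (hb : 0 ≤ b) {v : ℤ → Torus d → ℂ}
    {D : FreqGroup τ d → ℂ} (hD : Measurable D)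
    (hcoeff : ∀ k ∈ filterSet d τ, ∀ n,
      timeCoeff (fun σ => D (σ, k)) n = 2 * Real.pi * spaceCoeff (v n) k)
    (hzero : ∀ k ∉ filterSet d τ, ∀ n, spaceCoeff (v n) k = 0)
    (hfin : weightedSq s (-b) ({z : FreqGroup τ d | z.2 ∈ filterSet d τ}.indicator
      fun z => ‖D z‖ₑ) ≠ ∞) :
    bourgainNorm τ s (-b) v ^ 2 ≤ weightedSq s (-b)
      ({z : FreqGroup τ d | z.2 ∈ filterSet d τ}.indicator fun z => ‖D z‖ₑ) := by
  have hS := measurableSet_snd_mem_filterSet (τ := τ) (d := d)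
  have hW := lintegral_freqMeasure (((measurable_weight s (-b)).mul
    (hD.enorm.indicator hS)).pow_const 2)
  have hind : ∀ k ∈ filterSet d τ, ∀ x : TimeCircle τ,
      {z : FreqGroup τ d | z.2 ∈ filterSet d τ}.indicator (fun z => ‖D z‖ₑ) (x, k) = ‖D (x, k)‖ₑ :=
    fun k hk x => Set.indicator_of_mem
      (s := {z : FreqGroup τ d | z.2 ∈ filterSet d τ}) (a := (x, k)) hk _
  have hDk : ∀ k, Measurable fun σ : TimeCircle τ => D (σ, k) := fun k =>
    hD.comp measurable_prodMk_right
  have hmem : ∀ k ∈ filterSet d τ, MemLp (fun σ : TimeCircle τ => D (σ, k)) 2 := by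
    intro k hk
    refine memLp_haar_iff_lintegral (hDk k) ?_
    obtain ⟨c, hc0, hct, hc⟩ := exists_le_weight (τ := τ) (d := d) hs hb
    have h1 : c ^ 2 * ∫⁻ x : TimeCircle τ, ‖D (x, k)‖ₑ ^ 2 ≤ weightedSq s (-b)
        ({z : FreqGroup τ d | z.2 ∈ filterSet d τ}.indicator fun z => ‖D z‖ₑ) := by
      rw [← lintegral_const_mul _ ((hDk k).enorm.pow_const 2)]
      refine le_trans ?_ (le_of_le_of_eq (ENNReal.le_tsum k) hW.symm)
      refine lintegral_mono fun x => ?_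
      simp only [Pi.mul_apply]
      rw [hind k hk, ← mul_pow]
      exact pow_le_pow_left' (mul_le_mul' (hc _) le_rfl) 2
    intro htop
    rw [htop, ENNReal.mul_top (pow_ne_zero 2 hc0), top_le_iff] at h1
    exact hfin h1
  have hsum : ∀ k, Summable (transformTerm τ v k) := by
    intro k
    by_cases hk : k ∈ filterSet d τ
    · refine summable_transformTerm ?_
      have := (tsum_enorm_timeCoeff_sq (hmem k hk)).1
      simp only [hcoeff k hk, norm_mul, mul_pow] at this
      refine (summable_mul_left_iff ?_).1 this
      have : ‖(Real.pi : ℂ)‖ ≠ 0 := by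
        rw [Complex.norm_of_nonneg Real.pi_pos.le]; exact Real.pi_ne_zero
      simp [Real.pi_ne_zero]
    · have : transformTerm τ v k = 0 := by
        ext1 m
        simp [transformTerm, hzero k hk m]
      rw [this]
      exact summable_zero
  rw [bourgainNorm_eq hsum, ← ENNReal.rpow_natCast, ← ENNReal.rpow_mul]
  norm_num
  refine le_of_le_of_eq (ENNReal.tsum_le_tsum fun k => ?_) hW.symm
  by_cases hk : k ∈ filterSet d τ
  · have hae := ae_eq_of_timeCoeff_eq (memLp_circleLift (Lp.memLp (transform τ v k))) (hmem k hk)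
      fun n => by rw [timeCoeff_circleLift_transform (hsum k), hcoeff k hk]
    refine le_of_eq (lintegral_congr_ae ?_)
    filter_upwards [hae] with x hx
    simp only [Pi.mul_apply]
    rw [hx, hind k hk]
  · have h0 : transform τ v k = 0 := by
      have : transformTerm τ v k = 0 := by
        ext1 m
        simp [transformTerm, hzero k hk m]
      rw [transform, this]
      exact tsum_zero
    have hae := ae_eq_of_timeCoeff_eq (memLp_circleLift (Lp.memLp (transform τ v k)))
      (B := fun _ : TimeCircle τ => 0) MemLp.zero'
      fun n => by rw [timeCoeff_circleLift_transform (hsum k), hzero k hk]; simp [timeCoeff]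
    refine le_of_eq_of_le (lintegral_congr_ae (g := fun _ => 0) ?_) (by simp)
    filter_upwards [hae] with x hx
    rw [hx]
    simp

end Lift

/-! ### The estimates in physical variables -/

theorem lintegral_enorm_sq_trigPoly {d : ℕ} (F : Finset (Fin d → ℤ)) (c : (Fin d → ℤ) → ℂ) :
    ∫⁻ x, ‖trigPoly F c x‖ₑ ^ 2 =
      ENNReal.ofReal ((2 * Real.pi) ^ d) * ∑ k ∈ F, ‖c k‖ₑ ^ 2 := by
  have e : ∀ w : ℂ, ‖w‖ₑ ^ 2 = ENNReal.ofReal (‖w‖ ^ 2) := fun w => by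
    rw [ENNReal.ofReal_pow (norm_nonneg _), ofReal_norm]
  have hc : Continuous fun x => ‖trigPoly F c x‖ ^ 2 := (continuous_trigPoly F c).norm.pow 2
  have hi : Integrable fun x => ‖trigPoly F c x‖ ^ 2 :=
    hc.integrable_of_hasCompactSupport (HasCompactSupport.of_compactSpace _)
  simp only [e]
  rw [← ofReal_integral_eq_lintegral_ofReal hi (Filter.Eventually.of_forall fun x => by positivity),
    integral_norm_sq_trigPoly, ENNReal.ofReal_mul (by positivity),
    ENNReal.ofReal_sum_of_nonneg fun k _ => by positivity]

theorem spaceCoeff_filterOp {d : ℕ} (τ : ℝ) (f : Torus d → ℂ) (k : Fin d → ℤ) :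
    spaceCoeff (filterOp τ f) k = if k ∈ filterSet d τ then spaceCoeff f k else 0 :=
  spaceCoeff_trigPoly (filterSet d τ) (spaceCoeff f) k

theorem spaceCoeff_const_mul {d : ℕ} (c : ℂ) (f : Torus d → ℂ) (k : Fin d → ℤ) :
    spaceCoeff (fun x => c * f x) k = c * spaceCoeff f k := by
  simp only [spaceCoeff, mul_assoc, integral_const_mul]
  ring

section Estimates

variable {τ : ℝ} {d : ℕ} [hτ : Fact (0 < τ)]

theorem isFiltered_freqLift (u : ℤ → Torus d → ℂ) :
    IsFiltered fun z : FreqGroup τ d => ‖freqLift u z‖ₑ := fun z hz => by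
  simp only [suppIn_freqLift u z hz, enorm_zero]

/-- Plancherel in space for each `n`, then Parseval in time for each of the finitely many `k`. -/
theorem tsum_lintegral_enorm_hat_sq {F : Finset (Fin d → ℤ)} {C : FreqGroup τ d → ℂ}
    (hC : Measurable C) (hCi : Integrable C (freqMeasure τ d)) (hF : SuppIn F C)
    (hfin : ∫⁻ z, ‖C z‖ₑ ^ 2 ∂(freqMeasure τ d) ≠ ∞) :
    ∑' n, ∫⁻ x, ‖hat C n x‖ₑ ^ 2 = ENNReal.ofReal ((2 * Real.pi) ^ d) *
      (ENNReal.ofReal (2 * Real.pi / τ) * ∫⁻ z, ‖C z‖ₑ ^ 2 ∂(freqMeasure τ d)) := by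
  have hsplit := lintegral_freqMeasure_of_suppIn (F := F) (hC.enorm.pow_const 2)
    (fun z hz => by simp [hF z hz])
  have hmem : ∀ k ∈ F, MemLp (fun σ : TimeCircle τ => C (σ, k)) 2 := fun k hk =>
    memLp_haar_iff_lintegral (hC.comp measurable_prodMk_right)
      ((ENNReal.sum_ne_top.1 (hsplit ▸ hfin)) k hk)
  simp only [hat_of_suppIn hCi hF, lintegral_enorm_sq_trigPoly]
  rw [ENNReal.tsum_mul_left, Summable.tsum_finsetSum fun _ _ => ENNReal.summable, hsplit,
    Finset.mul_sum (s := F) (a := ENNReal.ofReal (2 * Real.pi / τ))]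
  congr 1
  exact Finset.sum_congr rfl fun k hk => (tsum_enorm_timeCoeff_sq (hmem k hk)).2

/-- The fourth power of the `L⁴` norm is the squared `L²` norm of the square, and `(Π_τ u)²` is, up
to a constant, the inverse transform of the self-convolution of the lift. -/
theorem seqLpNorm_filterOp_le {s b : ℝ} {K : ℝ≥0} (hB : BilinearBound τ d s b K)
    {u : ℤ → Torus d → ℂ} (hu : MemBourgain τ (s / 2) b u) :
    seqLpNorm 4 τ (fun n => filterOp τ (u n)) ≤
      ((((2 * Real.pi) ^ (d + 1)).toNNReal * (4 * K)) ^ (1 / 4 : ℝ) : ℝ≥0) *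
        bourgainNorm τ (s / 2) b u := by
  have hτ0 : (0 : ℝ) < τ := hτ.out
  let A : FreqGroup τ d → ℂ := freqLift u
  have hA : Measurable A := measurable_freqLift u
  have hAi : Integrable A (freqMeasure τ d) := integrable_freqLift u
  have hC2 : ∫⁻ z, ‖conv A A z‖ₑ ^ 2 ∂(freqMeasure τ d) ≤
      4 * K * bourgainNorm τ (s / 2) b u ^ 4 := by
    refine (lintegral_mono fun z => pow_le_pow_left' (enorm_conv_le A A z) 2).trans ?_
    refine (lintegral_sq_lconvolution_self_le hB hA.enorm (isFiltered_freqLift u)).trans ?_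
    have h := pow_le_pow_left' (weightedSq_freqLift_le (s := s / 2) (b := b) hu.summable) 2
    rw [← pow_mul] at h
    exact mul_le_mul' le_rfl h
  have hfin : ∫⁻ z, ‖conv A A z‖ₑ ^ 2 ∂(freqMeasure τ d) ≠ ∞ :=
    ne_top_of_le_ne_top (ENNReal.mul_ne_top (ENNReal.mul_ne_top (by norm_num) ENNReal.coe_ne_top)
      (ENNReal.pow_ne_top hu.2.ne)) hC2
  -- Each lift brings a factor `2π ≥ 1`, which is dropped.
  have hpt : ∀ n x, ‖filterOp τ (u n) x‖ₑ ^ 4 ≤ ‖hat (conv A A) n x‖ₑ ^ 2 := by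
    intro n x
    have h1 : (1 : ℝ≥0∞) ≤ ‖(2 * Real.pi : ℂ)‖ₑ := by
      rw [← ofReal_norm, ENNReal.one_le_ofReal, norm_mul, Complex.norm_of_nonneg Real.pi_pos.le]
      have := Real.pi_gt_three
      norm_num
      linarith
    rw [hat_conv hAi hAi, hat_freqLift hu.summable, ← sq, enorm_pow, ← pow_mul, enorm_mul]
    exact pow_le_pow_left' (le_mul_of_one_le_left' h1) 4
  have hsum : ∑' n, eLpNorm (filterOp τ (u n)) (4 : ℝ≥0) volume ^ ((4 : ℝ≥0) : ℝ) ≤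
      ENNReal.ofReal ((2 * Real.pi) ^ d) *
        (ENNReal.ofReal (2 * Real.pi / τ) * (4 * K * bourgainNorm τ (s / 2) b u ^ 4)) := by
    refine le_trans (ENNReal.tsum_le_tsum fun n => ?_) (le_of_eq_of_le
      (tsum_lintegral_enorm_hat_sq (measurable_conv hA hA) (integrable_conv hAi hAi)
        ((suppIn_freqLift u).conv (suppIn_freqLift u)) hfin) (by gcongr))
    rw [eLpNorm_nnreal_pow_eq_lintegral (by norm_num)]
    refine lintegral_mono fun x => le_of_eq_of_le ?_ (hpt n x)
    rw [← ENNReal.rpow_natCast]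
    norm_num
  -- The `τ` of the discrete time norm cancels the length `2π/τ` of the frequency circle, so the
  -- constant is uniform.
  have hconst : ENNReal.ofReal τ * (ENNReal.ofReal ((2 * Real.pi) ^ d) *
      ENNReal.ofReal (2 * Real.pi / τ)) = (((2 * Real.pi) ^ (d + 1)).toNNReal : ℝ≥0) := by
    rw [← ENNReal.ofReal_mul (by positivity), ← ENNReal.ofReal_mul hτ0.le]
    change _ = ENNReal.ofReal _
    congr 1
    field_simp
    ring
  rw [seqLpNorm, ENNReal.coe_rpow_of_nonneg _ (by norm_num)]
  have h4 : bourgainNorm τ (s / 2) b u = (bourgainNorm τ (s / 2) b u ^ 4) ^ (1 / 4 : ℝ) := by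
    rw [← ENNReal.rpow_natCast, ← ENNReal.rpow_mul]
    norm_num
  rw [h4, ← ENNReal.mul_rpow_of_nonneg _ _ (by norm_num)]
  have he : (1 / ((4 : ℝ≥0) : ℝ)) = 1 / 4 := by norm_num
  rw [he]
  refine ENNReal.rpow_le_rpow ((mul_le_mul' le_rfl hsum).trans (le_of_eq ?_)) (by norm_num)
  rw [ENNReal.coe_mul, ← hconst]
  push_cast
  ring

/-- The transform of the trilinear term before the outer filter, up to a factor. -/
def cubicLift (u : Fin 3 → ℤ → Torus d → ℂ) : FreqGroup τ d → ℂ :=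
  conv (conv (freqLift (u 0)) (freqLift (u 2))) (reflect (freqLift (u 1)))

theorem measurable_cubicLift (u : Fin 3 → ℤ → Torus d → ℂ) :
    Measurable (cubicLift u : FreqGroup τ d → ℂ) :=
  measurable_conv (measurable_conv (measurable_freqLift _) (measurable_freqLift _))
    (measurable_reflect (measurable_freqLift _))

theorem enorm_cubicLift_le (u : Fin 3 → ℤ → Torus d → ℂ) (z : FreqGroup τ d) :
    ‖cubicLift u z‖ₑ ≤ triConv (fun i z => ‖freqLift (u i) z‖ₑ) z := by
  refine (enorm_conv_le _ _ z).trans (lconvolution_mono (fun y => enorm_conv_le _ _ y)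
    (fun y => le_of_eq ?_) z)
  rw [reflect, RCLike.enorm_conj]

theorem spaceCoeff_hat {F : Finset (Fin d → ℤ)} {A : FreqGroup τ d → ℂ}
    (hA : Integrable A (freqMeasure τ d)) (hF : SuppIn F A) (n : ℤ) (k : Fin d → ℤ) :
    spaceCoeff (hat A n) k = timeCoeff (fun σ => A (σ, k)) n := by
  have h : hat A n = trigPoly F fun k => timeCoeff (fun σ => A (σ, k)) n :=
    funext fun x => hat_of_suppIn hA hF n x
  rw [h, spaceCoeff_trigPoly]
  split_ifs with hk
  · rfl
  · have : ∀ σ, A (σ, k) = 0 := fun σ => hF _ hk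
    simp [timeCoeff, this]

theorem timeCoeff_cubicLift {u : Fin 3 → ℤ → Torus d → ℂ}
    (hu : ∀ i k, Summable (transformTerm τ (u i) k)) {k : Fin d → ℤ} (hk : k ∈ filterSet d τ)
    (n : ℤ) :
    timeCoeff (fun σ : TimeCircle τ => cubicLift u (σ, k)) n =
      (2 * Real.pi) ^ 3 * spaceCoeff (cubic τ u n) k := by
  have hi := fun i => integrable_freqLift (τ := τ) (u i)
  have hS := fun i => suppIn_freqLift (τ := τ) (u i)
  have hhat : hat (cubicLift u : FreqGroup τ d → ℂ) n = fun x => (2 * Real.pi) ^ 3 *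
      (filterOp τ (u 0 n) x * filterOp τ (fun y => starRingEnd ℂ (u 1 n y)) x *
        filterOp τ (u 2 n) x) := by
    ext x
    rw [cubicLift, hat_conv (integrable_conv (hi 0) (hi 2)) (integrable_reflect (hi 1)),
      hat_conv (hi 0) (hi 2), hat_reflect, hat_freqLift (hu 0), hat_freqLift (hu 1),
      hat_freqLift (hu 2), filterOp_conj]
    simp only [map_mul, Complex.conj_ofReal, map_ofNat]
    ring
  have h := spaceCoeff_hat (F := _) (integrable_conv (integrable_conv (hi 0) (hi 2))
    (integrable_reflect (hi 1))) (((hS 0).conv (hS 2)).conv (hS 1).reflect) n k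
  change spaceCoeff (hat (cubicLift u) n) k = timeCoeff (fun σ => cubicLift u (σ, k)) n at h
  rw [← h, hhat, spaceCoeff_const_mul, cubic, spaceCoeff_filterOp, if_pos hk]

theorem bourgainNorm_cubic_sq_le {s b : ℝ} (hs : 0 ≤ s) (hb : 0 ≤ b)
    {u : Fin 3 → ℤ → Torus d → ℂ} (hu : ∀ i k, Summable (transformTerm τ (u i) k))
    (hfin : weightedSq s (-b) ({z : FreqGroup τ d | z.2 ∈ filterSet d τ}.indicator
      (triConv fun i z => ‖freqLift (u i) z‖ₑ)) ≠ ∞) :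
    bourgainNorm τ s (-b) (cubic τ u) ^ 2 ≤ weightedSq s (-b)
      ({z : FreqGroup τ d | z.2 ∈ filterSet d τ}.indicator
        (triConv fun i z => ‖freqLift (u i) z‖ₑ)) := by
  -- Three lifts bring `(2π)³`, whereas the transform of a single sequence calls for `2π`.
  let D : FreqGroup τ d → ℂ := fun z => ((2 * Real.pi) ^ 2 : ℂ)⁻¹ * cubicLift u z
  have hpi : (2 * Real.pi : ℂ) ≠ 0 :=
    mul_ne_zero two_ne_zero (Complex.ofReal_ne_zero.2 Real.pi_ne_zero)
  have hD : ∀ z, ‖D z‖ₑ ≤ triConv (fun i z => ‖freqLift (u i) z‖ₑ) z := by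
    intro z
    refine le_trans ?_ (enorm_cubicLift_le u z)
    rw [← ofReal_norm, ← ofReal_norm]
    refine ENNReal.ofReal_le_ofReal ?_
    rw [norm_mul]
    refine mul_le_of_le_one_left (norm_nonneg _) ?_
    rw [norm_inv, norm_pow, norm_mul, Complex.norm_of_nonneg Real.pi_pos.le, Complex.norm_two]
    exact inv_le_one_of_one_le₀ (one_le_pow₀ (by linarith [Real.pi_gt_three]))
  have hle : weightedSq s (-b) ({z : FreqGroup τ d | z.2 ∈ filterSet d τ}.indicator
      fun z => ‖D z‖ₑ) ≤ weightedSq s (-b) ({z : FreqGroup τ d | z.2 ∈ filterSet d τ}.indicator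
        (triConv fun i z => ‖freqLift (u i) z‖ₑ)) :=
    lintegral_mono fun z => pow_le_pow_left' (mul_le_mul' le_rfl
      (Set.indicator_le_indicator (hD z))) 2
  refine (bourgainNorm_le_of_timeCoeff hs hb ((measurable_cubicLift u).const_mul _)
    (fun k hk n => ?_) (fun k hk n => ?_) (ne_top_of_le_ne_top hfin hle)).trans hle
  · have h1 : timeCoeff (fun σ : TimeCircle τ => ((2 * Real.pi) ^ 2 : ℂ)⁻¹ * cubicLift u (σ, k)) n =
        ((2 * Real.pi) ^ 2 : ℂ)⁻¹ * timeCoeff (fun σ : TimeCircle τ => cubicLift u (σ, k)) n := by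
      rw [timeCoeff, timeCoeff, ← integral_const_mul]
      refine integral_congr_ae (Filter.Eventually.of_forall fun σ => ?_)
      ring
    rw [h1, timeCoeff_cubicLift hu hk]
    field_simp
  · rw [cubic, spaceCoeff_filterOp, if_neg hk]

theorem bourgainNorm_cubic_le {s b : ℝ} (hs : 0 ≤ s) (hb : 0 ≤ b) {K : ℝ≥0}
    (hB : BilinearBound τ d s b K) {u : Fin 3 → ℤ → Torus d → ℂ}
    (hu : ∀ i, MemBourgain τ s b (u i)) :
    bourgainNorm τ s (-b) (cubic τ u) ≤ (6 * ((2 : ℝ) ^ s).toNNReal ^ 2 * K : ℝ≥0) *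
      bourgainNorm τ s b (u 0) * bourgainNorm τ s b (u 1) * bourgainNorm τ s b (u 2) := by
  have hS : ∀ i k, Summable (transformTerm τ (u i) k) := fun i => (hu i).summable
  have hle := weightedSq_triConv_le_of_nonneg hs hB
    (fun i => (measurable_freqLift (τ := τ) (u i)).enorm) (fun i => isFiltered_freqLift (u i))
  have hbd : 27 * ENNReal.ofReal (2 ^ s) ^ 4 * (K : ℝ≥0∞) ^ 2 *
      ∏ j, weightedSq s b (fun z : FreqGroup τ d => ‖freqLift (u j) z‖ₑ) ≤
      ((6 * ((2 : ℝ) ^ s).toNNReal ^ 2 * K : ℝ≥0) * bourgainNorm τ s b (u 0) *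
        bourgainNorm τ s b (u 1) * bourgainNorm τ s b (u 2)) ^ 2 := by
    -- 27 is raised to the perfect square `36 = 6²` so that the root of the constant is explicit.
    calc _ ≤ 36 * ENNReal.ofReal (2 ^ s) ^ 4 * (K : ℝ≥0∞) ^ 2 *
          ∏ j, bourgainNorm τ s b (u j) ^ 2 :=
        mul_le_mul' (by gcongr; norm_num)
          (Finset.prod_le_prod' fun j _ => weightedSq_freqLift_le (hS j))
      _ = _ := by
        rw [Fin.prod_univ_three, ENNReal.ofReal]
        push_cast
        ring
  have htop : ((6 * ((2 : ℝ) ^ s).toNNReal ^ 2 * K : ℝ≥0) * bourgainNorm τ s b (u 0) *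
        bourgainNorm τ s b (u 1) * bourgainNorm τ s b (u 2)) ^ 2 ≠ ∞ :=
    ENNReal.pow_ne_top (ENNReal.mul_ne_top (ENNReal.mul_ne_top (ENNReal.mul_ne_top
      ENNReal.coe_ne_top (hu 0).2.ne) (hu 1).2.ne) (hu 2).2.ne)
  refine (ENNReal.pow_right_strictMono two_ne_zero).le_iff_le.1 ?_
  exact (bourgainNorm_cubic_sq_le hs hb hS (ne_top_of_le_ne_top htop (hle.trans hbd))).trans
    (hle.trans hbd)

theorem bourgainNorm_zero_cubic_le {s b : ℝ} (hb : 0 ≤ b) {K : ℝ≥0}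
    (hB : BilinearBound τ d s b K) {u : Fin 3 → ℤ → Torus d → ℂ} (p : Equiv.Perm (Fin 3))
    (h0 : MemBourgain τ s b (u (p 0))) (h1 : MemBourgain τ s b (u (p 1)))
    (h2 : MemBourgain τ 0 b (u (p 2))) :
    bourgainNorm τ 0 (-b) (cubic τ u) ≤ K * bourgainNorm τ s b (u (p 0)) *
      bourgainNorm τ s b (u (p 1)) * bourgainNorm τ 0 b (u (p 2)) := by
  have hS' : ∀ i k, Summable (transformTerm τ (u (p i)) k) := by
    intro i
    fin_cases i
    · exact h0.summable
    · exact h1.summable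
    · exact h2.summable
  have hS : ∀ i k, Summable (transformTerm τ (u i) k) := fun i => by
    simpa using hS' (p.symm i)
  have hle := weightedSq_triConv_le hB
    (fun i => (measurable_freqLift (τ := τ) (u i)).enorm) (fun i => isFiltered_freqLift (u i)) (p 2)
  have hbd : (K : ℝ≥0∞) ^ 2 * ∏ j, weightedSq (if j = p 2 then 0 else s) b
      (fun z : FreqGroup τ d => ‖freqLift (u j) z‖ₑ) ≤
      (K * bourgainNorm τ s b (u (p 0)) *
        bourgainNorm τ s b (u (p 1)) * bourgainNorm τ 0 b (u (p 2))) ^ 2 := by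
    rw [← Equiv.prod_comp p, Fin.prod_univ_three]
    simp only [p.injective.eq_iff, if_true, Fin.reduceEq, if_false]
    calc _ ≤ (K : ℝ≥0∞) ^ 2 * (bourgainNorm τ s b (u (p 0)) ^ 2 *
          bourgainNorm τ s b (u (p 1)) ^ 2 * bourgainNorm τ 0 b (u (p 2)) ^ 2) :=
        mul_le_mul' le_rfl (mul_le_mul' (mul_le_mul' (weightedSq_freqLift_le (hS _))
          (weightedSq_freqLift_le (hS _))) (weightedSq_freqLift_le (hS _)))
      _ = _ := by ring
  have htop : (K * bourgainNorm τ s b (u (p 0)) *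
        bourgainNorm τ s b (u (p 1)) * bourgainNorm τ 0 b (u (p 2))) ^ 2 ≠ ∞ :=
    ENNReal.pow_ne_top (ENNReal.mul_ne_top (ENNReal.mul_ne_top (ENNReal.mul_ne_top
      ENNReal.coe_ne_top h0.2.ne) h1.2.ne) h2.2.ne)
  refine (ENNReal.pow_right_strictMono two_ne_zero).le_iff_le.1 ?_
  exact (bourgainNorm_cubic_sq_le le_rfl hb hS (ne_top_of_le_ne_top htop (hle.trans hbd))).trans
    (hle.trans hbd)

end Estimates

end DiscBourgain

end

/-! ### The three estimates for the given exponents. -/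

theorem theorem2p4 (d : ℕ) (hd : 1 ≤ d) (s₀ b₀ b₁ : ℝ)
    (hs₀ : max 0 ((d : ℝ) / 2 - 1) < s₀)
    (hb₀ : b₀ ∈ Set.Ioo (1 / 2 : ℝ) (min (1 / 2 + 1 / 4 * (s₀ - (d : ℝ) / 2 + 1)) (3 / 4)))
    (hb₁ : b₁ = 1 - b₀) :
    (∃ C : ℝ≥0, ∀ τ ∈ Set.Ioc (0 : ℝ) 1, ∀ u : ℤ → Torus d → ℂ,
      MemBourgain τ (s₀ / 2) b₁ u →
        seqLpNorm 4 τ (fun n => filterOp τ (u n)) ≤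
          C * bourgainNorm τ (s₀ / 2) b₁ u) ∧
    (∃ C : ℝ≥0, ∀ τ ∈ Set.Ioc (0 : ℝ) 1, ∀ u : Fin 3 → ℤ → Torus d → ℂ,
      (∀ i, MemBourgain τ s₀ b₁ (u i)) →
        bourgainNorm τ s₀ (-b₁) (cubic τ u) ≤
          C * bourgainNorm τ s₀ b₁ (u 0) * bourgainNorm τ s₀ b₁ (u 1) *
            bourgainNorm τ s₀ b₁ (u 2)) ∧
    (∃ C : ℝ≥0, ∀ τ ∈ Set.Ioc (0 : ℝ) 1, ∀ u : Fin 3 → ℤ → Torus d → ℂ,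
      ∀ p : Equiv.Perm (Fin 3),
      MemBourgain τ s₀ b₁ (u (p 0)) → MemBourgain τ s₀ b₁ (u (p 1)) →
      MemBourgain τ 0 b₁ (u (p 2)) →
        bourgainNorm τ 0 (-b₁) (cubic τ u) ≤
          C * bourgainNorm τ s₀ b₁ (u (p 0)) * bourgainNorm τ s₀ b₁ (u (p 1)) *
            bourgainNorm τ 0 b₁ (u (p 2))) := by
  obtain ⟨hb1, hb2⟩ := hb₀
  obtain ⟨hb3, hb4⟩ := lt_min_iff.1 hb2
  obtain ⟨hs1, -⟩ := max_lt_iff.1 hs₀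
  have hb : 0 ≤ b₁ := by linarith
  -- `1/2 < b₀ < 3/4` gives `1/4 < b₁ < 1/2`, and `b₀ < 1/2 + (s₀ - d/2 + 1)/4` is the same as `d/2
  -- < s₀ + (4 b₁ - 1)`.
  obtain ⟨K, hK⟩ := exists_lintegral_weight_le hd hs1 (b := b₁) (by linarith) (by linarith)
    (by linarith)
  refine ⟨⟨(((2 * Real.pi) ^ (d + 1)).toNNReal * (4 * K)) ^ (1 / 4 : ℝ), fun τ hτ u hu => ?_⟩,
    ⟨6 * ((2 : ℝ) ^ s₀).toNNReal ^ 2 * K, fun τ hτ u hu => ?_⟩,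
    ⟨K, fun τ hτ u p h0 h1 h2 => ?_⟩⟩
  all_goals
    have : Fact (0 < τ) := ⟨hτ.1⟩
    have hB := bilinearBound_of_lintegral_weight_le (hK τ)
  · exact seqLpNorm_filterOp_le hB hu
  · exact bourgainNorm_cubic_le hs1.le hb hB hu
  · exact bourgainNorm_zero_cubic_le hb hB p h0 h1 h2
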